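/- **Setting.** A two-player sequential game without chance nodes is played on a finite directed acyclic graph with node set $V$ and root $v_0$. Each node $v$ with a nonempty set $C(v)$ of children belongs to the leader or to the follower, who moves from $v$ to a child of $v$, possibly at random; each leaf carries a utility in $\mathbb{R}$ for each player. A history is a path from $v_0$; a (history-dependent) strategy of a player assigns to every history that ends in a non-leaf node $v$ of that player a probability distribution on $C(v)$, and $u_i(\sigma_1,\sigma_2)$ is the expected utility of player $i$. A strong Stackelberg equilibrium (SSE) is a pair $(\sigma_1,\sigma_2)$ such that $\sigma_2$ is a best response to $\sigma_1$ and $u_1(\sigma_1,\sigma_2)\ge u_1(\tau_1,\tau_2)$ for every leader strategy $\tau_1$ and every best response $\tau_2$ to $\tau_1$. A strategy profile with memory consists of a set $M$ of memory states, an initial state $m_0\in M$, an update function $\mathcal M: M\times V\times V\to M$ (the new state after a move from $v$ to $w$ in state $m$) and, for each $m\in M$ and each non-leaf node $v$, a probability distribution on $C(v)$ according to which the owner of $v$ moves when the current state is $m$; it induces a pair of history-dependent strategies. **Theorem.** There is an absolute constant $C$ such that the following hold. 1. Every two-player sequential game without chance nodes on a finite directed acyclic graph with node set $V$ has a strategy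 profile with memory that has at most $C\,|V|$ memory states and whose induced strategies form an SSE (among all history-dependent strategies). 2. There is an algorithm which, given such a game with rational utilities (written in binary), computes a strategy profile with memory that has at most $C\,|V|$ memory states and whose induced strategies form an SSE, in time polynomial in the size of the input (the number of nodes plus the total bit length of the utilities at the leaves). -/

import Mathlib

/-! ### Two-player sequential games without chance nodes -/

/-- The two players: the leader commits first, the follower best-responds. -/
inductive Player where
  | leader
  | follower

/-- A two-player sequential game without chance nodes, with utilities in `K`.  It is played on the
directed graph with node set `V` in which `children v` is the set of children of `v`; an action at
`v` is the choice of a child.  Only the values of `util` at leaves (nodes without children) are ever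
used, and the owner of a leaf is irrelevant. -/
structure Game (V : Type*) (K : Type*) where
  /-- the set of children of a node -/
  children : V → Finset V
  /-- the node at which the game starts -/
  root : V
  /-- the player who moves at a node -/
  owner : V → Player
  /-- the utility of each player at a leaf -/
  util : Player → V → K

/-- `p` is a probability distribution on the finite set `S`. -/
def IsDistribution {V : Type*} (S : Finset V) (p : V → ℝ) : Prop :=
  (∀ w, 0 ≤ p w) ∧ (∀ w, w ∉ S → p w = 0) ∧ ∑ w ∈ S, p w = 1

/-- A strategy profile with memory, with node set `V` and set `M` of memory states.
`act m v w` is the probability with which the player who owns `v` moves from `v` to `w` when the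
current memory state is `m`; `update m v w` is the memory state after that move. -/
structure MemProfile (V : Type*) (M : Type*) where
  /-- the move probabilities of the owner of each node -/
  act : M → V → V → ℝ
  /-- the memory update function -/
  update : M → V → V → M
  /-- the initial memory state -/
  init : M

namespace MemProfile

variable {V M : Type*}

/-- The memory state that is current after a history (listed with the current node first). -/
def memory (P : MemProfile V M) : List V → M
  | [] => P.init
  | [_] => P.init
  | w :: v :: h => P.update (P.memory (v :: h)) v w

/-- The history-dependent behaviour induced by a strategy profile with memory. -/
def behaviour (P : MemProfile V M) : List V → V → ℝ
  | [] => fun _ => 0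
  | v :: h => P.act (P.memory (v :: h)) v

end MemProfile

namespace Game

section Basic

variable {V K : Type*}

/-- The graph of the game has no directed cycle. -/
def Acyclic (G : Game V K) : Prop :=
  ∀ v, ¬ Relation.TransGen (fun x y => y ∈ G.children x) v v

/-- Histories, listed with the current node first and the root last. -/
inductive IsHistory (G : Game V K) : List V → Prop
  | root : IsHistory G [G.root]
  | step {v w : V} {h : List V} :
      IsHistory G (v :: h) → w ∈ G.children v → IsHistory G (w :: v :: h)

/-- `σ` is a history-dependent (behavioural) strategy of player `i`: at each history that ends at a
non-leaf node of player `i` it gives a probability distribution on the children of that node.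
Its values at all other lists are irrelevant. -/
def IsStrategy (G : Game V K) (i : Player) (σ : List V → V → ℝ) : Prop :=
  ∀ v h, G.IsHistory (v :: h) → G.owner v = i → (G.children v).Nonempty →
    IsDistribution (G.children v) (σ (v :: h))

/-- The move probabilities at a history when the leader plays `σ₁` and the follower plays `σ₂`. -/
def moveProb (G : Game V K) (σ₁ σ₂ : List V → V → ℝ) (v : V) (h : List V) : V → ℝ :=
  match G.owner v with
  | Player.leader => σ₁ (v :: h)
  | Player.follower => σ₂ (v :: h)

end Basic

section Real

variable {V : Type*}

/-- Expected utility of player `i` from the history `v :: h` on, looking at most `k` moves ahead. -/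
noncomputable def expectedFrom (G : Game V ℝ) (σ₁ σ₂ : List V → V → ℝ) (i : Player) :
    ℕ → V → List V → ℝ
  | 0, v, _ => G.util i v
  | k + 1, v, h =>
    if (G.children v).Nonempty then
      ∑ w ∈ G.children v, G.moveProb σ₁ σ₂ v h w * expectedFrom G σ₁ σ₂ i k w (v :: h)
    else G.util i v

/-- Expected utility `u_i(σ₁, σ₂)`.  In an acyclic graph no play has more than `|V|` nodes, so that
`|V|` moves of look-ahead reach a leaf along each play. -/
noncomputable def expectedUtil [Fintype V] (G : Game V ℝ) (σ₁ σ₂ : List V → V → ℝ)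
    (i : Player) : ℝ :=
  G.expectedFrom σ₁ σ₂ i (Fintype.card V) G.root []

/-- `σ₂` is a best response of the follower to the leader's strategy `σ₁`. -/
def IsBestResponse [Fintype V] (G : Game V ℝ) (σ₁ σ₂ : List V → V → ℝ) : Prop :=
  G.IsStrategy Player.follower σ₂ ∧
    ∀ τ₂, G.IsStrategy Player.follower τ₂ →
      G.expectedUtil σ₁ τ₂ Player.follower ≤ G.expectedUtil σ₁ σ₂ Player.follower

/-- `(σ₁, σ₂)` is a strong Stackelberg equilibrium: among all pairs of a leader strategy and a best
response to it, it maximizes the leader's expected utility. -/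
def IsSSE [Fintype V] (G : Game V ℝ) (σ₁ σ₂ : List V → V → ℝ) : Prop :=
  G.IsStrategy Player.leader σ₁ ∧ G.IsBestResponse σ₁ σ₂ ∧
    ∀ τ₁ τ₂, G.IsStrategy Player.leader τ₁ → G.IsBestResponse τ₁ τ₂ →
      G.expectedUtil τ₁ τ₂ Player.leader ≤ G.expectedUtil σ₁ σ₂ Player.leader

/-- `P` is a strategy profile with memory for `G`, and the history-dependent strategies that it
induces form a strong Stackelberg equilibrium (among all history-dependent strategies). -/
def IsSSEWithMemory [Fintype V] (G : Game V ℝ) {M : Type*} (P : MemProfile V M) : Prop :=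
  (∀ m v, (G.children v).Nonempty → IsDistribution (G.children v) (P.act m v)) ∧
    G.IsSSE P.behaviour P.behaviour

/-- A game with rational utilities, seen as a game with real utilities. -/
noncomputable def toReal (G : Game V ℚ) : Game V ℝ where
  children := G.children
  root := G.root
  owner := G.owner
  util := fun i v => ((G.util i v : ℚ) : ℝ)

end Real

end Game

/-! ### Algorithms: random access programs over the rationals with bit costs -/

namespace RAM

/-- The number of bits of a rational number (numerator and denominator in lowest terms). -/
def bits (q : ℚ) : ℕ := q.num.natAbs.size + q.den.size

/-- A memory: three-dimensional arrays of rational numbers; `s (a, i, j, k)` is the content of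
the cell `(i, j, k)` of the array with number `a`. -/
abbrev Mem : Type := ℕ × ℕ × ℕ × ℕ → ℚ

/-- Expressions: constants, array access, arithmetic, comparison. -/
inductive Expr where
  | const (c : ℚ)
  | read (a : ℕ) (i j k : Expr)
  | add (e f : Expr)
  | sub (e f : Expr)
  | mul (e f : Expr)
  | div (e f : Expr)
  | le (e f : Expr)

namespace Expr

/-- The value of an expression; an array subscript is rounded down to a natural number, and a
comparison has the value `1` if it holds and `0` if not. -/
def eval (s : Mem) : Expr → ℚ
  | const c => c
  | read a i j k => s (a, ⌊eval s i⌋₊, ⌊eval s j⌋₊, ⌊eval s k⌋₊)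
  | .add e f => eval s e + eval s f
  | .sub e f => eval s e - eval s f
  | .mul e f => eval s e * eval s f
  | .div e f => eval s e / eval s f
  | le e f => if eval s e ≤ eval s f then 1 else 0

/-- The cost of evaluating an expression: `1` plus the number of bits of the value, summed over all
its subexpressions. -/
def cost (s : Mem) : Expr → ℕ
  | const c => 1 + bits c
  | read a i j k =>
      1 + bits (eval s (read a i j k)) + cost s i + cost s j + cost s k
  | .add e f => 1 + bits (eval s e + eval s f) + cost s e + cost s f
  | .sub e f => 1 + bits (eval s e - eval s f) + cost s e + cost s f
  | .mul e f => 1 + bits (eval s e * eval s f) + cost s e + cost s f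
  | .div e f => 1 + bits (eval s e / eval s f) + cost s e + cost s f
  | le e f => 1 + bits (eval s (le e f)) + cost s e + cost s f

end Expr

/-- Programs: assignment to an array cell, composition, branching and loops.  Conditions are
expressions, and count as true when their value is not `0`. -/
inductive Prog where
  | skip
  | write (a : ℕ) (i j k e : Expr)
  | seq (c d : Prog)
  | cond (e : Expr) (c d : Prog)
  | loop (e : Expr) (c : Prog)

/-- `Run c s s' t`: started in the memory `s`, the program `c` halts in the memory `s'`, at total
cost `t`. -/
inductive Run : Prog → Mem → Mem → ℕ → Prop
  | skip (s : Mem) : Run Prog.skip s s 1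
  | write (s : Mem) (a : ℕ) (i j k e : Expr) :
      Run (Prog.write a i j k e) s
        (Function.update s (a, ⌊i.eval s⌋₊, ⌊j.eval s⌋₊, ⌊k.eval s⌋₊) (e.eval s))
        (1 + i.cost s + j.cost s + k.cost s + e.cost s)
  | seq {c d : Prog} {s s' s'' : Mem} {t t' : ℕ} :
      Run c s s' t → Run d s' s'' t' → Run (Prog.seq c d) s s'' (1 + t + t')
  | cond_true {e : Expr} {c d : Prog} {s s' : Mem} {t : ℕ} :
      e.eval s ≠ 0 → Run c s s' t → Run (Prog.cond e c d) s s' (1 + e.cost s + t)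
  | cond_false {e : Expr} {c d : Prog} {s s' : Mem} {t : ℕ} :
      e.eval s = 0 → Run d s s' t → Run (Prog.cond e c d) s s' (1 + e.cost s + t)
  | loop_stop {e : Expr} {c : Prog} {s : Mem} :
      e.eval s = 0 → Run (Prog.loop e c) s s (1 + e.cost s)
  | loop_step {e : Expr} {c : Prog} {s s' s'' : Mem} {t t' : ℕ} :
      e.eval s ≠ 0 → Run c s s' t → Run (Prog.loop e c) s' s'' t' →
      Run (Prog.loop e c) s s'' (1 + e.cost s + t + t')

end RAM

namespace Game

variable {n : ℕ}

/-- The utility at a leaf, and `0` at any other node. -/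
def leafUtil (G : Game (Fin n) ℚ) (i : Player) (v : Fin n) : ℚ :=
  if (G.children v).Nonempty then 0 else G.util i v

/-- The input size: the number of nodes plus the number of bits of the utilities. -/
def size (G : Game (Fin n) ℚ) : ℕ :=
  n + ∑ v, (RAM.bits (G.leafUtil Player.leader v) + RAM.bits (G.leafUtil Player.follower v))

/-- The initial memory for the input `G`: array `0` holds the number of nodes and the root, array
`1` the adjacency matrix, array `2` the owners (`1` for the leader, `2` for the follower), arrays
`3` and `4` the utilities of the leader and of the follower at the leaves. -/
def input (G : Game (Fin n) ℚ) : RAM.Mem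
  | (0, 0, 0, 0) => n
  | (0, 1, 0, 0) => (G.root : ℕ)
  | (1, v, w, 0) =>
      if h : v < n ∧ w < n then
        if (⟨w, h.2⟩ : Fin n) ∈ G.children ⟨v, h.1⟩ then 1 else 0
      else 0
  | (2, v, 0, 0) =>
      if h : v < n then
        match G.owner ⟨v, h⟩ with
        | Player.leader => 1
        | Player.follower => 2
      else 0
  | (3, v, 0, 0) => if h : v < n then G.leafUtil Player.leader ⟨v, h⟩ else 0
  | (4, v, 0, 0) => if h : v < n then G.leafUtil Player.follower ⟨v, h⟩ else 0
  | _ => 0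

end Game

/-- The final memory `s` describes the strategy profile with memory `P` on the nodes `Fin n` with
memory states `Fin k`: array `5` holds the number of memory states and the initial memory state,
array `6` the table of move probabilities, array `7` the table of the memory update function. -/
def MemProfile.IsOutput {n k : ℕ} (P : MemProfile (Fin n) (Fin k)) (s : RAM.Mem) : Prop :=
  s (5, 0, 0, 0) = k ∧ s (5, 1, 0, 0) = (P.init : ℕ) ∧
    (∀ (m : Fin k) (v w : Fin n), ((s (6, m, v, w) : ℚ) : ℝ) = P.act m v w) ∧
    ∀ (m : Fin k) (v w : Fin n), s (7, m, v, w) = (P.update m v w : ℕ)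

/-! After a history, all that earlier incentives depend on is the utility that the follower still
expects. A profile can therefore use as memory a promise of utility to the follower. A promise at a
follower node is enforceable as soon as it is at least the minimax value `low` there: every
deviation is answered by an absorbing punishing state, in which the leader holds the follower down
to `low`. This gives a dynamic program for the most that the leader can get at a node while keeping
a given promise. A follower node hands the promise on unchanged to one child and discards promises
below `low`; a leader node may mix two children whose promises average to the given one.

The main point is that the follower's leaf utilities suffice as promises. Each outcome (follower
utility, leader utility) of a leader strategy and a best response lies below a segment whose ends
are over such targets, and the table lies above this segment at all targets in between (`Below`).
Mixing at a leader node preserves this, because in the plane a convex combination lies below one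
point or below a segment between two of them (`exists_segment_above`, `Tables.Valid.below_leader`).
Truncation at a follower node preserves it, because `low` is itself a leaf utility
(`Tables.Valid.below_follower`). A linear function on a segment is largest at an end, so no outcome
beats the best table entry at the root (`Tables.Valid.below`). Conversely the profile read off from
the tables attains that entry, and its follower strategy is a best response
(`Tables.Implements.values`). With one target per node and one punishing state there are `|V| + 1`
memory states.

For the algorithm, the equations of the dynamic program determine the values at a node from those at
its children, so `|V|` synchronous rounds reach the solution without sorting the graph
(`eq_of_levels`). An entry is found by exhaustive search over two children and two targets. Each
round multiplies a common denominator of the entries by one fixed number `weightDen`, and convex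
combinations do not increase absolute values, so all numbers keep polynomially many bits. A
total-correctness calculus for programs with counting loops (`Ensures`) keeps track of running time
and bit lengths together. -/

namespace Game

/-! ### Induction along an acyclic graph -/

section Rank

variable {V K : Type*}

/-- The number of proper descendants is a rank function on an acyclic graph. -/
theorem Acyclic.exists_rank [Fintype V] {G : Game V K} (hG : G.Acyclic) :
    ∃ rank : V → ℕ, (∀ v, ∀ w ∈ G.children v, rank w < rank v) ∧
      ∀ v, rank v < Fintype.card V := by
  classical
  refine ⟨fun v => (Finset.univ.filter fun u =>
    Relation.TransGen (fun x y => y ∈ G.children x) v u).card, ?_, ?_⟩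
  · intro v w hw
    apply Finset.card_lt_card
    rw [Finset.ssubset_iff_of_subset]
    · exact ⟨w, by simpa using .single hw, by simpa using hG w⟩
    · intro u hu
      simp only [Finset.mem_filter, Finset.mem_univ, true_and] at hu ⊢
      exact .head hw hu
  · intro v
    exact Finset.card_lt_univ_of_notMem (x := v) (by simpa using hG v)

/-- Induction on the number of moves of look-ahead, which has to suffice to reach the leaves. -/
theorem fuel_induction {G : Game V K} {rank : V → ℕ}
    (hr : ∀ v, ∀ w ∈ G.children v, rank w < rank v) {C : ℕ → V → Prop}
    (leaf : ∀ k v, G.children v = ∅ → C k v)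
    (step : ∀ k v, (G.children v).Nonempty → rank v ≤ k + 1 →
      (∀ w ∈ G.children v, rank w ≤ k) →
      (∀ w ∈ G.children v, C k w) → C (k + 1) v) :
    ∀ k v, rank v ≤ k → C k v := by
  intro k
  induction k with
  | zero =>
    intro v hv
    apply leaf
    rw [Finset.eq_empty_iff_forall_notMem]
    intro w hw
    have := hr v w hw
    omega
  | succ k ih =>
    intro v hv
    rcases (G.children v).eq_empty_or_nonempty with h | h
    · exact leaf _ _ h
    · have hk : ∀ w ∈ G.children v, rank w ≤ k := fun w hw => by
        have := hr v w hw
        omega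
      exact step k v h hv hk fun w hw => ih w (hk w hw)

/-- If the values at a level are determined by those of the children at the level before, then they
stabilize. -/
theorem eq_of_levels {α : Type*} {G : Game V K} {rank : V → ℕ}
    (hr : ∀ v, ∀ w ∈ G.children v, rank w < rank v)
    {R : V → (V → α) → α → Prop}
    (hR : ∀ v g g' a a', (∀ w ∈ G.children v, g w = g' w) → R v g a → R v g' a' → a = a')
    {f : ℕ → V → α} {N : ℕ} (hf : ∀ r < N, ∀ v, R v (f r) (f (r + 1) v)) :
    ∀ k v, rank v = k → ∀ r r', rank v < r → rank v < r' → r ≤ N → r' ≤ N → f r v = f r' v := by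
  intro k
  induction k using Nat.strong_induction_on with
  | _ k ih =>
    rintro v rfl (_ | r) (_ | r') h h' hN hN'
    · omega
    · omega
    · omega
    -- Both levels exceed the rank and so are positive; each value is determined by the level
    -- before, where the children, having smaller rank, have already stabilized.
    · refine hR v _ _ _ _ ?_ (hf r (by omega) v) (hf r' (by omega) v)
      intro w hw
      have := hr v w hw
      exact ih _ this w rfl r r' (by omega) (by omega) (by omega) (by omega)

end Rank

/-! ### Values against a fixed leader strategy, and best responses -/

section Values

variable {V : Type*} {G : Game V ℝ}

theorem expectedFrom_leaf (σ₁ σ₂ : List V → V → ℝ) (i : Player) (k : ℕ) {v : V} (h : List V)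
    (hv : G.children v = ∅) : G.expectedFrom σ₁ σ₂ i k v h = G.util i v := by
  cases k <;> simp [expectedFrom, hv]

theorem expectedFrom_succ (σ₁ σ₂ : List V → V → ℝ) (i : Player) (k : ℕ) {v : V} (h : List V)
    (hv : (G.children v).Nonempty) : G.expectedFrom σ₁ σ₂ i (k + 1) v h =
      ∑ w ∈ G.children v, G.moveProb σ₁ σ₂ v h w * G.expectedFrom σ₁ σ₂ i k w (v :: h) := by
  simp [expectedFrom, hv]

/-- The largest expected utility that the follower can attain against `σ`. -/
noncomputable def bestFrom (G : Game V ℝ) (σ : List V → V → ℝ) : ℕ → V → List V → ℝ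
  | 0, v, _ => G.util Player.follower v
  | k + 1, v, h =>
    if hv : (G.children v).Nonempty then
      match G.owner v with
      | Player.leader => ∑ w ∈ G.children v, σ (v :: h) w * bestFrom G σ k w (v :: h)
      | Player.follower => (G.children v).sup' hv fun w => bestFrom G σ k w (v :: h)
    else G.util Player.follower v

theorem bestFrom_leaf (σ : List V → V → ℝ) (k : ℕ) {v : V} (h : List V)
    (hv : G.children v = ∅) : G.bestFrom σ k v h = G.util Player.follower v := by
  cases k <;> simp [bestFrom, hv]

theorem bestFrom_leader (σ : List V → V → ℝ) (k : ℕ) {v : V} (h : List V)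
    (hv : (G.children v).Nonempty) (ho : G.owner v = Player.leader) :
    G.bestFrom σ (k + 1) v h =
      ∑ w ∈ G.children v, σ (v :: h) w * G.bestFrom σ k w (v :: h) := by
  simp [bestFrom, hv, ho]

theorem bestFrom_follower (σ : List V → V → ℝ) (k : ℕ) {v : V} (h : List V)
    (hv : (G.children v).Nonempty) (ho : G.owner v = Player.follower) :
    G.bestFrom σ (k + 1) v h =
      (G.children v).sup' hv fun w => G.bestFrom σ k w (v :: h) := by
  simp [bestFrom, hv, ho]

theorem sum_mul_le_of_isDistribution {S : Finset V} {p f : V → ℝ} {c : ℝ}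
    (hp : IsDistribution S p) (hf : ∀ w ∈ S, f w ≤ c) : ∑ w ∈ S, p w * f w ≤ c :=
  calc ∑ w ∈ S, p w * f w ≤ ∑ w ∈ S, p w * c :=
        Finset.sum_le_sum fun w hw => mul_le_mul_of_nonneg_left (hf w hw) (hp.1 w)
    _ = c := by rw [← Finset.sum_mul, hp.2.2, one_mul]

theorem le_sum_mul_of_isDistribution {S : Finset V} {p f : V → ℝ} {c : ℝ}
    (hp : IsDistribution S p) (hf : ∀ w ∈ S, c ≤ f w) : c ≤ ∑ w ∈ S, p w * f w :=
  calc c = ∑ w ∈ S, p w * c := by rw [← Finset.sum_mul, hp.2.2, one_mul]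
    _ ≤ ∑ w ∈ S, p w * f w :=
        Finset.sum_le_sum fun w hw => mul_le_mul_of_nonneg_left (hf w hw) (hp.1 w)

/-- If a weighted average attains an upper bound termwise, so does each term of positive weight. -/
theorem eq_of_sum_mul_eq {S : Finset V} {p f g : V → ℝ} (hp : ∀ w, 0 ≤ p w)
    (hfg : ∀ w ∈ S, f w ≤ g w) (h : ∑ w ∈ S, p w * f w = ∑ w ∈ S, p w * g w) {w : V}
    (hw : w ∈ S) (hpw : 0 < p w) : f w = g w := by
  have := (Finset.sum_eq_sum_iff_of_le
    (fun w hw => mul_le_mul_of_nonneg_left (hfg w hw) (hp w))).1 h w hw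
  exact mul_left_cancel₀ hpw.ne' this

theorem IsStrategy.moveProb {σ₁ σ₂ : List V → V → ℝ} (h₁ : G.IsStrategy Player.leader σ₁)
    (h₂ : G.IsStrategy Player.follower σ₂) {v : V} {h : List V} (hh : G.IsHistory (v :: h))
    (hv : (G.children v).Nonempty) :
    IsDistribution (G.children v) (G.moveProb σ₁ σ₂ v h) := by
  unfold Game.moveProb
  rcases ho : G.owner v with _ | _
  · exact h₁ v h hh ho hv
  · exact h₂ v h hh ho hv

variable {rank : V → ℕ}

theorem expectedFrom_le_bestFrom (hr : ∀ v, ∀ w ∈ G.children v, rank w < rank v)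
    {σ₁ σ₂ : List V → V → ℝ} (h₁ : G.IsStrategy Player.leader σ₁)
    (h₂ : G.IsStrategy Player.follower σ₂) :
    ∀ k v, rank v ≤ k → ∀ h, G.IsHistory (v :: h) →
      G.expectedFrom σ₁ σ₂ Player.follower k v h ≤ G.bestFrom σ₁ k v h := by
  refine fuel_induction hr (C := fun k v => ∀ h, G.IsHistory (v :: h) →
      G.expectedFrom σ₁ σ₂ Player.follower k v h ≤ G.bestFrom σ₁ k v h) ?_ ?_
  · intro k v hv h _
    rw [expectedFrom_leaf _ _ _ _ _ hv, bestFrom_leaf _ _ _ hv]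
  · intro k v hv _ _ ih h hh
    have hp := h₁.moveProb h₂ hh hv
    rw [expectedFrom_succ _ _ _ _ _ hv]
    rcases ho : G.owner v with _ | _
    · rw [bestFrom_leader _ _ _ hv ho]
      refine Finset.sum_le_sum fun w hw => ?_
      have : G.moveProb σ₁ σ₂ v h w = σ₁ (v :: h) w := by simp [Game.moveProb, ho]
      rw [← this]
      exact mul_le_mul_of_nonneg_left (ih w hw _ (hh.step hw)) (hp.1 w)
    · rw [bestFrom_follower _ _ _ hv ho]
      exact sum_mul_le_of_isDistribution hp fun w hw => (ih w hw _ (hh.step hw)).trans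
        (Finset.le_sup' (fun w => G.bestFrom σ₁ k w (v :: h)) hw)

theorem bestFrom_fuel (hr : ∀ v, ∀ w ∈ G.children v, rank w < rank v) (σ : List V → V → ℝ) :
    ∀ k v, rank v ≤ k → ∀ k', rank v ≤ k' → ∀ h, G.bestFrom σ k v h = G.bestFrom σ k' v h := by
  refine fuel_induction hr (C := fun k v => ∀ k', rank v ≤ k' → ∀ h,
      G.bestFrom σ k v h = G.bestFrom σ k' v h) ?_ ?_
  · intro k v hv k' _ h
    rw [bestFrom_leaf _ _ _ hv, bestFrom_leaf _ _ _ hv]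
  · intro k v hv _ hk ih k' hk' h
    obtain ⟨w, hw⟩ := hv
    have h0 := hr v w hw
    obtain ⟨k', rfl⟩ : ∃ l, k' = l + 1 := ⟨k' - 1, by omega⟩
    have key : ∀ w ∈ G.children v, G.bestFrom σ k w (v :: h) = G.bestFrom σ k' w (v :: h) :=
      fun w hw => ih w hw k' (by have := hr v w hw; omega) _
    rcases ho : G.owner v with _ | _
    · rw [bestFrom_leader _ _ _ ⟨w, hw⟩ ho, bestFrom_leader _ _ _ ⟨w, hw⟩ ho]
      exact Finset.sum_congr rfl fun w hw => by rw [key w hw]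
    · rw [bestFrom_follower _ _ _ ⟨w, hw⟩ ho, bestFrom_follower _ _ _ ⟨w, hw⟩ ho]
      exact Finset.sup'_congr _ rfl key

/-- Backward induction: the pure reply that moves at each history to a child of largest `bestFrom`
is optimal from all histories at once. -/
theorem exists_expectedFrom_eq_bestFrom (hr : ∀ v, ∀ w ∈ G.children v, rank w < rank v)
    (σ : List V → V → ℝ) :
    ∃ τ, G.IsStrategy Player.follower τ ∧ ∀ k v, rank v ≤ k → ∀ h,
      G.expectedFrom σ τ Player.follower k v h = G.bestFrom σ k v h := by
  classical
  -- The children are compared with look-ahead `rank w`, so that the choice does not depend on `k`;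
  -- by `bestFrom_fuel` any sufficient look-ahead gives the same values.
  have hmax : ∀ (v : V) (h : List V), ∃ w, (G.children v).Nonempty → w ∈ G.children v ∧
      ∀ w' ∈ G.children v, G.bestFrom σ (rank w') w' (v :: h) ≤
        G.bestFrom σ (rank w) w (v :: h) := by
    intro v h
    by_cases hv : (G.children v).Nonempty
    · obtain ⟨w, hw, hmax⟩ := Finset.exists_max_image (G.children v)
        (fun w => G.bestFrom σ (rank w) w (v :: h)) hv
      exact ⟨w, fun _ => ⟨hw, hmax⟩⟩
    · exact ⟨v, fun h => absurd h hv⟩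
  choose b hb using hmax
  refine ⟨fun l w => match l with
    | [] => 0
    | v :: h => if w = b v h then 1 else 0, ?_, ?_⟩
  · intro v h _ _ hv
    refine ⟨fun w => ?_, fun w hw => ?_, ?_⟩
    · dsimp only
      split_ifs <;> norm_num
    · have : w ≠ b v h := fun h' => hw (h' ▸ (hb v h hv).1)
      simp [this]
    · simp [(hb v h hv).1]
  · refine fuel_induction hr (C := fun k v => ∀ h,
        G.expectedFrom σ _ Player.follower k v h = G.bestFrom σ k v h) ?_ ?_
    · intro k v hv h
      rw [expectedFrom_leaf _ _ _ _ _ hv, bestFrom_leaf _ _ _ hv]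
    · intro k v hv _ hk ih h
      rw [expectedFrom_succ _ _ _ _ _ hv]
      rcases ho : G.owner v with _ | _
      · rw [bestFrom_leader _ _ _ hv ho]
        refine Finset.sum_congr rfl fun w hw => ?_
        rw [ih w hw]
        simp [Game.moveProb, ho]
      · rw [bestFrom_follower _ _ _ hv ho]
        obtain ⟨hbm, hbmax⟩ := hb v h hv
        simp only [Game.moveProb, ho, ite_mul, one_mul, zero_mul, Finset.sum_ite_eq', hbm, if_true]
        rw [ih _ hbm]
        refine le_antisymm (Finset.le_sup' (fun w => G.bestFrom σ k w (v :: h)) hbm) ?_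
        refine Finset.sup'_le _ _ fun w hw => ?_
        rw [bestFrom_fuel hr σ k w (hk w hw) _ le_rfl,
          bestFrom_fuel hr σ k _ (hk _ hbm) _ le_rfl]
        exact hbmax w hw

variable [Fintype V]

/-- Replaces the comparison with all replies by one equation at the root, which can be passed down
to the children. -/
theorem isBestResponse_iff (hr : ∀ v, ∀ w ∈ G.children v, rank w < rank v)
    (hc : ∀ v, rank v < Fintype.card V) {σ₁ σ₂ : List V → V → ℝ}
    (h₁ : G.IsStrategy Player.leader σ₁) (h₂ : G.IsStrategy Player.follower σ₂) :
    G.IsBestResponse σ₁ σ₂ ↔ G.expectedUtil σ₁ σ₂ Player.follower =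
      G.bestFrom σ₁ (Fintype.card V) G.root [] := by
  have hle : ∀ {τ}, G.IsStrategy Player.follower τ →
      G.expectedUtil σ₁ τ Player.follower ≤ G.bestFrom σ₁ (Fintype.card V) G.root [] :=
    fun hτ => expectedFrom_le_bestFrom hr h₁ hτ _ _ (hc _).le _ .root
  constructor
  · intro h
    obtain ⟨τ, hτ, hτb⟩ := exists_expectedFrom_eq_bestFrom hr σ₁
    refine le_antisymm (hle h₂) ?_
    rw [← hτb _ _ (hc _).le]
    exact h.2 τ hτ
  · intro h
    exact ⟨h₂, fun τ hτ => h ▸ hle hτ⟩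

end Values

end Game

namespace Game

/-! ### Convex combinations in the plane -/

section Planar

/-- A convex combination of finitely many points of the plane lies below one of the points or below
a segment between two of them. -/
theorem exists_segment_above {ι : Type*} (s : Finset ι) (q X Y : ι → ℝ) (hq : ∀ i ∈ s, 0 ≤ q i)
    (hs : ∑ i ∈ s, q i = 1) {a b : ℝ} (hb : ∑ i ∈ s, q i * X i = b)
    (ha : a ≤ ∑ i ∈ s, q i * Y i) :
    (∃ i ∈ s, X i = b ∧ a ≤ Y i) ∨
      ∃ i ∈ s, ∃ k ∈ s, X i < b ∧ b < X k ∧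
        a * (X k - X i) ≤ Y i * (X k - b) + Y k * (b - X i) := by
  classical
  by_contra! hcon
  obtain ⟨h₁, h₂⟩ := hcon
  -- If nothing passes above `(b, a)`, the slopes from it to all points on its right are smaller
  -- than the slopes to all points on its left. A line through `(b, a)` with a slope `c` in between
  -- is strictly above every point, hence above their average.
  obtain ⟨c, hc₁, hc₂⟩ := Order.exists_between_finsets
    (lo := (s.filter fun k => b < X k).image fun k => (Y k - a) / (X k - b))
    (hi := (s.filter fun i => X i < b).image fun i => (a - Y i) / (b - X i)) (by
      intro x hx y hy
      simp only [Finset.mem_image, Finset.mem_filter] at hx hy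
      obtain ⟨k, ⟨hk, hkb⟩, rfl⟩ := hx
      obtain ⟨i, ⟨hi, hib⟩, rfl⟩ := hy
      have := h₂ i hi k hk hib hkb
      rw [div_lt_div_iff₀ (by linarith) (by linarith)]
      nlinarith)
  have hneg : ∀ i ∈ s, Y i - a - c * (X i - b) < 0 := by
    intro i hi
    rcases lt_trichotomy (X i) b with h | h | h
    · have := hc₂ _ (Finset.mem_image_of_mem _ (Finset.mem_filter.2 ⟨hi, h⟩))
      rw [lt_div_iff₀ (by linarith)] at this
      nlinarith
    · have := h₁ i hi h
      rw [h]
      linarith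
    · have := hc₁ _ (Finset.mem_image_of_mem _ (Finset.mem_filter.2 ⟨hi, h⟩))
      rw [div_lt_iff₀ (by linarith)] at this
      nlinarith
  have hsum : ∑ i ∈ s, q i * (Y i - a - c * (X i - b)) < 0 := by
    obtain ⟨i, hi, hqi⟩ : ∃ i ∈ s, 0 < q i := by
      by_contra! h
      have : ∑ i ∈ s, q i ≤ 0 := Finset.sum_nonpos h
      linarith
    calc _ < ∑ i ∈ s, (0 : ℝ) := Finset.sum_lt_sum
          (fun i hi => mul_nonpos_of_nonneg_of_nonpos (hq i hi) (hneg i hi).le)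
          ⟨i, hi, mul_neg_of_pos_of_neg hqi (hneg i hi)⟩
      _ = 0 := by simp
  have : ∑ i ∈ s, q i * (Y i - a - c * (X i - b)) =
      ∑ i ∈ s, q i * Y i - a * ∑ i ∈ s, q i - c * (∑ i ∈ s, q i * X i - b * ∑ i ∈ s, q i) := by
    simp only [Finset.mul_sum, ← Finset.sum_sub_distrib]
    exact Finset.sum_congr rfl fun i _ => by ring
  rw [this, hs, hb] at hsum
  linarith

end Planar

/-! ### The equations of the dynamic program -/

section Tables

variable {V M K : Type*} [Field K] [LinearOrder K] [IsStrictOrderedRing K]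

/-- The weight of `j₁` in a combination of the targets `j₁` and `j₂` with mean `x j`; it is `0` if
the two targets agree. -/
def weight (x : M → K) (j j₁ j₂ : M) : K := (x j₂ - x j) / (x j₂ - x j₁)

theorem weight_nonneg {x : M → K} {j j₁ j₂ : M} (h₁ : x j₁ ≤ x j) (h₂ : x j ≤ x j₂) :
    0 ≤ weight x j j₁ j₂ :=
  div_nonneg (by linarith) (by linarith)

theorem weight_le_one {x : M → K} {j j₁ j₂ : M} (h₁ : x j₁ ≤ x j) (h₂ : x j ≤ x j₂) :
    weight x j j₁ j₂ ≤ 1 :=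
  div_le_one_of_le₀ (by linarith) (by linarith)

-- Division by zero gives `0`. A deterministic move is thus encoded by two equal promises, and then
-- the second child is taken with certainty.
omit [LinearOrder K] [IsStrictOrderedRing K] in
theorem weight_eq_zero {x : M → K} {j j₁ j₂ : M} (h : x j₁ = x j₂) : weight x j j₁ j₂ = 0 := by
  simp [weight, h]

theorem weight_combination {x : M → K} {j j₁ j₂ : M} (h₁ : x j₁ ≤ x j) (h₂ : x j ≤ x j₂) :
    weight x j j₁ j₂ * x j₁ + (1 - weight x j j₁ j₂) * x j₂ = x j := by
  rcases eq_or_ne (x j₁) (x j₂) with h | h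
  · rw [weight_eq_zero h]
    linarith
  · have : x j₂ - x j₁ ≠ 0 := sub_ne_zero.2 h.symm
    unfold weight
    field_simp
    ring

/-- From the node `v`, with the promise `x j` of utility to the follower, the owner may move to `w₁`
with promise `x j₁` or to `w₂` with promise `x j₂`, and this gives the leader the utility `y`.
Here `low` are the security levels of the follower and `T` is the table of utilities that the leader
can attain with a given promise. -/
structure Admissible (G : Game V K) (low : V → K) (x : M → K) (T : V → M → Option K) (v : V) (j : M)
    (w₁ : V) (j₁ : M) (w₂ : V) (j₂ : M) (y : K) : Prop where
  mem₁ : w₁ ∈ G.children v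
  mem₂ : w₂ ∈ G.children v
  le₁ : x j₁ ≤ x j
  le₂ : x j ≤ x j₂
  low_le : low v ≤ x j
  -- The next memory state is a function of the move, so two different promises require two
  -- different children. Only the leader mixes different promises, as the follower has to be
  -- indifferent.
  eq_or_leader : x j₁ = x j₂ ∨ G.owner v = Player.leader ∧ w₁ ≠ w₂
  value : ∃ y₁ y₂, T w₁ j₁ = some y₁ ∧ T w₂ j₂ = some y₂ ∧
    y = weight x j j₁ j₂ * y₁ + (1 - weight x j j₁ j₂) * y₂

omit [IsStrictOrderedRing K] in
theorem Admissible.congr {G : Game V K} {low : V → K} {x : M → K} {T T' : V → M → Option K} {v : V}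
    {j : M} {w₁ : V} {j₁ : M} {w₂ : V} {j₂ : M} {y : K} (hT : ∀ w ∈ G.children v, T w = T' w)
    (h : Admissible G low x T v j w₁ j₁ w₂ j₂ y) : Admissible G low x T' v j w₁ j₁ w₂ j₂ y :=
  { h with value := by simpa only [← hT _ h.mem₁, ← hT _ h.mem₂] using h.value }

/-- The security level `a` of the follower at `v` in terms of those of the children. -/
structure IsLow (G : Game V K) (v : V) (low : V → K) (a : K) : Prop where
  leaf : G.children v = ∅ → a = G.util Player.follower v
  leader : G.owner v = Player.leader → ∀ w ∈ G.children v, a ≤ low w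
  follower : G.owner v = Player.follower → ∀ w ∈ G.children v, low w ≤ a
  attained : (G.children v).Nonempty → ∃ w ∈ G.children v, low w = a

/-- The row of the table at `v` in terms of the rows of the children. -/
structure IsRow (G : Game V K) (low : V → K) (x : M → K) (pun : M) (v : V) (T : V → M → Option K)
    (row : M → Option K) : Prop where
  pun_eq : row pun = none
  leaf : G.children v = ∅ → ∀ j ≠ pun, ∀ y, row j = some y ↔
    x j = G.util Player.follower v ∧ y = G.util Player.leader v
  ge : ∀ j ≠ pun, ∀ w₁ j₁ w₂ j₂ y, Admissible G low x T v j w₁ j₁ w₂ j₂ y →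
    ∃ y', row j = some y' ∧ y ≤ y'
  attained : (G.children v).Nonempty → ∀ j y, row j = some y →
    ∃ w₁ j₁ w₂ j₂, Admissible G low x T v j w₁ j₁ w₂ j₂ y

omit [Field K] [IsStrictOrderedRing K] in
theorem IsLow.congr {G : Game V K} {v : V} {low low' : V → K} {a : K}
    (hl : ∀ w ∈ G.children v, low w = low' w) (h : IsLow G v low a) : IsLow G v low' a where
  leaf := h.leaf
  leader ho w hw := by rw [← hl w hw]; exact h.leader ho w hw
  follower ho w hw := by rw [← hl w hw]; exact h.follower ho w hw
  attained hv := by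
    obtain ⟨w, hw, he⟩ := h.attained hv
    exact ⟨w, hw, by rw [← hl w hw, he]⟩

-- Uniqueness, here and in `IsRow.unique`, is what makes the rounds of the iteration stabilize.
omit [Field K] [IsStrictOrderedRing K] in
theorem IsLow.unique {G : Game V K} {v : V} {low low' : V → K} {a a' : K}
    (hl : ∀ w ∈ G.children v, low w = low' w) (h : IsLow G v low a) (h' : IsLow G v low' a') :
    a = a' := by
  have h := h.congr hl
  rcases (G.children v).eq_empty_or_nonempty with hv | hv
  · rw [h.leaf hv, h'.leaf hv]
  · obtain ⟨w, hw, rfl⟩ := h.attained hv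
    obtain ⟨w', hw', rfl⟩ := h'.attained hv
    rcases ho : G.owner v with _ | _
    · exact le_antisymm (h.leader ho _ hw') (h'.leader ho _ hw)
    · exact le_antisymm (h'.follower ho _ hw) (h.follower ho _ hw')

omit [IsStrictOrderedRing K] in
theorem IsRow.congr {G : Game V K} {low : V → K} {x : M → K} {pun : M} {v : V}
    {T T' : V → M → Option K} {row : M → Option K} (hT : ∀ w ∈ G.children v, T w = T' w)
    (h : IsRow G low x pun v T row) : IsRow G low x pun v T' row where
  pun_eq := h.pun_eq
  leaf := h.leaf
  ge j hj _ _ _ _ _ hA := h.ge j hj _ _ _ _ _ (hA.congr fun w hw => (hT w hw).symm)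
  attained hv j y hy := by
    obtain ⟨w₁, j₁, w₂, j₂, hA⟩ := h.attained hv j y hy
    exact ⟨w₁, j₁, w₂, j₂, hA.congr hT⟩

omit [IsStrictOrderedRing K] in
theorem IsRow.ne_pun {G : Game V K} {low : V → K} {x : M → K} {pun : M} {v : V}
    {T : V → M → Option K} {row : M → Option K} (h : IsRow G low x pun v T row) {j : M} {y : K}
    (hy : row j = some y) : j ≠ pun := by
  rintro rfl
  simp [h.pun_eq] at hy

-- At an inner node each entry of one row comes from an admissible candidate and is therefore
-- dominated by the entry of the other row; by symmetry they agree.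
omit [IsStrictOrderedRing K] in
theorem IsRow.unique {G : Game V K} {low : V → K} {x : M → K} {pun : M} {v : V}
    {T T' : V → M → Option K} {row row' : M → Option K} (hT : ∀ w ∈ G.children v, T w = T' w)
    (h : IsRow G low x pun v T row) (h' : IsRow G low x pun v T' row') : row = row' := by
  have h := h.congr hT
  have key : ∀ {r r' : M → Option K}, IsRow G low x pun v T' r → IsRow G low x pun v T' r' →
      (G.children v).Nonempty → ∀ j y, r j = some y → ∃ y', r' j = some y' ∧ y ≤ y' := by
    intro r r' hr hr' hv j y hy
    obtain ⟨w₁, j₁, w₂, j₂, hA⟩ := hr.attained hv j y hy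
    exact hr'.ge j (hr.ne_pun hy) _ _ _ _ _ hA
  funext j
  rcases eq_or_ne j pun with rfl | hj
  · rw [h.pun_eq, h'.pun_eq]
  rcases (G.children v).eq_empty_or_nonempty with hv | hv
  · ext y
    rw [h.leaf hv j hj, h'.leaf hv j hj]
  · ext y
    constructor
    · intro hy
      obtain ⟨y', hy', hle⟩ := key h h' hv j y hy
      obtain ⟨y'', hy'', hle'⟩ := key h' h hv j y' hy'
      rw [hy] at hy''
      obtain rfl := Option.some.inj hy''
      rw [hy', le_antisymm hle hle']
    · intro hy
      obtain ⟨y', hy', hle⟩ := key h' h hv j y hy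
      obtain ⟨y'', hy'', hle'⟩ := key h h' hv j y' hy'
      rw [hy] at hy''
      obtain rfl := Option.some.inj hy''
      rw [hy', le_antisymm hle hle']

/-- The data from which a profile is read off: the security levels of the follower, the table of
utilities attainable by the leader, and for each memory state and node the two children to move to
and the next two memory states. -/
structure Tables (V M K : Type*) where
  /-- the security level of the follower -/
  low : V → K
  /-- the utility that the leader can attain with a given promise to the follower -/
  val : V → M → Option K
  /-- the first child -/
  fst : M → V → V
  /-- the memory state at the first child -/
  fstMem : M → V → M
  /-- the second child -/
  snd : M → V → V
  /-- the memory state at the second child -/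
  sndMem : M → V → M

/-- The tables satisfy the equations of the dynamic program for the targets `x`; the memory state
`pun` is the one in which the leader punishes the follower. -/
structure Tables.Valid (t : Tables V M K) (G : Game V K) (x : M → K) (pun : M) : Prop where
  low : ∀ v, IsLow G v t.low (t.low v)
  row : ∀ v, IsRow G t.low x pun v t.val (t.val v)
  target : ∀ v, G.children v = ∅ → ∃ j ≠ pun, x j = G.util Player.follower v
  move : ∀ v, (G.children v).Nonempty → ∀ j y, t.val v j = some y →
    Admissible G t.low x t.val v j (t.fst j v) (t.fstMem j v) (t.snd j v) (t.sndMem j v) y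
  punish : ∀ v, (G.children v).Nonempty → ∀ j, t.val v j = none →
    t.fst j v ∈ G.children v ∧ t.fstMem j v = pun ∧ t.snd j v ∈ G.children v ∧
      t.sndMem j v = pun ∧ t.low (t.snd j v) = t.low v

end Tables

/-! ### Valid tables yield a strong Stackelberg equilibrium -/

section Profile

variable {V M : Type*} {G : Game V ℝ} {t : Tables V M ℝ} {x : M → ℝ} {pun : M}

open Classical in
/-- The profile `P` plays according to the tables `t`. -/
structure Tables.Implements (t : Tables V M ℝ) (G : Game V ℝ) (x : M → ℝ) (pun : M)
    (P : MemProfile V M) : Prop where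
  act : ∀ j v, (G.children v).Nonempty → ∀ w, P.act j v w =
    (if w = t.fst j v then weight x j (t.fstMem j v) (t.sndMem j v) else 0) +
      if w = t.snd j v then 1 - weight x j (t.fstMem j v) (t.sndMem j v) else 0
  update : ∀ j v, (G.children v).Nonempty → ∀ w, P.update j v w =
    if w = t.snd j v then t.sndMem j v else if w = t.fst j v then t.fstMem j v else pun

variable {P : MemProfile V M}

theorem Tables.Valid.mem (ht : t.Valid G x pun) {v : V} (hv : (G.children v).Nonempty) (j : M) :
    t.fst j v ∈ G.children v ∧ t.snd j v ∈ G.children v := by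
  rcases h : t.val v j with _ | y
  · exact ⟨(ht.punish v hv j h).1, (ht.punish v hv j h).2.2.1⟩
  · exact ⟨(ht.move v hv j y h).mem₁, (ht.move v hv j y h).mem₂⟩

theorem Tables.Implements.sum_act (hP : t.Implements G x pun P) (ht : t.Valid G x pun) {v : V}
    (hv : (G.children v).Nonempty) (j : M) (f : V → ℝ) :
    ∑ w ∈ G.children v, P.act j v w * f w =
      weight x j (t.fstMem j v) (t.sndMem j v) * f (t.fst j v) +
        (1 - weight x j (t.fstMem j v) (t.sndMem j v)) * f (t.snd j v) := by
  classical
  obtain ⟨h₁, h₂⟩ := ht.mem hv j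
  simp only [hP.act j v hv, add_mul, Finset.sum_add_distrib, ite_mul, zero_mul,
    Finset.sum_ite_eq', h₁, h₂, if_true]

theorem Tables.Implements.isDistribution (hP : t.Implements G x pun P) (ht : t.Valid G x pun)
    {v : V} (hv : (G.children v).Nonempty) (j : M) :
    IsDistribution (G.children v) (P.act j v) := by
  classical
  obtain ⟨h₁, h₂⟩ := ht.mem hv j
  refine ⟨fun w => ?_, fun w hw => ?_, ?_⟩
  · have : 0 ≤ weight x j (t.fstMem j v) (t.sndMem j v) ∧
        weight x j (t.fstMem j v) (t.sndMem j v) ≤ 1 := by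
      rcases h : t.val v j with _ | y
      · obtain ⟨_, e₁, _, e₂, _⟩ := ht.punish v hv j h
        rw [weight_eq_zero (by rw [e₁, e₂])]
        norm_num
      · have := ht.move v hv j y h
        exact ⟨weight_nonneg this.le₁ this.le₂, weight_le_one this.le₁ this.le₂⟩
    rw [hP.act j v hv]
    refine add_nonneg ?_ ?_
    · split_ifs
      exacts [this.1, le_rfl]
    · split_ifs
      exacts [sub_nonneg.2 this.2, le_rfl]
  · have e₁ : w ≠ t.fst j v := fun h => hw (h ▸ h₁)
    have e₂ : w ≠ t.snd j v := fun h => hw (h ▸ h₂)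
    simp [hP.act j v hv, e₁, e₂]
  · have := hP.sum_act ht hv j fun _ => 1
    simpa using this

theorem Tables.Implements.isStrategy (hP : t.Implements G x pun P) (ht : t.Valid G x pun)
    (i : Player) : G.IsStrategy i P.behaviour :=
  fun _ _ _ _ hv => hP.isDistribution ht hv _

theorem moveProb_behaviour (v : V) (h : List V) :
    G.moveProb P.behaviour P.behaviour v h = P.act (P.memory (v :: h)) v := by
  unfold Game.moveProb
  rcases G.owner v with _ | _ <;> rfl

variable {rank : V → ℕ}

/-- In the punishing state the leader holds the follower down to the security level. -/
theorem Tables.Implements.bestFrom_le_low (hr : ∀ v, ∀ w ∈ G.children v, rank w < rank v)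
    (hP : t.Implements G x pun P) (ht : t.Valid G x pun) :
    ∀ k v, rank v ≤ k → ∀ h, P.memory (v :: h) = pun →
      G.bestFrom P.behaviour k v h ≤ t.low v := by
  refine fuel_induction hr (C := fun k v => ∀ h, P.memory (v :: h) = pun →
      G.bestFrom P.behaviour k v h ≤ t.low v) ?_ ?_
  · intro k v hv h _
    rw [bestFrom_leaf _ _ _ hv, (ht.low v).leaf hv]
  · intro k v hv _ _ ih h hm
    obtain ⟨_, e₁, hmem, e₂, hlow⟩ := ht.punish v hv pun (ht.row v).pun_eq
    -- The punishing state is absorbing: every branch of the update leads back to `pun`.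
    have hnext : ∀ w, P.memory (w :: v :: h) = pun := fun w => by
      change P.update (P.memory (v :: h)) v w = pun
      rw [hP.update _ _ hv, hm, e₁, e₂]
      simp
    rcases ho : G.owner v with _ | _
    · rw [bestFrom_leader _ _ _ hv ho]
      change ∑ w ∈ G.children v, P.act (P.memory (v :: h)) v w * _ ≤ _
      rw [hm, hP.sum_act ht hv, weight_eq_zero (by rw [e₁, e₂]), ← hlow]
      linarith [ih _ hmem (v :: h) (hnext _)]
    · rw [bestFrom_follower _ _ _ hv ho]
      exact Finset.sup'_le _ _ fun w hw =>
        (ih w hw _ (hnext w)).trans ((ht.low v).follower ho w hw)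

/-- With a promise that the tables can keep, the follower gets what was promised and cannot get
more, and the leader gets what the table says. -/
theorem Tables.Implements.values (hr : ∀ v, ∀ w ∈ G.children v, rank w < rank v)
    (hP : t.Implements G x pun P) (ht : t.Valid G x pun) :
    ∀ k v, rank v ≤ k → ∀ h y, t.val v (P.memory (v :: h)) = some y →
      G.bestFrom P.behaviour k v h ≤ x (P.memory (v :: h)) ∧
      G.expectedFrom P.behaviour P.behaviour Player.follower k v h = x (P.memory (v :: h)) ∧
      G.expectedFrom P.behaviour P.behaviour Player.leader k v h = y := by
  classical
  refine fuel_induction hr (C := fun k v => ∀ h y, t.val v (P.memory (v :: h)) = some y →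
      G.bestFrom P.behaviour k v h ≤ x (P.memory (v :: h)) ∧
      G.expectedFrom P.behaviour P.behaviour Player.follower k v h = x (P.memory (v :: h)) ∧
      G.expectedFrom P.behaviour P.behaviour Player.leader k v h = y) ?_ ?_
  · intro k v hv h y hy
    obtain ⟨e₁, e₂⟩ := ((ht.row v).leaf hv _ ((ht.row v).ne_pun hy) y).1 hy
    rw [bestFrom_leaf _ _ _ hv, expectedFrom_leaf _ _ _ _ _ hv, expectedFrom_leaf _ _ _ _ _ hv]
    exact ⟨e₁.ge, e₁.symm, e₂.symm⟩
  · intro k v hv _ hk ih h y hy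
    set j := P.memory (v :: h) with hj
    have hA := ht.move v hv j y hy
    obtain ⟨y₁, y₂, hy₁, hy₂, hval⟩ := hA.value
    have hnext : ∀ w, P.memory (w :: v :: h) = if w = t.snd j v then t.sndMem j v
        else if w = t.fst j v then t.fstMem j v else pun := fun w => by
      change P.update (P.memory (v :: h)) v w = _
      rw [hP.update _ _ hv]
    have hm₂ : P.memory (t.snd j v :: v :: h) = t.sndMem j v := by rw [hnext]; simp
    obtain ⟨b₂, f₂, l₂⟩ := ih _ hA.mem₂ (v :: h) y₂ (by rw [hm₂]; exact hy₂)
    rw [hm₂] at b₂ f₂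
    -- If the two children coincide, the update takes the branch of the second one, and nothing is
    -- known about the first promise. But then the promises agree and the first weight is `0`.
    have hcomb : ∀ f : V → ℝ, ∀ c, (t.fst j v ≠ t.snd j v → f (t.fst j v) = c) →
        weight x j (t.fstMem j v) (t.sndMem j v) * f (t.fst j v) =
          weight x j (t.fstMem j v) (t.sndMem j v) * c := by
      intro f c hf
      rcases hA.eq_or_leader with h | h
      · simp [weight_eq_zero h]
      · rw [hf h.2]
    have h₁ : t.fst j v ≠ t.snd j v →
        G.bestFrom P.behaviour k (t.fst j v) (v :: h) ≤ x (t.fstMem j v) ∧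
        G.expectedFrom P.behaviour P.behaviour Player.follower k (t.fst j v) (v :: h) =
          x (t.fstMem j v) ∧
        G.expectedFrom P.behaviour P.behaviour Player.leader k (t.fst j v) (v :: h) = y₁ := by
      intro hne
      have hm₁ : P.memory (t.fst j v :: v :: h) = t.fstMem j v := by rw [hnext]; simp [hne]
      have := ih _ hA.mem₁ (v :: h) y₁ (by rw [hm₁]; exact hy₁)
      rwa [hm₁] at this
    have hw₁ := weight_nonneg hA.le₁ hA.le₂
    have hw₂ := weight_le_one hA.le₁ hA.le₂
    refine ⟨?_, ?_, ?_⟩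
    · rcases ho : G.owner v with _ | _
      · rw [bestFrom_leader _ _ _ hv ho]
        change ∑ w ∈ G.children v, P.act (P.memory (v :: h)) v w * _ ≤ _
        rw [← hj, hP.sum_act ht hv j fun w => G.bestFrom P.behaviour k w (v :: h),
          ← weight_combination hA.le₁ hA.le₂]
        refine add_le_add ?_ (mul_le_mul_of_nonneg_left b₂ (by linarith))
        rcases hA.eq_or_leader with h | h
        · simp [weight_eq_zero h]
        · exact mul_le_mul_of_nonneg_left (h₁ h.2).1 hw₁
      · rw [bestFrom_follower _ _ _ hv ho]
        have heq : x (t.fstMem j v) = x (t.sndMem j v) := by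
          rcases hA.eq_or_leader with h | h
          · exact h
          · simp [ho] at h
        have hx₂ : x (t.sndMem j v) = x j := le_antisymm (heq ▸ hA.le₁) hA.le₂
        refine Finset.sup'_le _ _ fun w hw => ?_
        by_cases hws : w = t.snd j v
        · rw [hws, ← hx₂]
          exact b₂
        by_cases hwf : w = t.fst j v
        · have hne : t.fst j v ≠ t.snd j v := hwf ▸ hws
          rw [hwf, ← hx₂, ← heq]
          exact (h₁ hne).1
        -- Any other child is a deviation: the punishing state leaves the follower at most `low w ≤
        -- low v ≤ x j`.
        · have hp : P.memory (w :: v :: h) = pun := by rw [hnext]; simp [hws, hwf]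
          exact (hP.bestFrom_le_low hr ht k w (hk w hw) _ hp).trans
            (((ht.low v).follower ho w hw).trans hA.low_le)
    · rw [expectedFrom_succ _ _ _ _ _ hv, moveProb_behaviour, ← hj,
        hP.sum_act ht hv j fun w =>
          G.expectedFrom P.behaviour P.behaviour Player.follower k w (v :: h),
        hcomb (fun w => G.expectedFrom P.behaviour P.behaviour Player.follower k w (v :: h)) _
          fun h => (h₁ h).2.1, f₂, weight_combination hA.le₁ hA.le₂]
    · rw [expectedFrom_succ _ _ _ _ _ hv, moveProb_behaviour, ← hj,
        hP.sum_act ht hv j fun w =>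
          G.expectedFrom P.behaviour P.behaviour Player.leader k w (v :: h),
        hcomb (fun w => G.expectedFrom P.behaviour P.behaviour Player.leader k w (v :: h)) _
          fun h => (h₁ h).2.2, l₂, hval]

/-- Whatever the leader does, the follower can attain the security level. -/
theorem Tables.Valid.low_le_bestFrom (hr : ∀ v, ∀ w ∈ G.children v, rank w < rank v)
    (ht : t.Valid G x pun) {σ : List V → V → ℝ} (hσ : G.IsStrategy Player.leader σ) :
    ∀ k v, rank v ≤ k → ∀ h, G.IsHistory (v :: h) → t.low v ≤ G.bestFrom σ k v h := by
  refine fuel_induction hr (C := fun k v => ∀ h, G.IsHistory (v :: h) →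
    t.low v ≤ G.bestFrom σ k v h) ?_ ?_
  · intro k v hv h _
    rw [bestFrom_leaf _ _ _ hv, (ht.low v).leaf hv]
  · intro k v hv _ _ ih h hh
    rcases ho : G.owner v with _ | _
    · rw [bestFrom_leader _ _ _ hv ho]
      exact le_sum_mul_of_isDistribution (hσ v h hh ho hv) fun w hw =>
        ((ht.low v).leader ho w hw).trans (ih w hw _ (hh.step hw))
    · rw [bestFrom_follower _ _ _ hv ho]
      obtain ⟨w, hw, he⟩ := (ht.low v).attained hv
      rw [← he]
      exact (ih w hw _ (hh.step hw)).trans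
        (Finset.le_sup' (fun w => G.bestFrom σ k w (v :: h)) hw)

/-- The point with follower utility `b` and leader utility `a` lies below a segment with ends at
targets and such that at all targets in between the row `R` lies above the segment. -/
def Below (x : M → ℝ) (pun : M) (R : M → Option ℝ) (a b : ℝ) : Prop :=
  ∃ l h α β, l ≠ pun ∧ h ≠ pun ∧ x l ≤ b ∧ b ≤ x h ∧ a ≤ α * b + β ∧
    ∀ j ≠ pun, x l ≤ x j → x j ≤ x h → ∃ y, R j = some y ∧ α * x j + β ≤ y

/-- The leader's utility is at most an entry of the row. -/
theorem Below.exists_le {R : M → Option ℝ} {a b : ℝ} (h : Below x pun R a b) :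
    ∃ j y, R j = some y ∧ a ≤ y := by
  obtain ⟨l, h, α, β, hl, hh, hlb, hbh, hab, hseg⟩ := h
  obtain ⟨y₁, h₁, hy₁⟩ := hseg l hl le_rfl (hlb.trans hbh)
  obtain ⟨y₂, h₂, hy₂⟩ := hseg h hh (hlb.trans hbh) le_rfl
  -- A linear function on the segment is largest at an end.
  rcases le_total 0 α with hα | hα
  · exact ⟨h, y₂, h₂, by nlinarith⟩
  · exact ⟨l, y₁, h₁, by nlinarith⟩

/-- Security levels are built from leaf utilities by minima and maxima, so truncation at a security
level creates no promise outside the targets. -/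
theorem Tables.Valid.exists_target (hr : ∀ v, ∀ w ∈ G.children v, rank w < rank v)
    (ht : t.Valid G x pun) (v : V) : ∃ j ≠ pun, x j = t.low v := by
  refine fuel_induction hr (C := fun _ v => ∃ j ≠ pun, x j = t.low v) ?_ ?_ (rank v) v le_rfl
  · intro _ v hv
    rw [(ht.low v).leaf hv]
    exact ht.target v hv
  · intro k v hv _ _ ih
    obtain ⟨w, hw, he⟩ := (ht.low v).attained hv
    rw [← he]
    exact ih w hw

theorem Tables.Valid.low_le (ht : t.Valid G x pun) {v : V} {j : M} {y : ℝ}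
    (hy : t.val v j = some y) : t.low v ≤ x j := by
  rcases (G.children v).eq_empty_or_nonempty with hv | hv
  · rw [(ht.low v).leaf hv, (((ht.row v).leaf hv j ((ht.row v).ne_pun hy) y).1 hy).1]
  · exact (ht.move v hv j y hy).low_le

/-- A row dominates those of the children at targets above the security level. -/
theorem Tables.Valid.le_val (ht : t.Valid G x pun) {v w : V} (hw : w ∈ G.children v) {j : M}
    {y : ℝ} (hy : t.val w j = some y) (hlow : t.low v ≤ x j) :
    ∃ y', t.val v j = some y' ∧ y ≤ y' :=
  (ht.row v).ge j ((ht.row w).ne_pun hy) w j w j y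
    -- The sure move to `w` with unchanged promise.
    ⟨hw, hw, le_rfl, le_rfl, hlow, .inl rfl, y, y, hy, hy, by ring⟩

/-- Entries of the child at targets from `low v` on carry over to `v`. If the segment begins further
left, it is cut at `low v`, which is a target. -/
theorem Tables.Valid.below_follower (hr : ∀ v, ∀ w ∈ G.children v, rank w < rank v)
    (ht : t.Valid G x pun) {v w : V} (hw : w ∈ G.children v) {a b : ℝ}
    (hb : Below x pun (t.val w) a b) (hlow : t.low v ≤ b) : Below x pun (t.val v) a b := by
  obtain ⟨l, h, α, β, hl, hh, hlb, hbh, hab, hseg⟩ := hb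
  have key : ∀ j ≠ pun, x l ≤ x j → x j ≤ x h → t.low v ≤ x j →
      ∃ y, t.val v j = some y ∧ α * x j + β ≤ y := by
    intro j hj h₁ h₂ h₃
    obtain ⟨y, hy, hle⟩ := hseg j hj h₁ h₂
    obtain ⟨y', hy', hle'⟩ := ht.le_val hw hy h₃
    exact ⟨y', hy', hle.trans hle'⟩
  rcases le_total (t.low v) (x l) with hc | hc
  · exact ⟨l, h, α, β, hl, hh, hlb, hbh, hab, fun j hj h₁ h₂ => key j hj h₁ h₂ (hc.trans h₁)⟩
  · obtain ⟨l', hl', he⟩ := ht.exists_target hr v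
    exact ⟨l', h, α, β, hl', hh, he ▸ hlow, hbh, hab, fun j hj h₁ h₂ =>
      key j hj (hc.trans (he ▸ h₁)) h₂ (he ▸ h₁)⟩

/-- The point of each child in the support lies below a point of its segment, which is a combination
of the two ends. The mixture is therefore below a convex combination of segment ends, all of them
over targets, and `exists_segment_above` leaves one or two of these. -/
theorem Tables.Valid.below_leader (ht : t.Valid G x pun) {v : V} (ho : G.owner v = Player.leader)
    {p a b : V → ℝ} (hp : IsDistribution (G.children v) p)
    (hb : ∀ w ∈ G.children v, 0 < p w → Below x pun (t.val w) (a w) (b w)) :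
    Below x pun (t.val v) (∑ w ∈ G.children v, p w * a w) (∑ w ∈ G.children v, p w * b w) := by
  classical
  have hex : ∀ w, ∃ l h α β, w ∈ G.children v → 0 < p w →
      l ≠ pun ∧ h ≠ pun ∧ x l ≤ b w ∧ b w ≤ x h ∧ a w ≤ α * b w + β ∧
        ∀ j ≠ pun, x l ≤ x j → x j ≤ x h → ∃ y, t.val w j = some y ∧ α * x j + β ≤ y := by
    intro w
    by_cases hw : w ∈ G.children v ∧ 0 < p w
    · obtain ⟨l, h, α, β, H⟩ := hb w hw.1 hw.2
      exact ⟨l, h, α, β, fun _ _ => H⟩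
    · exact ⟨pun, pun, 0, 0, fun h₁ h₂ => absurd ⟨h₁, h₂⟩ hw⟩
  choose l h α β H using hex
  set S := (G.children v).filter fun w => 0 < p w with hS
  have hsum : ∀ f : V → ℝ, ∑ w ∈ S, p w * f w = ∑ w ∈ G.children v, p w * f w := by
    intro f
    rw [hS, Finset.sum_filter]
    refine Finset.sum_congr rfl fun w _ => ?_
    split_ifs with hw
    · rfl
    · rw [le_antisymm (not_lt.1 hw) (hp.1 w), zero_mul]
  have H' : ∀ w ∈ S, w ∈ G.children v ∧ l w ≠ pun ∧ h w ≠ pun ∧ x (l w) ≤ b w ∧ b w ≤ x (h w) ∧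
      a w ≤ α w * b w + β w ∧ ∀ j ≠ pun, x (l w) ≤ x j → x j ≤ x (h w) →
        ∃ y, t.val w j = some y ∧ α w * x j + β w ≤ y := by
    intro w hw
    rw [hS, Finset.mem_filter] at hw
    exact ⟨hw.1, H w hw.1 hw.2⟩
  have hμ : ∀ w, ∃ μ : ℝ, w ∈ S → 0 ≤ μ ∧ μ ≤ 1 ∧ b w = μ * x (l w) + (1 - μ) * x (h w) := by
    intro w
    by_cases hw : w ∈ S
    · obtain ⟨-, -, -, h₁, h₂, -⟩ := H' w hw
      rcases eq_or_lt_of_le (h₁.trans h₂) with he | hlt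
      · exact ⟨0, fun _ => ⟨le_rfl, zero_le_one, by linarith⟩⟩
      · refine ⟨(x (h w) - b w) / (x (h w) - x (l w)), fun _ =>
          ⟨div_nonneg (by linarith) (by linarith), div_le_one_of_le₀ (by linarith) (by linarith),
            ?_⟩⟩
        have : x (h w) - x (l w) ≠ 0 := by linarith
        field_simp
        ring
    · exact ⟨0, fun h => absurd h hw⟩
  choose μ hμ using hμ
  -- `(w, true)` stands for the left and `(w, false)` for the right end of the segment of `w`; `q`
  -- is the weight of the end in the mixture.
  set e : V × Bool → M := fun i => if i.2 then l i.1 else h i.1 with he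
  set q : V × Bool → ℝ := fun i => p i.1 * if i.2 then μ i.1 else 1 - μ i.1 with hq
  have hsplit : ∀ f : V × Bool → ℝ, ∑ i ∈ S ×ˢ Finset.univ, q i * f i =
      ∑ w ∈ S, p w * (μ w * f (w, true) + (1 - μ w) * f (w, false)) := by
    intro f
    rw [Finset.sum_product]
    refine Finset.sum_congr rfl fun w _ => ?_
    simp [hq]
    ring
  have he' : ∀ i : V × Bool, i.1 ∈ S → e i ≠ pun ∧ x (l i.1) ≤ x (e i) ∧ x (e i) ≤ x (h i.1) := by
    rintro ⟨w, _ | _⟩ hw <;> obtain ⟨-, h₁, h₂, h₃, h₄, -⟩ := H' w hw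
    · simpa [he] using ⟨h₂, h₃.trans h₄⟩
    · simpa [he] using ⟨h₁, h₃.trans h₄⟩
  set A := ∑ w ∈ G.children v, p w * a w
  set B := ∑ w ∈ G.children v, p w * b w with hB
  have hentry : ∀ i : V × Bool, i.1 ∈ S → ∀ j ≠ pun, x (l i.1) ≤ x j → x j ≤ x (h i.1) →
      ∃ y, t.val v j = some y ∧ α i.1 * x j + β i.1 ≤ y := by
    intro i hi j hj h₁ h₂
    obtain ⟨hw, -, -, -, -, -, hseg⟩ := H' _ hi
    obtain ⟨y, hy, hle⟩ := hseg j hj h₁ h₂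
    obtain ⟨y', hy', hle'⟩ := ht.le_val hw hy
      (((ht.low v).leader ho _ hw).trans (ht.low_le hy))
    exact ⟨y', hy', hle.trans hle'⟩
  rcases exists_segment_above (S ×ˢ Finset.univ) q (fun i => x (e i))
    (fun i => α i.1 * x (e i) + β i.1) (a := A) (b := B) (by
      rintro ⟨w, _ | _⟩ hi <;> simp only [Finset.mem_product, Finset.mem_univ, and_true] at hi <;>
        obtain ⟨h₁, h₂, -⟩ := hμ w hi
      · simpa [hq] using mul_nonneg (hp.1 w) (sub_nonneg.2 h₂)
      · simpa [hq] using mul_nonneg (hp.1 w) h₁) (by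
      have := hsplit fun _ => 1
      simp only [mul_one, add_sub_cancel] at this
      rw [this]
      simpa [hp.2.2] using hsum fun _ => 1) (by
      rw [hsplit, hB, ← hsum]
      exact Finset.sum_congr rfl fun w hw => by simp [he, (hμ w hw).2.2]) (by
      rw [hsplit, show A = _ from (hsum a).symm]
      refine Finset.sum_le_sum fun w hw => mul_le_mul_of_nonneg_left ?_ (hp.1 w)
      obtain ⟨-, -, -, -, -, hle, -⟩ := H' w hw
      refine hle.trans (le_of_eq ?_)
      rw [(hμ w hw).2.2]
      simp only [he, if_true, Bool.false_eq_true, if_false]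
      ring) with ⟨i, hi, hxi, hyi⟩ | ⟨i, hi, k, hk, hxi, hxk, hseg⟩
  · have hi : i.1 ∈ S := by simpa using hi
    obtain ⟨h₁, h₂, h₃⟩ := he' i hi
    refine ⟨e i, e i, α i.1, β i.1, h₁, h₁, hxi.le, hxi.ge, by rwa [← hxi], fun j hj hj₁ hj₂ => ?_⟩
    exact hentry i hi j hj (h₂.trans hj₁) (hj₂.trans h₃)
  · have hi : i.1 ∈ S := by simpa using hi
    have hk : k.1 ∈ S := by simpa using hk
    obtain ⟨i₁, i₂, i₃⟩ := he' i hi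
    obtain ⟨k₁, k₂, k₃⟩ := he' k hk
    have hpos : 0 < x (e k) - x (e i) := by linarith
    -- Two ends at one child lie on that child's own line, which serves again. Two ends at different
    -- children may be mixed by the leader at any target in between, and the weight reproduces the
    -- line through the ends.
    rcases eq_or_ne i.1 k.1 with hik | hik
    · refine ⟨e i, e k, α i.1, β i.1, i₁, k₁, hxi.le, hxk.le, ?_, fun j hj hj₁ hj₂ => ?_⟩
      · rw [← hik] at hseg
        refine le_of_mul_le_mul_right (hseg.trans (le_of_eq ?_)) hpos
        ring
      · rw [← hik] at k₃
        exact hentry i hi j hj (i₂.trans hj₁) (hj₂.trans k₃)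
    · obtain ⟨hwi, -, -, -, -, -, hsi⟩ := H' _ hi
      obtain ⟨hwk, -, -, -, -, -, hsk⟩ := H' _ hk
      obtain ⟨y₁, hy₁, hle₁⟩ := hsi _ i₁ i₂ i₃
      obtain ⟨y₂, hy₂, hle₂⟩ := hsk _ k₁ k₂ k₃
      set Y₁ := α i.1 * x (e i) + β i.1
      set Y₂ := α k.1 * x (e k) + β k.1
      refine ⟨e i, e k, (Y₂ - Y₁) / (x (e k) - x (e i)),
        Y₁ - (Y₂ - Y₁) / (x (e k) - x (e i)) * x (e i), i₁, k₁, hxi.le, hxk.le, ?_,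
        fun j hj hj₁ hj₂ => ?_⟩
      · refine le_of_mul_le_mul_right (hseg.trans (le_of_eq ?_)) hpos
        field_simp
        ring
      · have hlow : t.low v ≤ x j :=
          (((ht.low v).leader ho _ hwi).trans (ht.low_le hy₁)).trans hj₁
        obtain ⟨y, hy, hle⟩ := (ht.row v).ge j hj i.1 (e i) k.1 (e k) _
          ⟨hwi, hwk, hj₁, hj₂, hlow, .inr ⟨ho, hik⟩, y₁, y₂, hy₁, hy₂, rfl⟩
        refine ⟨y, hy, le_trans ?_ hle⟩
        have hw₁ := weight_nonneg hj₁ hj₂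
        have hw₂ := weight_le_one hj₁ hj₂
        calc _ = weight x j (e i) (e k) * Y₁ + (1 - weight x j (e i) (e k)) * Y₂ := by
              unfold weight
              field_simp
              ring
          _ ≤ _ := add_le_add (mul_le_mul_of_nonneg_left hle₁ hw₁)
              (mul_le_mul_of_nonneg_left hle₂ (by linarith))

/-- The outcome of a leader strategy and a best response to it lies below the table. -/
theorem Tables.Valid.below (hr : ∀ v, ∀ w ∈ G.children v, rank w < rank v)
    (ht : t.Valid G x pun) {σ₁ σ₂ : List V → V → ℝ} (h₁ : G.IsStrategy Player.leader σ₁)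
    (h₂ : G.IsStrategy Player.follower σ₂) :
    ∀ k v, rank v ≤ k → ∀ h, G.IsHistory (v :: h) →
      G.expectedFrom σ₁ σ₂ Player.follower k v h = G.bestFrom σ₁ k v h →
      Below x pun (t.val v) (G.expectedFrom σ₁ σ₂ Player.leader k v h)
        (G.expectedFrom σ₁ σ₂ Player.follower k v h) := by
  refine fuel_induction hr (C := fun k v => ∀ h, G.IsHistory (v :: h) →
      G.expectedFrom σ₁ σ₂ Player.follower k v h = G.bestFrom σ₁ k v h →
      Below x pun (t.val v) (G.expectedFrom σ₁ σ₂ Player.leader k v h)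
        (G.expectedFrom σ₁ σ₂ Player.follower k v h)) ?_ ?_
  · intro k v hv h _ _
    rw [expectedFrom_leaf _ _ _ _ _ hv, expectedFrom_leaf _ _ _ _ _ hv]
    obtain ⟨j, hj, he⟩ := ht.target v hv
    refine ⟨j, j, 0, G.util Player.leader v, hj, hj, he.le, he.ge, by simp, fun i hi h₁ h₂ => ?_⟩
    exact ⟨_, ((ht.row v).leaf hv i hi _).2 ⟨(le_antisymm h₂ h₁).trans he, rfl⟩, by simp⟩
  · intro k v hv hkv hk ih h hh hbest
    have hp := h₁.moveProb h₂ hh hv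
    have hle : ∀ w ∈ G.children v, G.expectedFrom σ₁ σ₂ Player.follower k w (v :: h) ≤
        G.bestFrom σ₁ k w (v :: h) := fun w hw =>
      expectedFrom_le_bestFrom hr h₁ h₂ k w (hk w hw) _ (hh.step hw)
    rcases ho : G.owner v with _ | _
    · rw [expectedFrom_succ _ _ _ _ _ hv] at hbest ⊢
      rw [expectedFrom_succ _ _ _ _ _ hv]
      rw [bestFrom_leader _ _ _ hv ho] at hbest
      have hm : σ₁ (v :: h) = G.moveProb σ₁ σ₂ v h := by simp [Game.moveProb, ho]
      rw [hm] at hbest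
      exact ht.below_leader ho hp fun w hw hpw =>
        ih w hw _ (hh.step hw) (eq_of_sum_mul_eq hp.1 hle hbest hw hpw)
    · set B := G.bestFrom σ₁ (k + 1) v h with hB
      have hchild : ∀ w ∈ G.children v, G.bestFrom σ₁ k w (v :: h) ≤ B := fun w hw => by
        rw [hB, bestFrom_follower _ _ _ hv ho]
        exact Finset.le_sup' (fun w => G.bestFrom σ₁ k w (v :: h)) hw
      -- Some child in the support gives the leader at least the average. As the reply is optimal,
      -- that child also gives the follower all of `B`, so the randomization of the follower can be
      -- dropped.
      obtain ⟨w, hw, hpw, hwa⟩ : ∃ w ∈ G.children v, 0 < G.moveProb σ₁ σ₂ v h w ∧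
          G.expectedFrom σ₁ σ₂ Player.leader (k + 1) v h ≤
            G.expectedFrom σ₁ σ₂ Player.leader k w (v :: h) := by
        by_contra! hcon
        rw [expectedFrom_succ _ _ _ _ _ hv] at hcon
        obtain ⟨w, hw, hpw⟩ : ∃ w ∈ G.children v, 0 < G.moveProb σ₁ σ₂ v h w := by
          by_contra! hn
          have := Finset.sum_nonpos hn
          rw [hp.2.2] at this
          linarith
        set A := ∑ w ∈ G.children v, G.moveProb σ₁ σ₂ v h w *
          G.expectedFrom σ₁ σ₂ Player.leader k w (v :: h) with hA
        have : A < ∑ w ∈ G.children v, G.moveProb σ₁ σ₂ v h w * A := by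
          conv_lhs => rw [hA]
          refine Finset.sum_lt_sum (fun w hw => ?_)
            ⟨w, hw, mul_lt_mul_of_pos_left (hcon w hw hpw) hpw⟩
          rcases (hp.1 w).eq_or_lt with h0 | h0
          · simp [← h0]
          · exact (mul_lt_mul_of_pos_left (hcon w hw h0) h0).le
        rw [← Finset.sum_mul, hp.2.2, one_mul] at this
        exact lt_irrefl _ this
      have hEB : G.expectedFrom σ₁ σ₂ Player.follower k w (v :: h) = B := by
        refine eq_of_sum_mul_eq (g := fun _ => B) hp.1
          (fun w hw => (hle w hw).trans (hchild w hw)) ?_ hw hpw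
        rw [← Finset.sum_mul, hp.2.2, one_mul, ← hbest, expectedFrom_succ _ _ _ _ _ hv]
      have hbw := ih w hw _ (hh.step hw)
        (le_antisymm (hle w hw) (hEB ▸ hchild w hw))
      rw [hEB] at hbw
      rw [hbest]
      have := ht.below_follower hr hw hbw (ht.low_le_bestFrom hr h₁ (k + 1) v hkv h hh)
      obtain ⟨l, u, α, β, c₁, c₂, c₃, c₄, c₅, c₆⟩ := this
      exact ⟨l, u, α, β, c₁, c₂, c₃, c₄, hwa.trans c₅, c₆⟩

/-- A profile that plays according to valid tables and starts with the promise that is best for the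
leader is a strong Stackelberg equilibrium. -/
theorem Tables.Implements.isSSEWithMemory [Fintype V] (hG : G.Acyclic)
    (hP : t.Implements G x pun P) (ht : t.Valid G x pun)
    (hinit : ∀ j y, t.val G.root j = some y → ∃ y', t.val G.root P.init = some y' ∧ y ≤ y') :
    G.IsSSEWithMemory P := by
  obtain ⟨rank, hr, hc⟩ := hG.exists_rank
  have hbelow : ∀ τ₁ τ₂, G.IsStrategy Player.leader τ₁ → G.IsBestResponse τ₁ τ₂ →
      ∃ y, t.val G.root P.init = some y ∧ G.expectedUtil τ₁ τ₂ Player.leader ≤ y := by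
    intro τ₁ τ₂ h₁ h₂
    obtain ⟨j, y, hy, hle⟩ := (ht.below hr h₁ h₂.1 _ _ (hc _).le _ .root
      ((isBestResponse_iff hr hc h₁ h₂.1).1 h₂)).exists_le
    obtain ⟨y', hy', hle'⟩ := hinit j y hy
    exact ⟨y', hy', hle.trans hle'⟩
  have hs := hP.isStrategy ht
  -- The root has an entry at all: `P.behaviour` has some best response, and the outcome of the two
  -- lies below the table.
  obtain ⟨y, hy⟩ : ∃ y, t.val G.root P.init = some y := by
    obtain ⟨τ, hτ, hτb⟩ := exists_expectedFrom_eq_bestFrom hr P.behaviour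
    obtain ⟨y, hy, -⟩ := hbelow P.behaviour τ (hs _)
      ((isBestResponse_iff hr hc (hs _) hτ).2 (hτb _ _ (hc _).le _))
    exact ⟨y, hy⟩
  obtain ⟨v₁, v₂, v₃⟩ := hP.values hr ht _ _ (hc _).le [] y hy
  refine ⟨fun j v hv => hP.isDistribution ht hv j, hs _,
    (isBestResponse_iff hr hc (hs _) (hs _)).2 (le_antisymm
      (expectedFrom_le_bestFrom hr (hs _) (hs _) _ _ (hc _).le _ .root) ?_), ?_⟩
  · unfold expectedUtil
    rw [v₂]
    exact v₁
  · intro τ₁ τ₂ h₁ h₂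
    obtain ⟨y', hy', hle⟩ := hbelow τ₁ τ₂ h₁ h₂
    rw [hy] at hy'
    obtain rfl := Option.some.inj hy'
    refine hle.trans (le_of_eq ?_)
    unfold expectedUtil
    rw [v₃]

end Profile

end Game

namespace Game

/-! ### Solving the equations by iteration -/

section Fixed

variable {V K α : Type*} {G : Game V K} {rank : V → ℕ}

/-- A child of `v` has rank below `rank v ≤ N`, so it has stabilized at level `N` already. Hence
level `N + 1` solves the equations with respect to itself. -/
theorem eq_pred_level (hr : ∀ v, ∀ w ∈ G.children v, rank w < rank v)
    {R : V → (V → α) → α → Prop}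
    (hR : ∀ v g g' a a', (∀ w ∈ G.children v, g w = g' w) → R v g a → R v g' a' → a = a')
    {f : ℕ → V → α} {N : ℕ} (hN : ∀ v, rank v < N + 1)
    (hf : ∀ r < N + 1, ∀ v, R v (f r) (f (r + 1) v)) :
    ∀ v, ∀ w ∈ G.children v, f N w = f (N + 1) w := by
  intro v w hw
  have h₁ := hr v w hw
  have h₂ := hN v
  exact eq_of_levels hr hR hf _ w rfl N (N + 1) (by omega) (by omega) (by omega) le_rfl

theorem exists_fixed [Nonempty α] [Fintype V] (hG : G.Acyclic) {R : V → (V → α) → α → Prop}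
    (hR : ∀ v g g' a a', (∀ w ∈ G.children v, g w = g' w) → R v g a → R v g' a' → a = a')
    (hcongr : ∀ v g g' a, (∀ w ∈ G.children v, g w = g' w) → R v g a → R v g' a)
    (htotal : ∀ v g, ∃ a, R v g a) : ∃ g : V → α, ∀ v, R v g (g v) := by
  obtain ⟨rank, hr, hc⟩ := hG.exists_rank
  choose φ hφ using htotal
  obtain ⟨a⟩ := ‹Nonempty α›
  set f : ℕ → V → α := fun r => Nat.rec (fun _ => a) (fun _ g v => φ v g) r
  have hf : ∀ r v, R v (f r) (f (r + 1) v) := fun r v => hφ v (f r)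
  exact ⟨f (Fintype.card V + 1), fun v => hcongr v _ _ _
    (eq_pred_level hr hR (fun v => (hc v).trans (Nat.lt_succ_self _)) (fun r _ => hf r) v)
    (hf _ v)⟩

end Fixed

/-! ### Existence of tables and of an equilibrium over the reals -/

section Exists

variable {V M K : Type*} [Field K] [LinearOrder K] [IsStrictOrderedRing K]

omit [Field K] [IsStrictOrderedRing K] in
theorem exists_isLow (G : Game V K) (v : V) (low : V → K) : ∃ a, IsLow G v low a := by
  rcases (G.children v).eq_empty_or_nonempty with hv | hv
  · exact ⟨G.util Player.follower v, fun _ => rfl, by simp [hv], by simp [hv], by simp [hv]⟩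
  rcases ho : G.owner v with _ | _
  · obtain ⟨w, hw, hmin⟩ := Finset.exists_min_image _ low hv
    exact ⟨low w, fun h => absurd h hv.ne_empty, fun _ => hmin, by simp [ho], fun _ => ⟨w, hw, rfl⟩⟩
  · obtain ⟨w, hw, hmax⟩ := Finset.exists_max_image _ low hv
    exact ⟨low w, fun h => absurd h hv.ne_empty, by simp [ho], fun _ => hmax, fun _ => ⟨w, hw, rfl⟩⟩

-- There are finitely many candidates, and each admissible one determines its value; the entry is
-- the maximum.
omit [IsStrictOrderedRing K] in
theorem exists_isRow [Finite V] [Finite M] (G : Game V K) (low : V → K) (x : M → K) (pun : M)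
    (v : V) (T : V → M → Option K) : ∃ row, IsRow G low x pun v T row := by
  classical
  have hentry : ∀ j, ∃ o : Option K, (j = pun → o = none) ∧ (j ≠ pun →
      (G.children v = ∅ → ∀ y, o = some y ↔
        x j = G.util Player.follower v ∧ y = G.util Player.leader v) ∧
      (∀ w₁ j₁ w₂ j₂ y, Admissible G low x T v j w₁ j₁ w₂ j₂ y → ∃ y', o = some y' ∧ y ≤ y') ∧
      ((G.children v).Nonempty → ∀ y, o = some y →
        ∃ w₁ j₁ w₂ j₂, Admissible G low x T v j w₁ j₁ w₂ j₂ y)) := by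
    intro j
    by_cases hj : j = pun
    · exact ⟨none, fun _ => rfl, fun h => absurd hj h⟩
    rcases (G.children v).eq_empty_or_nonempty with hv | hv
    · have hA : ∀ w₁ j₁ w₂ j₂ y, ¬ Admissible G low x T v j w₁ j₁ w₂ j₂ y := by
        intro _ _ _ _ _ h
        simpa [hv] using h.mem₁
      by_cases hx : x j = G.util Player.follower v
      · refine ⟨some (G.util Player.leader v), fun h => absurd h hj, fun _ => ⟨fun _ y => ?_,
          fun _ _ _ _ _ h => absurd h (hA _ _ _ _ _), fun h => absurd hv h.ne_empty⟩⟩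
        simp [hx, eq_comm]
      · refine ⟨none, fun h => absurd h hj, fun _ => ⟨fun _ y => ?_,
          fun _ _ _ _ _ h => absurd h (hA _ _ _ _ _), fun h => absurd hv h.ne_empty⟩⟩
        simp [hx]
    · set S : Set (V × M × V × M) :=
        {c | ∃ y, Admissible G low x T v j c.1 c.2.1 c.2.2.1 c.2.2.2 y} with hS
      set val : V × M × V × M → K := fun c =>
        weight x j c.2.1 c.2.2.2 * (T c.1 c.2.1).getD 0 +
          (1 - weight x j c.2.1 c.2.2.2) * (T c.2.2.1 c.2.2.2).getD 0 with hval
      have hvalue : ∀ c y, Admissible G low x T v j c.1 c.2.1 c.2.2.1 c.2.2.2 y → y = val c := by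
        intro c y h
        obtain ⟨y₁, y₂, h₁, h₂, h₃⟩ := h.value
        simp [hval, h₁, h₂, h₃]
      rcases S.eq_empty_or_nonempty with hE | hne
      · refine ⟨none, fun _ => rfl, fun _ => ⟨fun h => absurd h hv.ne_empty, ?_, by simp⟩⟩
        intro w₁ j₁ w₂ j₂ y h
        have : (w₁, j₁, w₂, j₂) ∈ S := ⟨y, h⟩
        simp [hE] at this
      · obtain ⟨c, ⟨y, hy⟩, hmax⟩ := Set.exists_max_image S val S.toFinite hne
        refine ⟨some y, fun h => absurd h hj, fun _ => ⟨fun h => absurd h hv.ne_empty, ?_, ?_⟩⟩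
        · intro w₁ j₁ w₂ j₂ y' h
          refine ⟨y, rfl, ?_⟩
          rw [hvalue _ _ hy, hvalue (w₁, j₁, w₂, j₂) y' h]
          exact hmax _ ⟨y', h⟩
        · rintro - y' hy'
          obtain rfl := Option.some.inj hy'
          exact ⟨_, _, _, _, hy⟩
  choose row h₁ h₂ using hentry
  exact ⟨row, h₁ pun rfl, fun hv j hj => (h₂ j hj).1 hv, fun j hj => (h₂ j hj).2.1,
    fun hv j y hy => (h₂ j fun h => by simp [h₁ j h] at hy).2.2 hv y hy⟩

omit [IsStrictOrderedRing K] in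
theorem exists_tables [Fintype V] [Finite M] {G : Game V K} (hG : G.Acyclic) (x : M → K) (pun : M)
    (htarget : ∀ v, G.children v = ∅ → ∃ j ≠ pun, x j = G.util Player.follower v) :
    ∃ t : Tables V M K, t.Valid G x pun := by
  classical
  obtain ⟨low, hlow⟩ := exists_fixed hG (R := fun v low a => IsLow G v low a)
    (fun _ _ _ _ _ h => IsLow.unique h) (fun _ _ _ _ h => IsLow.congr h)
    (fun v low => exists_isLow G v low)
  obtain ⟨T, hT⟩ := exists_fixed hG (R := fun v T row => IsRow G low x pun v T row)
    (fun _ _ _ _ _ h => IsRow.unique h) (fun _ _ _ _ h => IsRow.congr h)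
    (fun v T => exists_isRow G low x pun v T)
  have hmove : ∀ v j, ∃ w₁ j₁ w₂ j₂, (G.children v).Nonempty →
      (∀ y, T v j = some y → Admissible G low x T v j w₁ j₁ w₂ j₂ y) ∧
      (T v j = none → w₁ ∈ G.children v ∧ j₁ = pun ∧ w₂ ∈ G.children v ∧ j₂ = pun ∧
        low w₂ = low v) := by
    intro v j
    rcases (G.children v).eq_empty_or_nonempty with hv | hv
    · exact ⟨v, pun, v, pun, fun h => absurd hv h.ne_empty⟩
    rcases h : T v j with _ | y
    · obtain ⟨w, hw, he⟩ := (hlow v).attained hv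
      exact ⟨w, pun, w, pun, fun _ => ⟨by simp, fun _ => ⟨hw, rfl, hw, rfl, he⟩⟩⟩
    · obtain ⟨w₁, j₁, w₂, j₂, hA⟩ := (hT v).attained hv j y h
      exact ⟨w₁, j₁, w₂, j₂, fun _ => ⟨fun y' hy' => Option.some.inj hy' ▸ hA, by simp⟩⟩
  choose w₁ j₁ w₂ j₂ hmove using hmove
  exact ⟨⟨low, T, fun j v => w₁ v j, fun j v => j₁ v j, fun j v => w₂ v j, fun j v => j₂ v j⟩,
    hlow, hT, htarget, fun v hv j y hy => (hmove v j hv).1 y hy, fun v hv j hj => (hmove v j hv).2 hj⟩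

omit [IsStrictOrderedRing K] in
/-- The memory state with the promise that is best for the leader at a node. -/
theorem exists_best_state [Finite M] (pun : M) (row : M → Option K) :
    ∃ i, ∀ j y, row j = some y → ∃ y', row i = some y' ∧ y ≤ y' := by
  rcases {j | row j ≠ none}.eq_empty_or_nonempty with h | h
  · refine ⟨pun, fun j y hy => ?_⟩
    have : j ∈ {j | row j ≠ none} := by simp [hy]
    simp [h] at this
  · obtain ⟨i, hi, hmax⟩ := Set.exists_max_image {j | row j ≠ none} (fun j => (row j).getD 0)
      (Set.toFinite _) h
    obtain ⟨y', hy'⟩ := Option.ne_none_iff_exists'.1 hi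
    refine ⟨i, fun j y hy => ⟨y', hy', ?_⟩⟩
    simpa [hy, hy'] using hmax j (by simp [hy])

/-- `none` is the punishing state and `some i` the promise of the follower utility stored at node
`i`. Numbers stored at inner nodes only add superfluous targets. -/
theorem exists_isSSEWithMemory [Fintype V] {G : Game V ℝ} (hG : G.Acyclic) :
    ∃ P : MemProfile V (Option (Fin (Fintype.card V))), G.IsSSEWithMemory P := by
  classical
  set x : Option (Fin (Fintype.card V)) → ℝ := fun o => o.elim 0 fun i =>
    G.util Player.follower ((Fintype.equivFin V).symm i)
  obtain ⟨t, ht⟩ := exists_tables hG x none fun v _ =>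
    ⟨some (Fintype.equivFin V v), by simp, by simp [x]⟩
  obtain ⟨i, hi⟩ := exists_best_state none (t.val G.root)
  set P : MemProfile V (Option (Fin (Fintype.card V))) :=
    { act := fun j v w => (if w = t.fst j v then weight x j (t.fstMem j v) (t.sndMem j v) else 0) +
        if w = t.snd j v then 1 - weight x j (t.fstMem j v) (t.sndMem j v) else 0
      update := fun j v w =>
        if w = t.snd j v then t.sndMem j v else if w = t.fst j v then t.fstMem j v else none
      init := i }
  exact ⟨P, Tables.Implements.isSSEWithMemory hG (P := P) (t := t)
    ⟨fun _ _ _ _ => by simp only [P], fun _ _ _ _ => by simp only [P]⟩ ht hi⟩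

end Exists

/-! ### From rational to real tables -/

section Cast

variable {V M : Type*} {G : Game V ℚ}

theorem weight_cast (x : M → ℚ) (j j₁ j₂ : M) :
    weight (fun j => (x j : ℝ)) j j₁ j₂ = ((weight x j j₁ j₂ : ℚ) : ℝ) := by
  simp [weight]

/-- Tables of rational numbers, seen as tables of real numbers. -/
noncomputable def Tables.toReal (t : Tables V M ℚ) : Tables V M ℝ where
  low v := t.low v
  val v j := (t.val v j).map fun q : ℚ => (q : ℝ)
  fst := t.fst
  fstMem := t.fstMem
  snd := t.snd
  sndMem := t.sndMem

/-- Weights and entries are rational, so passing to the reals adds no candidates. -/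
theorem admissible_toReal {low : V → ℚ} {x : M → ℚ} {T : V → M → Option ℚ} {v : V} {j : M}
    {w₁ : V} {j₁ : M} {w₂ : V} {j₂ : M} {y : ℝ} :
    Admissible G.toReal (fun v => (low v : ℝ)) (fun j => (x j : ℝ))
      (fun v j => (T v j).map fun q : ℚ => (q : ℝ)) v j w₁ j₁ w₂ j₂ y ↔
    ∃ q : ℚ, y = q ∧ Admissible G low x T v j w₁ j₁ w₂ j₂ q := by
  constructor
  · rintro ⟨h₁, h₂, h₃, h₄, h₅, h₆, y₁, y₂, e₁, e₂, e₃⟩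
    obtain ⟨q₁, hq₁, rfl⟩ := Option.map_eq_some_iff.1 e₁
    obtain ⟨q₂, hq₂, rfl⟩ := Option.map_eq_some_iff.1 e₂
    refine ⟨weight x j j₁ j₂ * q₁ + (1 - weight x j j₁ j₂) * q₂, ?_, h₁, h₂, by exact_mod_cast h₃,
      by exact_mod_cast h₄, by exact_mod_cast h₅, by exact_mod_cast h₆, q₁, q₂, hq₁, hq₂, rfl⟩
    rw [e₃, weight_cast]
    push_cast
    rfl
  · rintro ⟨q, rfl, ⟨h₁, h₂, h₃, h₄, h₅, h₆, q₁, q₂, hq₁, hq₂, rfl⟩⟩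
    refine ⟨h₁, h₂, by exact_mod_cast h₃, by exact_mod_cast h₄, by exact_mod_cast h₅,
      by exact_mod_cast h₆, q₁, q₂, by simp [hq₁], by simp [hq₂], ?_⟩
    rw [weight_cast]
    push_cast
    rfl

theorem Tables.Valid.toReal {t : Tables V M ℚ} {x : M → ℚ} {pun : M} (ht : t.Valid G x pun) :
    t.toReal.Valid G.toReal (fun j => (x j : ℝ)) pun where
  low v :=
    { leaf := fun hv => by simpa [Game.toReal, Tables.toReal] using (ht.low v).leaf hv
      leader := fun ho w hw => by simpa [Tables.toReal] using (ht.low v).leader ho w hw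
      follower := fun ho w hw => by simpa [Tables.toReal] using (ht.low v).follower ho w hw
      attained := fun hv => by simpa [Tables.toReal, Game.toReal] using (ht.low v).attained hv }
  row v :=
    { pun_eq := by simp [Tables.toReal, (ht.row v).pun_eq]
      leaf := fun hv j hj y => by
        simp only [Tables.toReal, Option.map_eq_some_iff, (ht.row v).leaf hv j hj, Game.toReal]
        constructor
        · rintro ⟨q, ⟨h₁, h₂⟩, rfl⟩
          exact ⟨by exact_mod_cast h₁, by exact_mod_cast h₂⟩
        · rintro ⟨h₁, h₂⟩
          exact ⟨_, ⟨by exact_mod_cast h₁, rfl⟩, h₂.symm⟩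
      ge := fun j hj w₁ j₁ w₂ j₂ y hA => by
        obtain ⟨q, rfl, hq⟩ := admissible_toReal.1 hA
        obtain ⟨q', hq', hle⟩ := (ht.row v).ge j hj w₁ j₁ w₂ j₂ q hq
        exact ⟨q', by simp [Tables.toReal, hq'], by exact_mod_cast hle⟩
      attained := fun hv j y hy => by
        obtain ⟨q, hq, rfl⟩ := Option.map_eq_some_iff.1 hy
        obtain ⟨w₁, j₁, w₂, j₂, hA⟩ := (ht.row v).attained hv j q hq
        exact ⟨w₁, j₁, w₂, j₂, admissible_toReal.2 ⟨q, rfl, hA⟩⟩ }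
  target v hv := by
    obtain ⟨j, hj, he⟩ := ht.target v hv
    exact ⟨j, hj, by simp [he, Game.toReal]⟩
  move v hv j y hy := by
    obtain ⟨q, hq, rfl⟩ := Option.map_eq_some_iff.1 hy
    exact admissible_toReal.2 ⟨q, rfl, ht.move v hv j q hq⟩
  punish v hv j hj := by
    obtain ⟨h₁, h₂, h₃, h₄, h₅⟩ := ht.punish v hv j (by simpa [Tables.toReal] using hj)
    exact ⟨h₁, h₂, h₃, h₄, by simp [Tables.toReal, h₅]⟩

end Cast

end Game

namespace RAM

/-! ### Bit lengths under arithmetic -/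

section Bits

theorem size_mul_le (a b : ℕ) : (a * b).size ≤ a.size + b.size := by
  rw [Nat.size_le, pow_add]
  exact Nat.mul_lt_mul'' (Nat.lt_size_self a) (Nat.lt_size_self b)

theorem size_add_le (a b : ℕ) : (a + b).size ≤ a.size + b.size + 1 := by
  rw [Nat.size_le]
  have h₁ : a < 2 ^ (a.size + b.size) :=
    (Nat.lt_size_self a).trans_le (Nat.pow_le_pow_right (by norm_num) (by omega))
  have h₂ : b < 2 ^ (a.size + b.size) :=
    (Nat.lt_size_self b).trans_le (Nat.pow_le_pow_right (by norm_num) (by omega))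
  rw [pow_succ]
  omega

/-- Reduction to lowest terms divides numerator and denominator, so it does not increase their
sizes. -/
theorem bits_div_le (a : ℤ) {d : ℕ} (hd : d ≠ 0) :
    bits ((a : ℚ) / d) ≤ a.natAbs.size + d.size := by
  have hd' : (d : ℤ) ≠ 0 := by exact_mod_cast hd
  refine add_le_add (Nat.size_le_size ?_) (Nat.size_le_size ?_)
  · rcases eq_or_ne a 0 with rfl | ha
    · simp
    · have : ((a : ℚ) / d).num ∣ a := by
        have := Rat.num_dvd a hd'
        rwa [Rat.divInt_eq_div, Int.cast_natCast] at this
      exact Nat.le_of_dvd (Int.natAbs_pos.2 ha) (Int.natAbs_dvd_natAbs.2 this)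
  · have := Rat.den_dvd a d
    rw [Rat.divInt_eq_div, Int.cast_natCast] at this
    exact Nat.le_of_dvd (Nat.pos_of_ne_zero hd) (by exact_mod_cast this)

theorem bits_add_le (q r : ℚ) : bits (q + r) ≤ 2 * (bits q + bits r) + 2 := by
  have : q + r = ((q.num * r.den + r.num * q.den : ℤ) : ℚ) / (q.den * r.den : ℕ) := by
    conv_lhs => rw [← Rat.num_div_den q, ← Rat.num_div_den r]
    have h₁ : (q.den : ℚ) ≠ 0 := by exact_mod_cast q.den_nz
    have h₂ : (r.den : ℚ) ≠ 0 := by exact_mod_cast r.den_nz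
    push_cast
    field_simp
  rw [this]
  refine (bits_div_le _ (mul_ne_zero q.den_nz r.den_nz)).trans ?_
  have h₁ : (q.num * r.den + r.num * q.den).natAbs.size ≤
      (q.num.natAbs * r.den).size + (r.num.natAbs * q.den).size + 1 := by
    refine le_trans (Nat.size_le_size ?_) (size_add_le _ _)
    refine (Int.natAbs_add_le _ _).trans (le_of_eq ?_)
    simp [Int.natAbs_mul]
  have h₂ := size_mul_le q.num.natAbs r.den
  have h₃ := size_mul_le r.num.natAbs q.den
  have h₄ := size_mul_le q.den r.den
  unfold bits
  omega

theorem bits_neg (q : ℚ) : bits (-q) = bits q := by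
  simp [bits]

theorem bits_sub_le (q r : ℚ) : bits (q - r) ≤ 2 * (bits q + bits r) + 2 := by
  rw [sub_eq_add_neg, ← bits_neg r]
  exact bits_add_le _ _

theorem bits_mul_le (q r : ℚ) : bits (q * r) ≤ 2 * (bits q + bits r) + 2 := by
  have : q * r = ((q.num * r.num : ℤ) : ℚ) / (q.den * r.den : ℕ) := by
    conv_lhs => rw [← Rat.num_div_den q, ← Rat.num_div_den r]
    push_cast
    rw [div_mul_div_comm]
  rw [this]
  refine (bits_div_le _ (mul_ne_zero q.den_nz r.den_nz)).trans ?_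
  rw [Int.natAbs_mul]
  have h₂ := size_mul_le q.num.natAbs r.num.natAbs
  have h₄ := size_mul_le q.den r.den
  unfold bits
  omega

theorem bits_inv_le (q : ℚ) : bits q⁻¹ ≤ bits q + 1 := by
  rcases eq_or_ne q 0 with rfl | hq
  · simp [bits]
  have hn : q.num.natAbs ≠ 0 := by simpa using hq
  have : q⁻¹ = ((q.num.sign * q.den : ℤ) : ℚ) / (q.num.natAbs : ℕ) := by
    conv_lhs => rw [← Rat.num_div_den q, inv_div]
    have h₁ : ((q.num.sign : ℤ) : ℚ) * (q.num.natAbs : ℚ) = q.num := by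
      rw [← Int.cast_natCast, ← Int.cast_mul, Int.sign_mul_natAbs]
    have h₂ : (q.num : ℚ) ≠ 0 := by simpa using hq
    have h₃ : (q.num.natAbs : ℚ) ≠ 0 := by exact_mod_cast hn
    rw [div_eq_div_iff h₂ h₃]
    push_cast
    have h₄ : ((q.num.sign : ℤ) : ℚ) * q.num = q.num.natAbs := by
      rw [← Int.cast_natCast, ← Int.cast_mul, Int.sign_mul_self_eq_natAbs]
    rw [mul_right_comm, h₄, mul_comm]
  rw [this]
  refine (bits_div_le _ hn).trans ?_
  rw [Int.natAbs_mul, Int.natAbs_sign_of_ne_zero (by simpa using hq)]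
  simp only [bits, one_mul, Int.natAbs_natCast]
  omega

theorem bits_div_rat_le (q r : ℚ) : bits (q / r) ≤ 2 * (bits q + bits r) + 4 := by
  rw [div_eq_mul_inv]
  have := bits_mul_le q r⁻¹
  have := bits_inv_le r
  omega

theorem bits_natCast_le (n : ℕ) : bits (n : ℚ) ≤ n + 1 := by
  have : n.size ≤ n := Nat.size_le.2 Nat.lt_two_pow_self
  simpa [bits] using this

theorem bits_zero_le : bits 0 ≤ 1 := by simpa using bits_natCast_le 0

theorem bits_one_le : bits 1 ≤ 2 := by simpa using bits_natCast_le 1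

end Bits

/-! ### Programs with counting loops: correctness, cost and bit bounds -/

section Commands

/-- All memory cells hold numbers with at most `B` bits. -/
def BitBound (B : ℕ) (s : Mem) : Prop := ∀ p, bits (s p) ≤ B

/-- A factor in the cost of evaluating an expression. -/
def Expr.weight : Expr → ℕ
  | const c => 2 * bits c + 1
  | read _ i j k => 2 + weight i + weight j + weight k
  | .add e f => 4 * (weight e + weight f) + 9
  | .sub e f => 4 * (weight e + weight f) + 9
  | .mul e f => 4 * (weight e + weight f) + 9
  | .div e f => 4 * (weight e + weight f) + 9
  | le e f => 4 * (weight e + weight f) + 9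

/-- Bits and cost are bounded together, because the cost of an expression contains the bits of its
value, which are bounded by those of the operands. The value is counted twice in the sum; this turns
the factor `2` of the bit bounds into `4`, and the constant `9 = 2 * 4 + 1` comes from division, the
worst case. -/
theorem Expr.bits_add_cost_le {B : ℕ} {s : Mem} (hs : BitBound B s) (e : Expr) :
    bits (e.eval s) + e.cost s ≤ e.weight * (B + 1) := by
  induction e with
  | const c =>
    simp only [eval, cost, weight]
    nlinarith
  | read a i j k hi hj hk =>
    have := hs (a, ⌊eval s i⌋₊, ⌊eval s j⌋₊, ⌊eval s k⌋₊)
    simp only [eval, cost, weight]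
    nlinarith
  | add e f he hf =>
    have := bits_add_le (eval s e) (eval s f)
    simp only [eval, cost, weight]
    nlinarith
  | sub e f he hf =>
    have := bits_sub_le (eval s e) (eval s f)
    simp only [eval, cost, weight]
    nlinarith
  | mul e f he hf =>
    have := bits_mul_le (eval s e) (eval s f)
    simp only [eval, cost, weight]
    nlinarith
  | div e f he hf =>
    have := bits_div_rat_le (eval s e) (eval s f)
    simp only [eval, cost, weight]
    nlinarith
  | le e f he hf =>
    have : bits (eval s (le e f)) ≤ 2 := by
      unfold eval
      split_ifs
      exacts [bits_one_le, bits_zero_le.trans (by norm_num)]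
    simp only [cost, weight]
    nlinarith

theorem Expr.cost_le {B : ℕ} {s : Mem} (hs : BitBound B s) (e : Expr) :
    e.cost s ≤ e.weight * (B + 1) :=
  (Nat.le_add_left _ _).trans (e.bits_add_cost_le hs)

/-- The scalar variable with number `a`. -/
def Expr.var (a : ℕ) : Expr := .read a (.const 0) (.const 0) (.const 0)

@[simp] theorem Expr.eval_var (s : Mem) (a : ℕ) : (Expr.var a).eval s = s (a, 0, 0, 0) := by
  simp [Expr.var, Expr.eval]

/-- Structured programs, in which all loops are counting loops: `for_ a d c` executes `c` for the
values `0, …, n + d - 1` of the variable `a`, where `n` is the content of the variable `0`. -/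
inductive Cmd where
  | write (a : ℕ) (i j k e : Expr)
  | seq (c d : Cmd)
  | when (e : Expr) (c : Cmd)
  | for_ (a d : ℕ) (c : Cmd)

namespace Cmd

/-- Assignment to a variable. -/
def set (a : ℕ) (e : Expr) : Cmd := write a (.const 0) (.const 0) (.const 0) e

/-- The condition of a counting loop. -/
def test (a d : ℕ) : Expr := .le (.add (.var a) (.const 1)) (.add (.var 0) (.const d))

/-- The program for a structured program. -/
def toProg : Cmd → Prog
  | write a i j k e => .write a i j k e
  | seq c d => .seq c.toProg d.toProg
  | when e c => .cond e c.toProg .skip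
  | for_ a d c => .seq (.write a (.const 0) (.const 0) (.const 0) (.const 0))
      (.loop (test a d) (.seq c.toProg
        (.write a (.const 0) (.const 0) (.const 0) (.add (.var a) (.const 1)))))

/-- The program writes to the array `b`. -/
def Writes (b : ℕ) : Cmd → Prop
  | write a _ _ _ _ => b = a
  | seq c d => c.Writes b ∨ d.Writes b
  | when _ c => c.Writes b
  | for_ a _ c => b = a ∨ c.Writes b

/-- A factor in the cost of the administration of a counting loop. -/
def loopWeight (a d : ℕ) : ℕ :=
  10 + 6 * (Expr.const 0).weight + (test a d).weight + (Expr.add (.var a) (.const 1)).weight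

/-- A bound on the cost of a run in which all cells have at most `B` bits and all counters stay
below `L + 2`. -/
def cost (L B : ℕ) : Cmd → ℕ
  | write _ i j k e => (1 + i.weight + j.weight + k.weight + e.weight) * (B + 1)
  | seq c d => 1 + c.cost L B + d.cost L B
  | when e c => (2 + e.weight) * (B + 1) + c.cost L B
  -- At most `L + 1` rounds, the last test, which fails, and the reset of the counter.
  | for_ a d c => (L + 3) * (loopWeight a d * (B + 1) + c.cost L B)

/-- The nesting of loops is fixed by the program, so a polynomial bit bound gives a polynomial cost
bound. -/
theorem exists_cost_eq (c : Cmd) (q : Polynomial ℕ) :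
    ∃ p : Polynomial ℕ, ∀ L, c.cost L (q.eval L) = p.eval L := by
  induction c with
  | write a i j k e =>
    exact ⟨(Polynomial.C (1 + i.weight + j.weight + k.weight + e.weight)) * (q + 1), fun L => by
      simp [cost]⟩
  | seq c d hc hd =>
    obtain ⟨p, hp⟩ := hc
    obtain ⟨r, hr⟩ := hd
    exact ⟨1 + p + r, fun L => by simp [cost, hp, hr]⟩
  | when e c hc =>
    obtain ⟨p, hp⟩ := hc
    exact ⟨Polynomial.C (2 + e.weight) * (q + 1) + p, fun L => by simp [cost, hp]⟩
  | for_ a d c hc =>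
    obtain ⟨p, hp⟩ := hc
    exact ⟨(Polynomial.X + 3) * (Polynomial.C (loopWeight a d) * (q + 1) + p), fun L => by
      simp [cost, hp]⟩

/-- Started in `s`, which has cells of at most `B` bits, the program `c` halts within its cost bound
in a memory of the same kind in which `Q` holds and which differs from `s` only in arrays that `c`
writes to. -/
def Ensures (L B : ℕ) (c : Cmd) (s : Mem) (Q : Mem → Prop) : Prop :=
  BitBound B s → ∃ s' t, Run c.toProg s s' t ∧ t ≤ c.cost L B ∧ BitBound B s' ∧
    (∀ a, ¬ c.Writes a → ∀ p, s' (a, p) = s (a, p)) ∧ Q s'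

variable {L B : ℕ} {c d : Cmd} {s : Mem} {Q Q' : Mem → Prop}

theorem Ensures.mono (h : Ensures L B c s Q)
    (hQ : ∀ s', (∀ a, ¬ c.Writes a → ∀ p, s' (a, p) = s (a, p)) → Q s' → Q' s') :
    Ensures L B c s Q' := by
  intro hs
  obtain ⟨s', t, h₁, h₂, h₃, h₄, h₅⟩ := h hs
  exact ⟨s', t, h₁, h₂, h₃, h₄, hQ s' h₄ h₅⟩

theorem BitBound.update (hs : BitBound B s) {p : ℕ × ℕ × ℕ × ℕ} {q : ℚ} (hq : bits q ≤ B) :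
    BitBound B (Function.update s p q) := by
  intro p'
  rw [Function.update_apply]
  split_ifs
  exacts [hq, hs p']

theorem Ensures.write {a : ℕ} {i j k e : Expr} (hb : BitBound B s → bits (e.eval s) ≤ B)
    (hQ : Q (Function.update s (a, ⌊i.eval s⌋₊, ⌊j.eval s⌋₊, ⌊k.eval s⌋₊) (e.eval s))) :
    Ensures L B (.write a i j k e) s Q := by
  intro hs
  refine ⟨_, _, Run.write s a i j k e, ?_, BitBound.update hs (hb hs), ?_, hQ⟩
  · have h₁ := i.cost_le hs
    have h₂ := j.cost_le hs
    have h₃ := k.cost_le hs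
    have h₄ := e.cost_le hs
    simp only [cost]
    nlinarith
  · intro b hb p
    rw [Function.update_of_ne]
    intro h
    exact hb (congrArg Prod.fst h)

theorem Ensures.set {a : ℕ} {e : Expr} (hb : BitBound B s → bits (e.eval s) ≤ B)
    (hQ : Q (Function.update s (a, 0, 0, 0) (e.eval s))) : Ensures L B (.set a e) s Q :=
  Ensures.write hb (by simpa [Expr.eval] using hQ)

theorem Ensures.seq (h : Ensures L B c s fun s' => Ensures L B d s' Q) :
    Ensures L B (.seq c d) s Q := by
  intro hs
  obtain ⟨s', t, h₁, h₂, h₃, h₄, h₅⟩ := h hs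
  obtain ⟨s'', t', g₁, g₂, g₃, g₄, g₅⟩ := h₅ h₃
  refine ⟨s'', _, h₁.seq g₁, ?_, g₃, fun a ha p => ?_, g₅⟩
  · simp only [cost]
    omega
  · simp only [Writes, not_or] at ha
    rw [g₄ a ha.2, h₄ a ha.1]

theorem Ensures.when {e : Expr} (h₁ : e.eval s ≠ 0 → Ensures L B c s Q) (h₀ : e.eval s = 0 → Q s) :
    Ensures L B (.when e c) s Q := by
  intro hs
  have hc := e.cost_le hs
  by_cases he : e.eval s = 0
  · refine ⟨s, _, Run.cond_false he (Run.skip s), ?_, hs, fun _ _ _ => rfl, h₀ he⟩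
    simp only [cost]
    nlinarith
  · obtain ⟨s', t, g₁, g₂, g₃, g₄, g₅⟩ := h₁ he hs
    refine ⟨s', _, Run.cond_true he g₁, ?_, g₃, g₄, g₅⟩
    simp only [cost]
    nlinarith

/-- The rule for counting loops, with the loop invariant `I`. -/
theorem Ensures.for_ {a m n : ℕ} (I : ℕ → Mem → Prop) (hLB : L + 2 ≤ B) (hn : s (0, 0, 0, 0) = n)
    (hm : n + m ≤ L + 1) (ha : ¬ c.Writes a) (h0 : ¬ c.Writes 0) (ha0 : a ≠ 0)
    (hI : ∀ i s q, I i s → I i (Function.update s (a, 0, 0, 0) q)) (init : I 0 s)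
    (step : ∀ i < n + m, ∀ s', (∀ b, b ≠ a → ¬ c.Writes b → ∀ p, s' (b, p) = s (b, p)) →
      s' (a, 0, 0, 0) = (i : ℚ) → I i s' → Ensures L B c s' (I (i + 1)))
    (fin : ∀ s', (∀ b, b ≠ a → ¬ c.Writes b → ∀ p, s' (b, p) = s (b, p)) → I (n + m) s' → Q s') :
    Ensures L B (.for_ a m c) s Q := by
  have hincr : ∀ s : Mem, (Expr.add (.var a) (.const 1)).eval s = s (a, 0, 0, 0) + 1 := by
    intro s
    simp [Expr.eval]
  -- Induction on the number `k` of rounds that remain.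
  have key : ∀ k i, i + k = n + m → ∀ s', BitBound B s' →
      (∀ b, b ≠ a → ¬ c.Writes b → ∀ p, s' (b, p) = s (b, p)) → s' (a, 0, 0, 0) = (i : ℚ) → I i s' →
      ∃ s'' t, Run (.loop (test a m) (.seq c.toProg
        (.write a (.const 0) (.const 0) (.const 0) (.add (.var a) (.const 1))))) s' s'' t ∧
        t ≤ (k + 1) * (loopWeight a m * (B + 1) + c.cost L B) ∧ BitBound B s'' ∧
        (∀ b, b ≠ a → ¬ c.Writes b → ∀ p, s'' (b, p) = s (b, p)) ∧ I (n + m) s'' := by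
    intro k
    induction k with
    | zero =>
      intro i hi s' hs hfr hcount hinv
      have htest : (test a m).eval s' = 0 := by
        have h1 : s' (0, 0, 0, 0) = n := by rw [hfr 0 ha0.symm h0, hn]
        have h2 : ¬ ((i : ℚ) + 1 ≤ n + m) := by
          have : ((n + m : ℕ) : ℚ) = i := by rw [← hi, Nat.add_zero]
          push_cast at this
          linarith
        simp [test, Expr.eval, h1, hcount, h2]
      refine ⟨s', _, Run.loop_stop htest, ?_, hs, hfr, by simpa [← hi] using hinv⟩
      have := (test a m).cost_le hs
      have hw : loopWeight a m = 10 + 6 * (Expr.const 0).weight + (test a m).weight +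
        (Expr.add (.var a) (.const 1)).weight := rfl
      have h5 : (test a m).weight * (B + 1) + 10 * (B + 1) ≤ loopWeight a m * (B + 1) := by
        rw [hw, ← add_mul]
        exact Nat.mul_le_mul_right _ (by omega)
      omega
    | succ k ih =>
      intro i hi s' hs hfr hcount hinv
      have htest : (test a m).eval s' ≠ 0 := by
        have h1 : s' (0, 0, 0, 0) = n := by rw [hfr 0 ha0.symm h0, hn]
        have h2 : (i : ℚ) + 1 ≤ n + m := by
          have : i + 1 ≤ n + m := by omega
          exact_mod_cast this
        simp [test, Expr.eval, h1, hcount, h2]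
      obtain ⟨s₁, t₁, g₁, g₂, g₃, g₄, g₅⟩ := step i (by omega) s' hfr hcount hinv hs
      have hcount₁ : s₁ (a, 0, 0, 0) = i := by rw [g₄ a ha, hcount]
      have hval : (Expr.add (.var a) (.const 1)).eval s₁ = (i + 1 : ℕ) := by
        rw [hincr, hcount₁]
        push_cast
        rfl
      have hrun := Run.write s₁ a (.const 0) (.const 0) (.const 0) (.add (.var a) (.const 1))
      rw [hval] at hrun
      simp only [Expr.eval, Nat.floor_zero] at hrun
      set s₂ := Function.update s₁ (a, 0, 0, 0) ((i + 1 : ℕ) : ℚ) with hs₂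
      have hb₂ : BitBound B s₂ := BitBound.update g₃ ((bits_natCast_le _).trans (by omega))
      obtain ⟨s₃, t₃, f₁, f₂, f₃, f₄, f₅⟩ := ih (i + 1) (by omega) s₂ hb₂
        (fun b hb hw p => by
          rw [hs₂, Function.update_of_ne, g₄ b hw, hfr b hb hw]
          intro h
          exact hb (congrArg Prod.fst h))
        (by simp [hs₂]) (hI _ _ _ g₅)
      refine ⟨s₃, _, Run.loop_step htest (g₁.seq hrun) f₁, ?_, f₃, f₄, f₅⟩
      have h1 := (test a m).cost_le hs
      have h2 := (Expr.const 0).cost_le g₃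
      have h3 := (Expr.add (.var a) (.const 1)).cost_le g₃
      have hw : loopWeight a m = 10 + 6 * (Expr.const 0).weight + (test a m).weight +
        (Expr.add (.var a) (.const 1)).weight := rfl
      have h4 : (k + 1 + 1) * (loopWeight a m * (B + 1) + c.cost L B) =
        (k + 1) * (loopWeight a m * (B + 1) + c.cost L B) + loopWeight a m * (B + 1) +
          c.cost L B := by ring
      have h5 : loopWeight a m * (B + 1) = 10 * (B + 1) + 6 * ((Expr.const 0).weight * (B + 1)) +
        (test a m).weight * (B + 1) +
        (Expr.add (.var a) (.const 1)).weight * (B + 1) := by rw [hw]; ring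
      omega
  intro hs
  have hrun := Run.write s a (.const 0) (.const 0) (.const 0) (.const 0)
  simp only [Expr.eval, Nat.floor_zero] at hrun
  set s₀ := Function.update s (a, 0, 0, 0) 0 with hs₀
  have hfr₀ : ∀ b, b ≠ a → ∀ p, s₀ (b, p) = s (b, p) := by
    intro b hb p
    rw [hs₀, Function.update_of_ne]
    intro h
    exact hb (congrArg Prod.fst h)
  obtain ⟨s', t, g₁, g₂, g₃, g₄, g₅⟩ := key (n + m) 0 (by omega) s₀
    (BitBound.update hs (bits_zero_le.trans (by omega))) (fun b hb _ => hfr₀ b hb)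
    (by simp [hs₀]) (hI _ _ _ init)
  refine ⟨s', _, hrun.seq g₁, ?_, g₃, fun b hb p => ?_, fin s' g₄ g₅⟩
  · have h2 := (Expr.const 0).cost_le hs
    have h5 : loopWeight a m * (B + 1) = 10 * (B + 1) + 6 * ((Expr.const 0).weight * (B + 1)) +
      (test a m).weight * (B + 1) +
      (Expr.add (.var a) (.const 1)).weight * (B + 1) := by unfold loopWeight; ring
    have h6 : (n + m + 1) * (loopWeight a m * (B + 1) + c.cost L B) ≤
        (L + 2) * (loopWeight a m * (B + 1) + c.cost L B) := Nat.mul_le_mul_right _ (by omega)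
    have h7 : (L + 3) * (loopWeight a m * (B + 1) + c.cost L B) =
      (L + 2) * (loopWeight a m * (B + 1) + c.cost L B) + loopWeight a m * (B + 1) +
        c.cost L B := by ring
    simp only [cost, h7]
    omega
  · simp only [Writes, not_or] at hb
    exact g₄ b hb.1 hb.2 p

end Cmd

end Commands

end RAM

/-! ### Bit bounds from common denominators -/

namespace RAM

/-- `q` is a multiple of `1 / d` with absolute value at most `U`. -/
def IsFrac (d U : ℕ) (q : ℚ) : Prop := (∃ z : ℤ, q * d = z) ∧ |q| ≤ U

/-- Over the denominator `d` the numerator is at most `U * d ≤ 2 ^ (l + k)`, which has at most `l +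
k + 1` bits; the denominator has at most `k + 1`. -/
theorem IsFrac.bits_le {d U k l : ℕ} {q : ℚ} (h : IsFrac d U q) (hd0 : d ≠ 0) (hd : d ≤ 2 ^ k)
    (hU : U ≤ 2 ^ l) : bits q ≤ 2 * k + l + 2 := by
  obtain ⟨⟨z, hz⟩, hq⟩ := h
  have hd0' : (0 : ℚ) < d := by exact_mod_cast Nat.pos_of_ne_zero hd0
  have : q = (z : ℚ) / d := by rw [← hz, mul_div_cancel_right₀ _ hd0'.ne']
  have hzb : z.natAbs ≤ U * d := by
    have h1 : |(z : ℚ)| ≤ U * d := by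
      rw [← hz, abs_mul, abs_of_pos hd0']
      exact mul_le_mul_of_nonneg_right hq hd0'.le
    rw [← Int.cast_abs, Int.abs_eq_natAbs] at h1
    exact_mod_cast h1
  have hUd : U * d < 2 ^ (l + k + 1) := by
    rw [pow_succ, pow_add]
    have := Nat.mul_le_mul hU hd
    have : 0 < 2 ^ l * 2 ^ k := by positivity
    omega
  rw [this]
  refine (bits_div_le z hd0).trans ?_
  have h1 : z.natAbs.size ≤ l + k + 1 := Nat.size_le.2 (hzb.trans_lt hUd)
  have h2 : d.size ≤ k + 1 :=
    Nat.size_le.2 (hd.trans_lt (Nat.pow_lt_pow_right (by norm_num) (Nat.lt_succ_self k)))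
  omega

theorem exists_mul_den (q : ℚ) {d : ℕ} (h : q.den ∣ d) : ∃ z : ℤ, q * d = z := by
  obtain ⟨k, rfl⟩ := h
  refine ⟨q.num * k, ?_⟩
  push_cast
  rw [← mul_assoc, Rat.mul_den_eq_num]

theorem den_le_two_pow {q : ℚ} {k : ℕ} (h : bits q ≤ k) : q.den ≤ 2 ^ k :=
  (Nat.lt_size_self _).le.trans (Nat.pow_le_pow_right (by norm_num)
    ((Nat.le_add_left _ _).trans h))

theorem abs_le_two_pow {q : ℚ} {k : ℕ} (h : bits q ≤ k) : |q| ≤ (2 ^ k : ℕ) := by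
  have h1 : q.num.natAbs ≤ 2 ^ k := (Nat.lt_size_self _).le.trans
    (Nat.pow_le_pow_right (by norm_num) ((Nat.le_add_right _ _).trans h))
  have h2 : |q| ≤ q.num.natAbs := by
    conv_lhs => rw [← Rat.num_div_den q]
    rw [abs_div, Nat.abs_cast, ← Int.cast_abs, Int.abs_eq_natAbs, Int.cast_natCast]
    exact div_le_self (Nat.cast_nonneg _) (by exact_mod_cast q.den_pos)
  exact h2.trans (by exact_mod_cast h1)

end RAM

namespace Game

open RAM

variable {n : ℕ} (G : Game (Fin n) ℚ)

theorem le_size : n ≤ G.size := Nat.le_add_right _ _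

theorem bits_leafUtil_le (i : Player) (v : Fin n) : bits (G.leafUtil i v) ≤ G.size := by
  have h : bits (G.leafUtil Player.leader v) + bits (G.leafUtil Player.follower v) ≤
      ∑ v, (bits (G.leafUtil Player.leader v) + bits (G.leafUtil Player.follower v)) :=
    Finset.single_le_sum (f := fun v =>
      bits (G.leafUtil Player.leader v) + bits (G.leafUtil Player.follower v))
      (fun _ _ => Nat.zero_le _) (Finset.mem_univ v)
  unfold size
  cases i <;> omega

/-- The targets for the follower's utility; the last index stands for the punishing state. -/
def target (j : Fin (n + 1)) : ℚ :=
  if h : (j : ℕ) < n then G.leafUtil Player.follower ⟨j, h⟩ else 0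

theorem bits_target_le (j : Fin (n + 1)) : bits (G.target j) ≤ G.size + 1 := by
  unfold target
  split_ifs
  · exact (G.bits_leafUtil_le _ _).trans (Nat.le_succ _)
  · exact bits_zero_le.trans (by omega)

/-- A common denominator of the leader's utilities at the leaves. -/
def valueDen : ℕ := ∏ v, (G.leafUtil Player.leader v).den

/-- A common denominator of the weights with which targets are combined. -/
def weightDen : ℕ := ∏ a, ∏ b, (G.target b - G.target a).den * ((G.target b - G.target a)⁻¹).den

/-- A common denominator of the utilities of the leader after `r` rounds. -/
def levelDen (r : ℕ) : ℕ := G.valueDen * G.weightDen ^ r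

/-- The exponent of a power of two that bounds the denominators, in terms of the input size. -/
def denBound (L : ℕ) : ℕ := L * L + (8 * L + 13) * (L + 1) * (L + 1) * L

/-- A bound on the number of bits of all memory cells, in terms of the input size. -/
def bitBound (L : ℕ) : ℕ := 2 * denBound L + L + 4

theorem valueDen_ne_zero : G.valueDen ≠ 0 := Finset.prod_ne_zero_iff.2 fun _ _ => Rat.den_nz _

theorem weightDen_ne_zero : G.weightDen ≠ 0 :=
  Finset.prod_ne_zero_iff.2 fun _ _ => Finset.prod_ne_zero_iff.2 fun _ _ =>
    mul_ne_zero (Rat.den_nz _) (Rat.den_nz _)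

theorem levelDen_ne_zero (r : ℕ) : G.levelDen r ≠ 0 :=
  mul_ne_zero G.valueDen_ne_zero (pow_ne_zero _ G.weightDen_ne_zero)

theorem valueDen_le : G.valueDen ≤ 2 ^ (G.size * G.size) := by
  refine (Finset.prod_le_pow_card _ _ (2 ^ G.size)
    fun v _ => den_le_two_pow (G.bits_leafUtil_le _ v)).trans ?_
  rw [Finset.card_univ, Fintype.card_fin, ← pow_mul]
  exact Nat.pow_le_pow_right (by norm_num) (Nat.mul_le_mul_left _ G.le_size)

theorem weightDen_le :
    G.weightDen ≤ 2 ^ ((8 * G.size + 13) * (G.size + 1) * (G.size + 1)) := by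
  have h1 : ∀ a b, (G.target b - G.target a).den * ((G.target b - G.target a)⁻¹).den ≤
      2 ^ (8 * G.size + 13) := by
    intro a b
    have h1 := bits_sub_le (G.target b) (G.target a)
    have h2 := bits_inv_le (G.target b - G.target a)
    have h3 := G.bits_target_le a
    have h4 := G.bits_target_le b
    calc _ ≤ 2 ^ (4 * G.size + 6) * 2 ^ (4 * G.size + 7) :=
          Nat.mul_le_mul (den_le_two_pow (by omega)) (den_le_two_pow (by omega))
      _ = 2 ^ (8 * G.size + 13) := by rw [← pow_add]; congr 1; ring
  have h2 : ∀ a, ∏ b, (G.target b - G.target a).den * ((G.target b - G.target a)⁻¹).den ≤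
      2 ^ ((8 * G.size + 13) * (G.size + 1)) := by
    intro a
    refine (Finset.prod_le_pow_card _ _ _ fun b _ => h1 a b).trans ?_
    rw [Finset.card_univ, Fintype.card_fin, ← pow_mul]
    exact Nat.pow_le_pow_right (by norm_num)
      (Nat.mul_le_mul_left _ (Nat.add_le_add_right G.le_size 1))
  refine (Finset.prod_le_pow_card _ _ _ fun a _ => h2 a).trans ?_
  rw [Finset.card_univ, Fintype.card_fin, ← pow_mul]
  exact Nat.pow_le_pow_right (by norm_num)
    (Nat.mul_le_mul_left _ (Nat.add_le_add_right G.le_size 1))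

theorem levelDen_le {r : ℕ} (hr : r ≤ n) : G.levelDen r ≤ 2 ^ denBound G.size := by
  unfold levelDen denBound
  rw [pow_add]
  refine Nat.mul_le_mul G.valueDen_le ((Nat.pow_le_pow_left G.weightDen_le r).trans ?_)
  rw [← pow_mul]
  exact Nat.pow_le_pow_right (by norm_num) (Nat.mul_le_mul_left _ (hr.trans G.le_size))

theorem bits_le_bitBound {r : ℕ} (hr : r ≤ n) {q : ℚ}
    (h : IsFrac (G.levelDen r) (2 ^ G.size) q) : bits q ≤ bitBound G.size := by
  have := h.bits_le (G.levelDen_ne_zero r) (G.levelDen_le hr) le_rfl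
  unfold bitBound
  omega

/-- A weight is a difference of targets times the inverse of such a difference, and `weightDen`
contains the denominators of all of these as separate factors. -/
theorem exists_weight_mul (j j₁ j₂ : Fin (n + 1)) :
    ∃ z : ℤ, weight G.target j j₁ j₂ * G.weightDen = z := by
  have hdvd : (G.target j₂ - G.target j).den * ((G.target j₂ - G.target j₁)⁻¹).den ∣
      G.weightDen := by
    unfold weightDen
    simp only [Finset.prod_mul_distrib]
    refine mul_dvd_mul ?_ ?_
    · exact (Finset.dvd_prod_of_mem (fun b => (G.target b - G.target j).den)
        (Finset.mem_univ j₂)).trans (Finset.dvd_prod_of_mem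
          (fun a => ∏ b, (G.target b - G.target a).den) (Finset.mem_univ j))
    · exact (Finset.dvd_prod_of_mem (fun b => ((G.target b - G.target j₁)⁻¹).den)
        (Finset.mem_univ j₂)).trans (Finset.dvd_prod_of_mem
          (fun a => ∏ b, ((G.target b - G.target a)⁻¹).den) (Finset.mem_univ j₁))
  obtain ⟨k, hk⟩ := hdvd
  refine ⟨(G.target j₂ - G.target j).num * ((G.target j₂ - G.target j₁)⁻¹).num * k, ?_⟩
  rw [hk, weight, div_eq_mul_inv]
  push_cast
  rw [← Rat.mul_den_eq_num, ← Rat.mul_den_eq_num]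
  ring

theorem isFrac_leafUtil (r : ℕ) (v : Fin n) :
    IsFrac (G.levelDen r) (2 ^ G.size) (G.leafUtil Player.leader v) :=
  ⟨exists_mul_den _ ((Finset.dvd_prod_of_mem (fun v => (G.leafUtil Player.leader v).den)
    (Finset.mem_univ v)).mul_right _), abs_le_two_pow (G.bits_leafUtil_le _ v)⟩

/-- The reason for polynomial growth: a round costs one factor `weightDen`, whatever the two entries
are, and a convex combination stays within the bound on absolute values. -/
theorem isFrac_combination {r : ℕ} {j j₁ j₂ : Fin (n + 1)} {y₁ y₂ : ℚ}
    (h₁ : G.target j₁ ≤ G.target j) (h₂ : G.target j ≤ G.target j₂)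
    (hy₁ : IsFrac (G.levelDen r) (2 ^ G.size) y₁) (hy₂ : IsFrac (G.levelDen r) (2 ^ G.size) y₂) :
    IsFrac (G.levelDen (r + 1)) (2 ^ G.size)
      (weight G.target j j₁ j₂ * y₁ + (1 - weight G.target j j₁ j₂) * y₂) := by
  obtain ⟨⟨z₁, hz₁⟩, hb₁⟩ := hy₁
  obtain ⟨⟨z₂, hz₂⟩, hb₂⟩ := hy₂
  obtain ⟨z, hz⟩ := G.exists_weight_mul j j₁ j₂
  have hw₁ := weight_nonneg h₁ h₂
  have hw₂ := weight_le_one h₁ h₂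
  have hl : G.levelDen (r + 1) = G.levelDen r * G.weightDen := by
    unfold levelDen
    rw [pow_succ, mul_assoc]
  refine ⟨⟨z * z₁ + (G.weightDen - z) * z₂, ?_⟩, ?_⟩
  · rw [hl]
    push_cast
    rw [← hz, ← hz₁, ← hz₂]
    ring
  · rw [abs_le] at hb₁ hb₂ ⊢
    constructor <;> nlinarith

/-- Covers the move probabilities of the output: `a` and `b` tell whether the child is the first and
the second one of the move. The factor `valueDen` in `levelDen 1` is not needed and does no harm. -/
theorem isFrac_of_weight {j j₁ j₂ : Fin (n + 1)} (h₁ : G.target j₁ ≤ G.target j)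
    (h₂ : G.target j ≤ G.target j₂) {a b : ℤ} (ha : a = 0 ∨ a = 1) (hb : b = 0 ∨ b = 1) :
    IsFrac (G.levelDen 1) (2 ^ G.size)
      (a * weight G.target j j₁ j₂ + b * (1 - weight G.target j j₁ j₂)) := by
  obtain ⟨z, hz⟩ := G.exists_weight_mul j j₁ j₂
  have hw₁ := weight_nonneg h₁ h₂
  have hw₂ := weight_le_one h₁ h₂
  refine ⟨⟨G.valueDen * (a * z + b * (G.weightDen - z)), ?_⟩, ?_⟩
  · unfold levelDen
    rw [pow_one]
    push_cast
    rw [← hz]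
    ring
  · have : (1 : ℚ) ≤ (2 ^ G.size : ℕ) := by exact_mod_cast Nat.one_le_two_pow
    refine le_trans ?_ this
    rw [abs_le]
    rcases ha with rfl | rfl <;> rcases hb with rfl | rfl <;> push_cast <;>
      constructor <;> linarith

theorem exists_bitBound_eq : ∃ p : Polynomial ℕ, ∀ L, bitBound L = p.eval L :=
  ⟨2 * (.X * .X + (8 * .X + 13) * (.X + 1) * (.X + 1) * .X) + .X + 4, fun L => by
    simp [bitBound, denBound]⟩

theorem bitBound_input : BitBound (bitBound G.size) G.input := by
  have h0 : bits 0 ≤ bitBound G.size := bits_zero_le.trans (by unfold bitBound; omega)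
  have h1 : bits 1 ≤ bitBound G.size := bits_one_le.trans (by unfold bitBound; omega)
  have h2 : bits 2 ≤ bitBound G.size :=
    (by simpa using bits_natCast_le 2 : bits 2 ≤ 3).trans (by unfold bitBound; omega)
  have hn := G.le_size
  have hu : ∀ i v, bits (G.leafUtil i v) ≤ bitBound G.size := fun i v =>
    (G.bits_leafUtil_le i v).trans (by unfold bitBound; omega)
  intro p
  unfold input
  split
  · exact (bits_natCast_le n).trans (by unfold bitBound; omega)
  · exact (bits_natCast_le _).trans (by have := G.root.2; unfold bitBound; omega)
  · split_ifs <;> assumption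
  · split_ifs
    · split <;> assumption
    · exact h0
  · split_ifs
    exacts [hu _ _, h0]
  · split_ifs
    exacts [hu _ _, h0]
  · exact h0

end Game

/-! ### Conditions as expressions, and rules for unchanged arrays -/

namespace RAM

namespace Expr

/-- Conjunction of conditions. -/
def conj (e f : Expr) : Expr := .mul e f

/-- Negation of a condition. -/
def neg (e : Expr) : Expr := .mul (.le e (.const 0)) (.le (.const 0) e)

/-- Disjunction of conditions. -/
def disj (e f : Expr) : Expr := neg (conj (neg e) (neg f))

/-- Strict inequality. -/
def less (e f : Expr) : Expr := neg (.le f e)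

/-- Equality. -/
def equal (e f : Expr) : Expr := .mul (.le e f) (.le f e)

variable {s : Mem} {e f : Expr}

theorem eval_le_ne_zero : (Expr.le e f).eval s ≠ 0 ↔ e.eval s ≤ f.eval s := by
  simp [eval]

theorem eval_conj_ne_zero : (conj e f).eval s ≠ 0 ↔ e.eval s ≠ 0 ∧ f.eval s ≠ 0 := by
  simp [conj, eval]

theorem eval_neg_ne_zero : (neg e).eval s ≠ 0 ↔ ¬ e.eval s ≠ 0 := by
  simp only [neg, eval]
  constructor
  · intro h h'
    rcases lt_or_gt_of_ne h' with h1 | h1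
    · exact h (by simp [not_le.2 h1])
    · exact h (by simp [not_le.2 h1])
  · intro h
    simp [not_not.1 h]

theorem eval_disj_ne_zero : (disj e f).eval s ≠ 0 ↔ e.eval s ≠ 0 ∨ f.eval s ≠ 0 := by
  rw [disj, eval_neg_ne_zero, eval_conj_ne_zero, eval_neg_ne_zero, eval_neg_ne_zero]
  tauto

theorem eval_less_ne_zero : (less e f).eval s ≠ 0 ↔ e.eval s < f.eval s := by
  rw [less, eval_neg_ne_zero, eval_le_ne_zero, not_le]

theorem eval_equal : (equal e f).eval s = if e.eval s = f.eval s then 1 else 0 := by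
  simp only [equal, eval]
  rcases lt_trichotomy (e.eval s) (f.eval s) with h | h | h
  · simp [h.ne, not_le.2 h]
  · simp [h]
  · simp [h.ne', not_le.2 h]

theorem eval_equal_ne_zero : (equal e f).eval s ≠ 0 ↔ e.eval s = f.eval s := by
  rw [eval_equal]
  split_ifs with h <;> simp [h]

theorem eval_read (a : ℕ) (i j k : Expr) :
    (read a i j k).eval s = s (a, ⌊i.eval s⌋₊, ⌊j.eval s⌋₊, ⌊k.eval s⌋₊) := rfl

theorem eval_const (c : ℚ) : (const c).eval s = c := rfl

theorem eval_add : (Expr.add e f).eval s = e.eval s + f.eval s := rfl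

theorem eval_sub : (Expr.sub e f).eval s = e.eval s - f.eval s := rfl

theorem eval_mul : (Expr.mul e f).eval s = e.eval s * f.eval s := rfl

theorem eval_div : (Expr.div e f).eval s = e.eval s / f.eval s := rfl

/-- Access to a one-dimensional array. -/
def read₁ (a : ℕ) (i : Expr) : Expr := .read a i (.const 0) (.const 0)

/-- Access to a two-dimensional array. -/
def read₂ (a : ℕ) (i j : Expr) : Expr := .read a i j (.const 0)

theorem eval_read₁ (a : ℕ) (i : Expr) : (read₁ a i).eval s = s (a, ⌊i.eval s⌋₊, 0, 0) := by
  simp [read₁, eval]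

theorem eval_read₂ (a : ℕ) (i j : Expr) :
    (read₂ a i j).eval s = s (a, ⌊i.eval s⌋₊, ⌊j.eval s⌋₊, 0) := by
  simp [read₂, eval]

end Expr

/-- The two memories agree on all arrays with a number below `k`. -/
def AgreeBelow (k : ℕ) (s s' : Mem) : Prop := ∀ b < k, ∀ p, s' (b, p) = s (b, p)

namespace Cmd

/-- Arrays are numbered so that the body of such a loop writes only to numbers above that of the
counter. The input, the outer counters and all variables with smaller numbers are then preserved
automatically. -/
theorem Ensures.for_above {L B : ℕ} {c : Cmd} {s : Mem} {Q : Mem → Prop} {a m n : ℕ}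
    (I : ℕ → Mem → Prop) (hLB : L + 2 ≤ B) (hn : s (0, 0, 0, 0) = n) (hm : n + m ≤ L + 1)
    (ha : a ≠ 0) (hc : ∀ b ≤ a, ¬ c.Writes b)
    (hI : ∀ i s q, I i s → I i (Function.update s (a, 0, 0, 0) q)) (init : I 0 s)
    (step : ∀ i < n + m, ∀ s', AgreeBelow a s s' → s' (a, 0, 0, 0) = (i : ℚ) → I i s' →
      Ensures L B c s' (I (i + 1)))
    (fin : ∀ s', AgreeBelow a s s' → I (n + m) s' → Q s') :
    Ensures L B (.for_ a m c) s Q :=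
  Ensures.for_ I hLB hn hm (hc a le_rfl) (hc 0 (Nat.zero_le a)) ha hI init
    (fun i hi s' hs' => step i hi s' fun b hb => hs' b hb.ne (hc b hb.le))
    (fun s' hs' => fin s' fun b hb => hs' b hb.ne (hc b hb.le))

theorem Ensures.agree {L B : ℕ} {c : Cmd} {s : Mem} {Q : Mem → Prop} {k : ℕ}
    (hc : ∀ b < k, ¬ c.Writes b) (h : Ensures L B c s Q) :
    Ensures L B c s fun s' => AgreeBelow k s s' ∧ Q s' :=
  h.mono fun _ hs hq => ⟨fun b hb => hs b (hc b hb), hq⟩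

theorem Ensures.write_two {L B : ℕ} {s : Mem} {Q : Mem → Prop} {a : ℕ} {i j e : Expr} {x y : ℕ}
    {q : ℚ} (hi : i.eval s = x) (hj : j.eval s = y) (he : e.eval s = q)
    (hb : BitBound B s → bits q ≤ B) (hQ : Q (Function.update s (a, x, y, 0) q)) :
    Ensures L B (.write a i j (.const 0) e) s Q :=
  Ensures.write (fun h => he ▸ hb h) (by simpa [hi, hj, he, Expr.eval] using hQ)

theorem Ensures.write_three {L B : ℕ} {s : Mem} {Q : Mem → Prop} {a : ℕ} {i j k e : Expr}
    {x y z : ℕ} {q : ℚ} (hi : i.eval s = x) (hj : j.eval s = y) (hk : k.eval s = z)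
    (he : e.eval s = q) (hb : BitBound B s → bits q ≤ B)
    (hQ : Q (Function.update s (a, x, y, z) q)) :
    Ensures L B (.write a i j k e) s Q :=
  Ensures.write (fun h => he ▸ hb h) (by simpa [hi, hj, hk, he] using hQ)

theorem Ensures.set_eq {L B : ℕ} {s : Mem} {Q : Mem → Prop} {a : ℕ} {e : Expr} {q : ℚ}
    (he : e.eval s = q) (hb : BitBound B s → bits q ≤ B)
    (hQ : Q (Function.update s (a, 0, 0, 0) q)) : Ensures L B (.set a e) s Q :=
  Ensures.set (fun h => he ▸ hb h) (he ▸ hQ)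

end Cmd

theorem AgreeBelow.trans {k l : ℕ} {s s' s'' : Mem} (h : AgreeBelow k s s')
    (h' : AgreeBelow l s' s'') (hkl : k ≤ l) : AgreeBelow k s s'' :=
  fun b hb p => (h' b (hb.trans_le hkl) p).trans (h b hb p)

theorem AgreeBelow.update {k : ℕ} {s s' : Mem} (h : AgreeBelow k s s') {a : ℕ} (ha : k ≤ a)
    (p : ℕ × ℕ × ℕ) (q : ℚ) : AgreeBelow k s (Function.update s' (a, p) q) := by
  intro b hb p'
  rw [Function.update_of_ne, h b hb]
  intro h
  have : b = a := congrArg Prod.fst h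
  omega

end RAM

namespace Game

open RAM

variable {n : ℕ} {G : Game (Fin n) ℚ} {s : Mem}

/-- The input arrays of the memory describe the game `G`. -/
def Loaded (G : Game (Fin n) ℚ) (s : Mem) : Prop := AgreeBelow 5 G.input s

theorem Loaded.nodes (h : G.Loaded s) : s (0, 0, 0, 0) = n := h 0 (by norm_num) _

theorem Loaded.root (h : G.Loaded s) : s (0, 1, 0, 0) = (G.root : ℕ) := h 0 (by norm_num) _

theorem Loaded.child (h : G.Loaded s) (v w : Fin n) :
    s (1, v, w, 0) ≠ 0 ↔ w ∈ G.children v := by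
  rw [h 1 (by norm_num)]
  simp [input]

theorem Loaded.owner (h : G.Loaded s) (v : Fin n) :
    s (2, v, 0, 0) = 1 ↔ G.owner v = Player.leader := by
  rw [h 2 (by norm_num)]
  simp only [input, v.2, dif_pos, Fin.eta]
  cases G.owner v <;> simp

theorem Loaded.leader (h : G.Loaded s) (v : Fin n) :
    s (3, v, 0, 0) = G.leafUtil Player.leader v := by
  rw [h 3 (by norm_num)]
  simp [input]

theorem Loaded.target (h : G.Loaded s) (j : Fin (n + 1)) : s (4, j, 0, 0) = G.target j := by
  rw [h 4 (by norm_num)]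
  rfl

theorem Loaded.follower (h : G.Loaded s) (v : Fin n) :
    s (4, v, 0, 0) = G.leafUtil Player.follower v := by
  rw [h 4 (by norm_num)]
  simp [input]

theorem Loaded.mono {k : ℕ} {s' : Mem} (h : G.Loaded s) (h' : AgreeBelow k s s') (hk : 5 ≤ k) :
    G.Loaded s' := AgreeBelow.trans h h' hk

theorem leafUtil_of_leaf (i : Player) {v : Fin n} (hv : G.children v = ∅) :
    G.leafUtil i v = G.util i v := by
  simp [leafUtil, hv]

theorem owner_ne_leader_iff {V K : Type*} {G : Game V K} {v : V} :
    G.owner v ≠ Player.leader ↔ G.owner v = Player.follower := by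
  cases G.owner v <;> simp

end Game

open RAM.Expr

/-! ### The security levels: program and correctness -/

namespace RAM

/-- The condition under which the child in variable `12` is a better reply than the child in
variable `14`. -/
def lowCond : Expr :=
  conj (read₂ 1 (var 9) (var 12)) (disj (equal (var 14) (var 0))
    (disj (conj (equal (read₁ 2 (var 9)) (.const 1)) (less (read₂ 10 (var 8) (var 12)) (var 13)))
      (conj (neg (equal (read₁ 2 (var 9)) (.const 1)))
        (less (var 13) (read₂ 10 (var 8) (var 12))))))

/-- The search for the best reply among the children. -/
def lowSearch : Cmd :=
  .for_ 12 0 (.when lowCond (.seq (.set 13 (read₂ 10 (var 8) (var 12))) (.set 14 (var 12))))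

/-- Round `8` of the computation of the security levels (array `10`) and of the children at which
they are attained (array `11`). -/
def lowRound : Cmd :=
  .for_ 9 0 (.seq (.set 13 (read₁ 4 (var 9))) (.seq (.set 14 (var 0)) (.seq lowSearch
    (.seq (.write 10 (.add (var 8) (.const 1)) (var 9) (.const 0) (var 13))
      (.write 11 (.add (var 8) (.const 1)) (var 9) (.const 0) (var 14))))))

/-- The computation of the security levels. -/
def lowCmd : Cmd := .for_ 8 0 lowRound

end RAM

namespace Game

open RAM Cmd

variable {n : ℕ} {G : Game (Fin n) ℚ} {L B : ℕ} {s : Mem}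

/-- The number `a` and the child with number `q` are an optimal reply of the owner of `v` when the
children have the security levels `g`. -/
def IsReply (G : Game (Fin n) ℚ) (v : Fin n) (g : Fin n → ℚ) (a q : ℚ) : Prop :=
  IsLow G v g a ∧ (G.children v = ∅ → q = n) ∧
    ((G.children v).Nonempty → ∃ w ∈ G.children v, q = (w : ℕ) ∧ g w = a)

/-- The value `n` in variable `14` means that no child has been seen, so the initial content of
variable `13` never competes with a child; at a leaf it survives as the result. -/
theorem lowSearch_ensures (hLB : L + 2 ≤ B) (hnL : n ≤ L) (hs : G.Loaded s) {r : ℕ} {v : Fin n}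
    (h8 : s (8, 0, 0, 0) = r) (h9 : s (9, 0, 0, 0) = (v : ℕ))
    (h13 : s (13, 0, 0, 0) = G.leafUtil Player.follower v) (h14 : s (14, 0, 0, 0) = n) :
    Ensures L B lowSearch s fun s' =>
      G.IsReply v (fun w => s (10, r, w, 0)) (s' (13, 0, 0, 0)) (s' (14, 0, 0, 0)) := by
  set g : Fin n → ℚ := fun w => s (10, r, w, 0) with hg
  refine Ensures.for_above (n := n)
    (fun i s' => ((∀ w : Fin n, (w : ℕ) < i → w ∉ G.children v) ∧
        s' (13, 0, 0, 0) = G.leafUtil Player.follower v ∧ s' (14, 0, 0, 0) = n) ∨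
      ∃ w ∈ G.children v, s' (14, 0, 0, 0) = (w : ℕ) ∧ s' (13, 0, 0, 0) = g w ∧
        (G.owner v = Player.leader → ∀ w' ∈ G.children v, (w' : ℕ) < i → g w ≤ g w') ∧
        (G.owner v = Player.follower → ∀ w' ∈ G.children v, (w' : ℕ) < i → g w' ≤ g w))
    hLB hs.nodes (by omega) (by norm_num) (by simp [Cmd.Writes, Cmd.set]; omega) ?_ ?_ ?_ ?_
  · intro i s' q h
    simpa [Function.update_apply] using h
  · left
    simp [h13, h14]
  · intro i hi s' hagree hcount hinv
    set w : Fin n := ⟨i, by simpa using hi⟩ with hw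
    have hs' := hs.mono hagree (by norm_num)
    have e8 : s' (8, 0, 0, 0) = r := by rw [hagree 8 (by norm_num), h8]
    have e9 : s' (9, 0, 0, 0) = (v : ℕ) := by rw [hagree 9 (by norm_num), h9]
    have hread : (Expr.read₂ 10 (.var 8) (.var 12)).eval s' = g w := by
      simp only [Expr.eval_read₂, Expr.eval_var, e8, hcount, Nat.floor_natCast]
      exact hagree 10 (by norm_num) _
    have hcond : lowCond.eval s' ≠ 0 ↔ w ∈ G.children v ∧ (s' (14, 0, 0, 0) = n ∨
        G.owner v = Player.leader ∧ g w < s' (13, 0, 0, 0) ∨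
        G.owner v = Player.follower ∧ s' (13, 0, 0, 0) < g w) := by
      have h1 := hs'.child v w
      simp only [lowCond, Expr.eval_conj_ne_zero, Expr.eval_disj_ne_zero, Expr.eval_equal_ne_zero,
        Expr.eval_neg_ne_zero, Expr.eval_less_ne_zero, hread, Expr.eval_var, Expr.eval_const,
        hs'.nodes, Expr.eval_read₂ 1, Expr.eval_read₁, e9, hcount, Nat.floor_natCast, hs'.owner,
        ← owner_ne_leader_iff, ne_eq, ← h1]
      rfl
    have hsucc : ∀ w' : Fin n, (w' : ℕ) < i + 1 → (w' : ℕ) < i ∨ w' = w := fun w' h => by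
      rcases Nat.lt_succ_iff_lt_or_eq.1 h with h | h
      · exact .inl h
      · exact .inr (Fin.ext h)
    refine Ensures.when (fun hne => ?_) (fun hz => ?_)
    · obtain ⟨hmem, hbetter⟩ := hcond.1 hne
      refine Ensures.seq (Ensures.set_eq hread
        (fun h => by rw [← hread, Expr.eval_read₂]; exact h _) (Ensures.set_eq (q := (w : ℕ)) ?_
        (fun _ => (bits_natCast_le _).trans (by have := w.2; omega)) ?_))
      · simp [hcount, hw]
      · right
        refine ⟨w, hmem, by simp, by simp, fun ho w' hw' hlt => ?_, fun ho w' hw' hlt => ?_⟩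
        · rcases hsucc w' hlt with h | rfl
          · rcases hinv with ⟨h1, -⟩ | ⟨u, hu, h1, h2, h3, h4⟩
            · exact absurd hw' (h1 w' h)
            · rcases hbetter with hb | hb | hb
              · rw [h1] at hb
                exact absurd (Nat.cast_injective hb) u.2.ne
              · exact (hb.2.le.trans h2.le).trans (h3 ho w' hw' h)
              · simp [ho] at hb
          · exact le_rfl
        · rcases hsucc w' hlt with h | rfl
          · rcases hinv with ⟨h1, -⟩ | ⟨u, hu, h1, h2, h3, h4⟩
            · exact absurd hw' (h1 w' h)
            · rcases hbetter with hb | hb | hb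
              · rw [h1] at hb
                exact absurd (Nat.cast_injective hb) u.2.ne
              · simp [ho] at hb
              · exact (h4 ho w' hw' h).trans (h2.ge.trans hb.2.le)
          · exact le_rfl
    · have hnot : ¬ (w ∈ G.children v ∧ _) := fun h => hcond.2 h hz
      rcases hinv with ⟨h1, h2, h3⟩ | ⟨u, hu, h1, h2, h3, h4⟩
      · refine .inl ⟨fun w' hlt hw' => ?_, h2, h3⟩
        rcases hsucc w' hlt with h | rfl
        · exact h1 w' h hw'
        · exact hnot ⟨hw', .inl h3⟩
      · refine .inr ⟨u, hu, h1, h2, fun ho w' hw' hlt => ?_, fun ho w' hw' hlt => ?_⟩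
        · rcases hsucc w' hlt with h | rfl
          · exact h3 ho w' hw' h
          · by_contra hcon
            exact hnot ⟨hw', .inr (.inl ⟨ho, h2 ▸ not_le.1 hcon⟩)⟩
        · rcases hsucc w' hlt with h | rfl
          · exact h4 ho w' hw' h
          · by_contra hcon
            exact hnot ⟨hw', .inr (.inr ⟨ho, h2 ▸ not_le.1 hcon⟩)⟩
  · intro s' _ hinv
    rcases hinv with ⟨h1, h2, h3⟩ | ⟨u, hu, h1, h2, h3, h4⟩
    · have hv : G.children v = ∅ := Finset.eq_empty_iff_forall_notMem.2 fun w => h1 w (by simp)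
      refine ⟨⟨fun _ => by rw [h2, leafUtil_of_leaf _ hv], by simp [hv], by simp [hv], by simp [hv]⟩,
        fun _ => h3, by simp [hv]⟩
    · have hv : G.children v ≠ ∅ := Finset.ne_empty_of_mem hu
      rw [h2]
      exact ⟨⟨fun h => absurd h hv, fun ho w hw => h3 ho w hw (by simp),
        fun ho w hw => h4 ho w hw (by simp), fun _ => ⟨u, hu, rfl⟩⟩, fun h => absurd h hv,
        fun _ => ⟨u, hu, h1, rfl⟩⟩

/-- The security levels in round `r + 1` are optimal with respect to those in round `r`. -/
def LowLevel (G : Game (Fin n) ℚ) (s : Mem) (r : ℕ) (v : Fin n) : Prop :=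
  G.IsReply v (fun w => s (10, r, w, 0)) (s (10, r + 1, v, 0)) (s (11, r + 1, v, 0))

/-- Every round has rows of its own in arrays `10` and `11`: round `r` reads row `r` and writes row
`r + 1`, so the equations of earlier rounds remain true. Row `0` is arbitrary. -/
theorem lowCmd_ensures (hLB : L + 2 ≤ B) (hnL : n ≤ L) (hs : G.Loaded s) :
    Ensures L B lowCmd s fun s' => ∀ r < n, ∀ v, G.LowLevel s' r v := by
  refine Ensures.for_above (n := n) (fun i s' => ∀ r < i, ∀ v, G.LowLevel s' r v)
    hLB hs.nodes (by omega) (by norm_num)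
    (by simp [lowRound, lowSearch, Cmd.Writes, Cmd.set]; omega) ?_ (by simp) ?_ (fun _ _ h => h)
  · intro i s' q h
    simpa [LowLevel, Function.update_apply] using h
  intro r hr s₁ hagree₁ hcount₁ hinv₁
  have hs₁ := hs.mono hagree₁ (by norm_num)
  refine Ensures.for_above (n := n) (fun i s' => (∀ r' < r, ∀ v, G.LowLevel s' r' v) ∧
      ∀ v : Fin n, (v : ℕ) < i → G.LowLevel s' r v)
    hLB hs₁.nodes (by omega) (by norm_num)
    (by simp [lowSearch, Cmd.Writes, Cmd.set]; omega) ?_ ⟨hinv₁, by simp⟩ ?_ ?_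
  · intro i s' q h
    simpa [LowLevel, Function.update_apply] using h
  · intro i hi s₂ hagree₂ hcount₂ hinv₂
    set v : Fin n := ⟨i, by simpa using hi⟩ with hv
    have hs₂ := hs₁.mono hagree₂ (by norm_num)
    have e8 : s₂ (8, 0, 0, 0) = r := by rw [hagree₂ 8 (by norm_num), hcount₁]
    have e9 : s₂ (9, 0, 0, 0) = (v : ℕ) := hcount₂
    refine Ensures.seq (Ensures.set_eq (q := G.leafUtil Player.follower v) ?_
      (fun h => hs₂.follower v ▸ h _) (Ensures.seq (Ensures.set_eq (q := n) ?_
      (fun _ => (bits_natCast_le n).trans (by omega)) (Ensures.seq ?_))))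
    · simp only [Expr.eval_read₁, Expr.eval_var, e9, Nat.floor_natCast]
      exact hs₂.follower v
    · simp [hs₂.nodes]
    set s₃ := Function.update (Function.update s₂ (13, 0, 0, 0) (G.leafUtil Player.follower v))
      (14, 0, 0, 0) (n : ℚ) with hs₃
    have hagree₃ : AgreeBelow 13 s₂ s₃ :=
      AgreeBelow.update (AgreeBelow.update (fun _ _ _ => rfl) le_rfl _ _) (by norm_num) _ _
    refine (lowSearch_ensures hLB hnL (hs₂.mono hagree₃ (by norm_num)) (r := r) (v := v)
      (by rw [hagree₃ 8 (by norm_num), e8]) (by rw [hagree₃ 9 (by norm_num), e9])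
      (by simp [hs₃]) (by simp [hs₃])).agree (k := 12)
      (by simp [lowSearch, Cmd.Writes, Cmd.set]; omega) |>.mono ?_
    rintro s₄ - ⟨hagree₄, hreply⟩
    have hagree : AgreeBelow 12 s₂ s₄ :=
      fun b hb p => (hagree₄ b hb p).trans (hagree₃ b (by omega) p)
    have f8 : s₄ (8, 0, 0, 0) = r := by rw [hagree 8 (by norm_num), e8]
    have f9 : s₄ (9, 0, 0, 0) = (v : ℕ) := by rw [hagree 9 (by norm_num), e9]
    refine Ensures.seq (Ensures.write_two (x := r + 1) (y := v) (q := s₄ (13, 0, 0, 0))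
      (by simp [Expr.eval_add, f8, Expr.eval_const]) (by simp [f9]) (by simp) (fun h => h _)
      (Ensures.write_two (x := r + 1) (y := v) (q := s₄ (14, 0, 0, 0))
        (by simp [Expr.eval_add, f8, Expr.eval_const]) (by simp [f9]) (by simp)
        (fun h => by simpa using h (14, 0, 0, 0)) ?_))
    set s₅ := Function.update (Function.update s₄ (10, r + 1, (v : ℕ), 0) (s₄ (13, 0, 0, 0)))
      (11, r + 1, (v : ℕ), 0) (s₄ (14, 0, 0, 0)) with hs₅
    have hcell : ∀ a r' (u : Fin n), a < 12 → ¬ (r' = r + 1 ∧ u = v) →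
        s₅ (a, r', u, 0) = s₂ (a, r', u, 0) := by
      intro a r' u ha hne
      have : ¬ (r' = r + 1 ∧ (u : ℕ) = v) := fun h => hne ⟨h.1, Fin.ext h.2⟩
      rw [hs₅, Function.update_of_ne, Function.update_of_ne, hagree a ha]
      · rintro h
        simp only [Prod.mk.injEq] at h
        exact this ⟨h.2.1, h.2.2.1⟩
      · rintro h
        simp only [Prod.mk.injEq] at h
        exact this ⟨h.2.1, h.2.2.1⟩
    have hrow : ∀ r' ≤ r, (fun w : Fin n => s₅ (10, r', w, 0)) = fun w : Fin n => s₂ (10, r', w, 0) :=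
      fun r' hr' => funext fun w => hcell 10 r' w (by norm_num) fun h => by omega
    refine ⟨fun r' hr' u => ?_, fun u hu => ?_⟩
    · have := hinv₂.1 r' hr' u
      unfold LowLevel at this ⊢
      rwa [hrow r' hr'.le, hcell 10 _ u (by norm_num) fun h => by omega,
        hcell 11 _ u (by norm_num) fun h => by omega]
    · rcases eq_or_ne u v with hue | hne
      · unfold LowLevel
        rw [hue, hrow r le_rfl]
        have h10 : s₅ (10, r + 1, (v : ℕ), 0) = s₄ (13, 0, 0, 0) := by
          simp [hs₅]
        have h11 : s₅ (11, r + 1, (v : ℕ), 0) = s₄ (14, 0, 0, 0) := by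
          simp [hs₅]
        rw [h10, h11]
        convert hreply using 2
        rw [hagree₃ 10 (by norm_num)]
      · have hlt : (u : ℕ) < i := by
          have : (u : ℕ) ≠ i := fun h => hne (Fin.ext h)
          omega
        have := hinv₂.2 u hlt
        unfold LowLevel at this ⊢
        rwa [hrow r le_rfl, hcell 10 _ u (by norm_num) fun h => hne h.2,
          hcell 11 _ u (by norm_num) fun h => hne h.2]
  · intro s' _ h r' hr' v
    rcases Nat.lt_succ_iff_lt_or_eq.1 hr' with h' | rfl
    · exact h.1 r' h' v
    · exact h.2 v (by simp)

end Game

/-! ### The table of the leader's utilities: program and correctness -/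

namespace RAM

/-- The target of the pair that is being improved. -/
def goalTarget : Expr := read₁ 4 (var 17)

/-- The target at the first child of the candidate. -/
def fstTarget : Expr := read₁ 4 (var 25)

/-- The target at the second child of the candidate. -/
def sndTarget : Expr := read₁ 4 (var 27)

/-- The weight of the first child of the candidate. -/
def candWeight : Expr := .div (.sub sndTarget goalTarget) (.sub sndTarget fstTarget)

/-- The value of the candidate for the leader. -/
def candValue : Expr :=
  .add (.mul candWeight (.read 19 (var 15) (var 24) (var 25)))
    (.mul (.sub (.const 1) candWeight) (.read 19 (var 15) (var 26) (var 27)))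

/-- The candidate is admissible and improves on the best one so far. -/
def candCond : Expr :=
  conj (less (var 17) (var 0)) (conj (read₂ 1 (var 16) (var 24)) (conj (read₂ 1 (var 16) (var 26))
    (conj (.read 18 (var 15) (var 24) (var 25)) (conj (.read 18 (var 15) (var 26) (var 27))
      (conj (.le fstTarget goalTarget) (conj (.le goalTarget sndTarget)
        (conj (.le (read₂ 10 (var 0) (var 16)) goalTarget)
          (conj (disj (equal fstTarget sndTarget)
            (conj (equal (read₁ 2 (var 16)) (.const 1)) (neg (equal (var 24) (var 26)))))
              (disj (neg (var 28)) (less (var 29) candValue))))))))))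

/-- Replace the best candidate so far if the current one is better. -/
def relax : Cmd :=
  .when candCond (.seq (.set 29 candValue) (.seq (.set 28 (.const 1)) (.seq (.set 30 (var 24))
    (.seq (.set 31 (var 25)) (.seq (.set 32 (var 26)) (.set 33 (var 27)))))))

/-- The search for the best candidate. -/
def search : Cmd := .for_ 24 0 (.for_ 25 1 (.for_ 26 0 (.for_ 27 1 relax)))

/-- The node is a leaf that offers the target to the follower. -/
def leafCond : Expr :=
  conj (less (var 17) (var 0)) (conj (equal (read₂ 11 (var 0) (var 16)) (var 0))
    (equal goalTarget (read₁ 4 (var 16))))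

/-- The entry before the search. -/
def start : Cmd :=
  .seq (.set 28 (.const 0)) (.seq (.set 29 (read₁ 3 (var 16)))
    (.seq (.set 30 (read₂ 11 (var 0) (var 16))) (.seq (.set 31 (var 0))
      (.seq (.set 32 (read₂ 11 (var 0) (var 16))) (.seq (.set 33 (var 0))
        (.when leafCond (.set 28 (.const 1))))))))

/-- Write the variable `e` to the next level of the array `a`. -/
def store (a e : ℕ) : Cmd := .write a (.add (var 15) (.const 1)) (var 16) (var 17) (var e)

/-- Write the best entry to the tables. -/
def storeBest : Cmd :=
  .seq (store 18 28) (.seq (store 19 29) (.seq (store 20 30) (.seq (store 21 31)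
    (.seq (store 22 32) (store 23 33)))))

/-- The computation of one entry of the tables. -/
def entry : Cmd := .seq start (.seq search storeBest)

/-- The computation of the tables. -/
def tableCmd : Cmd := .for_ 15 0 (.for_ 16 0 (.for_ 17 1 entry))

namespace Cmd

/-- A loop that establishes `Dom c` for more and more `c`. -/
theorem Ensures.forall_loop_on {C : Type*} {L B : ℕ} {c : Cmd} {s : Mem} {a m n : ℕ}
    {Inv : Mem → Prop} {Dom : C → Mem → Prop} (S : ℕ → C → Prop) (K : ℕ → Prop)
    (hLB : L + 2 ≤ B) (hn : s (0, 0, 0, 0) = n) (hm : n + m ≤ L + 1) (ha : ¬ c.Writes a)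
    (h0 : K 0) (hK : ∀ b, K b → b ≠ a ∧ ¬ c.Writes b)
    (hInv : ∀ s q, Inv s → Inv (Function.update s (a, 0, 0, 0) q))
    (hDom : ∀ x s q, Dom x s → Dom x (Function.update s (a, 0, 0, 0) q)) (init : Inv s)
    (step : ∀ i < n + m, ∀ s', (∀ b, K b → ∀ p, s' (b, p) = s (b, p)) →
      s' (a, 0, 0, 0) = (i : ℚ) → Inv s' →
      Ensures L B c s' fun s'' => Inv s'' ∧ (∀ x, Dom x s' → Dom x s'') ∧ ∀ x, S i x → Dom x s'') :
    Ensures L B (.for_ a m c) s fun s' => Inv s' ∧ (∀ x, Dom x s → Dom x s') ∧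
      ∀ i < n + m, ∀ x, S i x → Dom x s' := by
  refine Ensures.for_ (n := n) (fun k s' => Inv s' ∧ (∀ x, Dom x s → Dom x s') ∧
      ∀ i < k, ∀ x, S i x → Dom x s') hLB hn hm ha (hK 0 h0).2 (hK 0 h0).1.symm ?_
      ⟨init, fun _ h => h, by simp⟩ ?_ (fun _ _ h => h)
  · rintro i s' q ⟨h₁, h₂, h₃⟩
    exact ⟨hInv _ _ h₁, fun x hx => hDom _ _ _ (h₂ x hx), fun k hk x hx => hDom _ _ _ (h₃ k hk x hx)⟩
  · rintro i hi s' hagree hcount ⟨h₁, h₂, h₃⟩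
    refine (step i hi s' (fun b hb => hagree b (hK b hb).1 (hK b hb).2) hcount h₁).mono ?_
    rintro s'' - ⟨g₁, g₂, g₃⟩
    refine ⟨g₁, fun x hx => g₂ x (h₂ x hx), fun k hk x hx => ?_⟩
    rcases Nat.lt_succ_iff_lt_or_eq.1 hk with h | rfl
    · exact g₂ x (h₃ k h x hx)
    · exact g₃ x hx

theorem Ensures.forall_loop {C : Type*} {L B : ℕ} {c : Cmd} {s : Mem} {a m n : ℕ}
    {Inv : Mem → Prop} {Dom : C → Mem → Prop} (S : ℕ → C → Prop) (hLB : L + 2 ≤ B)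
    (hn : s (0, 0, 0, 0) = n) (hm : n + m ≤ L + 1) (ha : a ≠ 0) (hc : ∀ b ≤ a, ¬ c.Writes b)
    (hInv : ∀ s q, Inv s → Inv (Function.update s (a, 0, 0, 0) q))
    (hDom : ∀ x s q, Dom x s → Dom x (Function.update s (a, 0, 0, 0) q)) (init : Inv s)
    (step : ∀ i < n + m, ∀ s', AgreeBelow a s s' → s' (a, 0, 0, 0) = (i : ℚ) → Inv s' →
      Ensures L B c s' fun s'' => Inv s'' ∧ (∀ x, Dom x s' → Dom x s'') ∧ ∀ x, S i x → Dom x s'') :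
    Ensures L B (.for_ a m c) s fun s' => Inv s' ∧ (∀ x, Dom x s → Dom x s') ∧
      ∀ i < n + m, ∀ x, S i x → Dom x s' :=
  Ensures.forall_loop_on S (· < a) hLB hn hm (hc a le_rfl) (Nat.pos_of_ne_zero ha)
    (fun b hb => ⟨hb.ne, hc b hb.le⟩) hInv hDom init step

end Cmd

end RAM

namespace Game

open RAM Cmd

variable {n : ℕ} {G : Game (Fin n) ℚ} {s : Mem}

/-- The table of the leader's utilities at level `r`. -/
def tab (n : ℕ) (s : Mem) (r : ℕ) (v : Fin n) (j : Fin (n + 1)) : Option ℚ :=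
  if s (18, r, v, j) = 0 then none else some (s (19, r, v, j))

theorem tab_eq_some {r : ℕ} {v : Fin n} {j : Fin (n + 1)} {y : ℚ} :
    tab n s r v j = some y ↔ s (18, r, v, j) ≠ 0 ∧ s (19, r, v, j) = y := by
  unfold tab
  split_ifs with h <;> simp [h]

/-- The numbers `q 0, …, q 5` are an entry for the target `j` at `v`: the flag that tells if the
target can be attained, the utility of the leader, and the two moves. -/
def IsEntry (G : Game (Fin n) ℚ) (low pm : Fin n → ℚ) (T : Fin n → Fin (n + 1) → Option ℚ) (r : ℕ)
    (v : Fin n) (j : Fin (n + 1)) (q : ℕ → ℚ) : Prop :=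
  IsFrac (G.levelDen (r + 1)) (2 ^ G.size) (q 1) ∧
  ((q 2 = pm v ∧ q 3 = n ∧ q 4 = pm v ∧ q 5 = n ∧
      (q 0 = 0 ∧ (G.children v = ∅ → j ≠ Fin.last n →
          G.target j ≠ G.leafUtil Player.follower v) ∨
        q 0 = 1 ∧ G.children v = ∅ ∧ j ≠ Fin.last n ∧ G.target j = G.leafUtil Player.follower v ∧
          q 1 = G.leafUtil Player.leader v)) ∨
    q 0 = 1 ∧ j ≠ Fin.last n ∧ ∃ (w₁ : Fin n) (j₁ : Fin (n + 1)) (w₂ : Fin n) (j₂ : Fin (n + 1)),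
      q 2 = (w₁ : ℕ) ∧ q 3 = (j₁ : ℕ) ∧ q 4 = (w₂ : ℕ) ∧ q 5 = (j₂ : ℕ) ∧
      Admissible G low G.target T v j w₁ j₁ w₂ j₂ (q 1))

/-- The entry `q` is at least as good as the candidate `c`. -/
def Dominates (G : Game (Fin n) ℚ) (low : Fin n → ℚ) (T : Fin n → Fin (n + 1) → Option ℚ)
    (v : Fin n) (j : Fin (n + 1)) (q : ℕ → ℚ) (c : Fin n × Fin (n + 1) × Fin n × Fin (n + 1)) :
    Prop :=
  j ≠ Fin.last n → ∀ y, Admissible G low G.target T v j c.1 c.2.1 c.2.2.1 c.2.2.2 y →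
    q 0 ≠ 0 ∧ y ≤ q 1

/-- The entry in the variables `28`, …, `33`. -/
def best (s : Mem) (i : ℕ) : ℚ := s (28 + i, 0, 0, 0)

theorem best_update {a : ℕ} (ha : a < 28) (s : Mem) (q : ℚ) :
    best (Function.update s (a, 0, 0, 0) q) = best s := by
  funext i
  unfold best
  rw [Function.update_of_ne]
  intro h
  have : 28 + i = a := congrArg Prod.fst h
  omega

/-- The memory during the computation of the entry for the target `j` at `v` in round `r`. -/
structure Context (G : Game (Fin n) ℚ) (low pm : Fin n → ℚ) (T : Fin n → Fin (n + 1) → Option ℚ)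
    (r : ℕ) (v : Fin n) (j : Fin (n + 1)) (s : Mem) : Prop where
  loaded : G.Loaded s
  round : s (15, 0, 0, 0) = r
  node : s (16, 0, 0, 0) = (v : ℕ)
  goal : s (17, 0, 0, 0) = (j : ℕ)
  low_eq : ∀ w : Fin n, s (10, n, w, 0) = low w
  pm_eq : ∀ w : Fin n, s (11, n, w, 0) = pm w
  tab_eq : tab n s r = T

variable {low pm : Fin n → ℚ} {T : Fin n → Fin (n + 1) → Option ℚ} {r : ℕ} {v : Fin n}
  {j : Fin (n + 1)}

theorem Context.mono {k : ℕ} {s' : Mem} (h : Context G low pm T r v j s) (h' : AgreeBelow k s s')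
    (hk : 24 ≤ k) : Context G low pm T r v j s' where
  loaded := h.loaded.mono h' (by omega)
  round := by rw [h' 15 (by omega), h.round]
  node := by rw [h' 16 (by omega), h.node]
  goal := by rw [h' 17 (by omega), h.goal]
  low_eq w := by rw [h' 10 (by omega), h.low_eq]
  pm_eq w := by rw [h' 11 (by omega), h.pm_eq]
  tab_eq := by
    rw [← h.tab_eq]
    funext w i
    unfold tab
    rw [h' 18 (by omega), h' 19 (by omega)]

theorem size_add_two_le : G.size + 2 ≤ bitBound G.size := by
  unfold bitBound
  omega

theorem bits_fin_le {m : ℕ} (hm : m ≤ n + 1) (i : Fin m) :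
    bits ((i : ℕ) : ℚ) ≤ bitBound G.size := by
  have h₁ := bits_natCast_le i
  have h₂ := i.2
  have h₃ := G.le_size
  have h₄ := G.size_add_two_le
  omega

/-- The value of an attained entry only increases, so candidates dominated before stay dominated,
and the current candidate is dominated afterwards whether or not it replaces the entry. -/
theorem relax_ensures (h : Context G low pm T r v j s)
    (hT : ∀ w i y, T w i = some y → IsFrac (G.levelDen r) (2 ^ G.size) y) (hr : r < n)
    {w₁ w₂ : Fin n} {j₁ j₂ : Fin (n + 1)} (h24 : s (24, 0, 0, 0) = (w₁ : ℕ))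
    (h25 : s (25, 0, 0, 0) = (j₁ : ℕ)) (h26 : s (26, 0, 0, 0) = (w₂ : ℕ))
    (h27 : s (27, 0, 0, 0) = (j₂ : ℕ)) (hq : G.IsEntry low pm T r v j (best s)) :
    Ensures G.size (bitBound G.size) relax s fun s' =>
      G.IsEntry low pm T r v j (best s') ∧
      (∀ c, G.Dominates low T v j (best s) c → G.Dominates low T v j (best s') c) ∧
      ∀ c, c = (w₁, j₁, w₂, j₂) → G.Dominates low T v j (best s') c := by
  set y := weight G.target j j₁ j₂ * s (19, r, w₁, j₁) +
    (1 - weight G.target j j₁ j₂) * s (19, r, w₂, j₂) with hy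
  have t₀ : goalTarget.eval s = G.target j := by
    simp only [goalTarget, Expr.eval_read₁, Expr.eval_var, h.goal, Nat.floor_natCast]
    exact h.loaded.target j
  have t₁ : fstTarget.eval s = G.target j₁ := by
    simp only [fstTarget, Expr.eval_read₁, Expr.eval_var, h25, Nat.floor_natCast]
    exact h.loaded.target j₁
  have t₂ : sndTarget.eval s = G.target j₂ := by
    simp only [sndTarget, Expr.eval_read₁, Expr.eval_var, h27, Nat.floor_natCast]
    exact h.loaded.target j₂
  have hval : candValue.eval s = y := by
    simp only [candValue, candWeight, Expr.eval_add, Expr.eval_mul, Expr.eval_sub, Expr.eval_div,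
      t₀, t₁, t₂, Expr.eval_const, Expr.eval_read, Expr.eval_var, h.round, h24, h25, h26, h27,
      Nat.floor_natCast]
    rfl
  have hadm : ∀ z, Admissible G low G.target T v j w₁ j₁ w₂ j₂ z ↔
      (w₁ ∈ G.children v ∧ w₂ ∈ G.children v ∧ s (18, r, w₁, j₁) ≠ 0 ∧ s (18, r, w₂, j₂) ≠ 0 ∧
        G.target j₁ ≤ G.target j ∧ G.target j ≤ G.target j₂ ∧ low v ≤ G.target j ∧
        (G.target j₁ = G.target j₂ ∨ G.owner v = Player.leader ∧ w₁ ≠ w₂)) ∧ z = y := by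
    intro z
    constructor
    · rintro ⟨a₁, a₂, a₃, a₄, a₅, a₆, y₁, y₂, b₁, b₂, rfl⟩
      rw [← h.tab_eq, tab_eq_some] at b₁ b₂
      obtain ⟨b₁, rfl⟩ := b₁
      obtain ⟨b₂, rfl⟩ := b₂
      exact ⟨⟨a₁, a₂, b₁, b₂, a₃, a₄, a₅, a₆⟩, rfl⟩
    · rintro ⟨⟨a₁, a₂, b₁, b₂, a₃, a₄, a₅, a₆⟩, rfl⟩
      refine ⟨a₁, a₂, a₃, a₄, a₅, a₆, _, _, ?_, ?_, rfl⟩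
      · rw [← h.tab_eq, tab_eq_some]
        exact ⟨b₁, rfl⟩
      · rw [← h.tab_eq, tab_eq_some]
        exact ⟨b₂, rfl⟩
  have hlast : ((j : ℕ) : ℚ) < n ↔ j ≠ Fin.last n := by
    rw [Nat.cast_lt, ← Fin.lt_last_iff_ne_last]
    exact Iff.rfl
  have hcond : candCond.eval s ≠ 0 ↔ j ≠ Fin.last n ∧
      Admissible G low G.target T v j w₁ j₁ w₂ j₂ y ∧ (best s 0 = 0 ∨ best s 1 < y) := by
    have c₁ := h.loaded.child v w₁
    have c₂ := h.loaded.child v w₂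
    have c₃ : ((w₁ : ℕ) : ℚ) = (w₂ : ℕ) ↔ w₁ = w₂ := by rw [Nat.cast_inj, Fin.val_inj]
    have c₄ : best s 0 = s (28, 0, 0, 0) := rfl
    have c₅ : best s 1 = s (29, 0, 0, 0) := rfl
    rw [hadm, ← c₁, ← c₂, ← hlast, c₄, c₅]
    simp only [candCond, Expr.eval_conj_ne_zero, Expr.eval_disj_ne_zero, Expr.eval_le_ne_zero,
      Expr.eval_less_ne_zero, Expr.eval_equal_ne_zero, Expr.eval_neg_ne_zero, hval, t₀, t₁, t₂,
      Expr.eval_read₁, Expr.eval_read₂, Expr.eval_read, Expr.eval_var, Expr.eval_const, h.round,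
      h.node, h.goal, h24, h25, h26, h27, h.loaded.nodes, Nat.floor_natCast, h.low_eq,
      h.loaded.owner, c₃, ne_eq, and_true, not_not, and_assoc]
  refine Ensures.when (fun hne => ?_) (fun hz => ?_)
  · obtain ⟨hj, hA, hbetter⟩ := hcond.1 hne
    have hfrac : IsFrac (G.levelDen (r + 1)) (2 ^ G.size) y := by
      obtain ⟨y₁, y₂, b₁, b₂, b₃⟩ := hA.value
      rw [b₃]
      exact G.isFrac_combination hA.le₁ hA.le₂ (hT _ _ _ b₁) (hT _ _ _ b₂)
    have hn1 : bits 1 ≤ bitBound G.size := bits_one_le.trans (by have := G.size_add_two_le; omega)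
    refine Ensures.seq (Ensures.set_eq hval (fun _ => G.bits_le_bitBound (r := r + 1) hr hfrac)
      (Ensures.seq (Ensures.set_eq (q := 1) rfl (fun _ => hn1)
      (Ensures.seq (Ensures.set_eq (q := (w₁ : ℕ)) (by simp [h24]) (fun _ => bits_fin_le (by omega) w₁)
      (Ensures.seq (Ensures.set_eq (q := (j₁ : ℕ)) (by simp [h25]) (fun _ => bits_fin_le le_rfl j₁)
      (Ensures.seq (Ensures.set_eq (q := (w₂ : ℕ)) (by simp [h26]) (fun _ => bits_fin_le (by omega) w₂)
      (Ensures.set_eq (q := (j₂ : ℕ)) (by simp [h27]) (fun _ => bits_fin_le le_rfl j₂) ?_))))))))))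
    set s' : Mem := Function.update (β := fun _ => ℚ) _ ((33 : ℕ), (0 : ℕ), (0 : ℕ), (0 : ℕ)) ((j₂ : ℕ) : ℚ) with hs'
    have q₀ : best s' 0 = 1 := by simp [best, hs']
    have q₁ : best s' 1 = y := by simp [best, hs']
    have q₂ : best s' 2 = (w₁ : ℕ) := by simp [best, hs']
    have q₃ : best s' 3 = (j₁ : ℕ) := by simp [best, hs']
    have q₄ : best s' 4 = (w₂ : ℕ) := by simp [best, hs']
    have q₅ : best s' 5 = (j₂ : ℕ) := by simp [best, hs']
    refine ⟨⟨by rwa [q₁], .inr ⟨q₀, hj, w₁, j₁, w₂, j₂, q₂, q₃, q₄, q₅, by rwa [q₁]⟩⟩,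
      fun c hc hj z hz => ?_, ?_⟩
    · obtain ⟨d₁, d₂⟩ := hc hj z hz
      rw [q₀, q₁]
      refine ⟨one_ne_zero, d₂.trans ?_⟩
      rcases hbetter with hb | hb
      · exact absurd hb d₁
      · exact hb.le
    · rintro c rfl hj z hz
      rw [q₀, q₁, ((hadm z).1 hz).2]
      exact ⟨one_ne_zero, le_rfl⟩
  · refine ⟨hq, fun c hc => hc, ?_⟩
    rintro c rfl hj z hz'
    obtain rfl := ((hadm z).1 hz').2
    by_contra hcon
    refine hcond.2 ⟨hj, hz', ?_⟩ hz
    by_contra! h'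
    exact hcon ⟨h'.1, h'.2⟩

/-- Each of the four nested loops fixes one more coordinate of the candidates that it makes
dominated. -/
theorem search_ensures (h : Context G low pm T r v j s)
    (hT : ∀ w i y, T w i = some y → IsFrac (G.levelDen r) (2 ^ G.size) y) (hr : r < n)
    (hq : G.IsEntry low pm T r v j (best s)) :
    Ensures G.size (bitBound G.size) search s fun s' =>
      G.IsEntry low pm T r v j (best s') ∧ ∀ c, G.Dominates low T v j (best s') c := by
  have hn := G.le_size
  have hupd : ∀ (a : ℕ), a < 28 → ∀ (s : Mem) (q : ℚ), G.IsEntry low pm T r v j (best s) →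
      G.IsEntry low pm T r v j (best (Function.update s (a, 0, 0, 0) q)) := fun a ha s q h => by
    rwa [best_update ha]
  have hupd' : ∀ (a : ℕ), a < 28 → ∀ c (s : Mem) (q : ℚ), G.Dominates low T v j (best s) c →
      G.Dominates low T v j (best (Function.update s (a, 0, 0, 0) q)) c := fun a ha c s q h => by
    rwa [best_update ha]
  refine (Ensures.forall_loop (n := n) (Inv := fun s => G.IsEntry low pm T r v j (best s))
    (Dom := fun c s => G.Dominates low T v j (best s) c) (fun i c => (c.1 : ℕ) = i)
    G.size_add_two_le h.loaded.nodes (by omega) (by norm_num)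
    (by simp [relax, Cmd.Writes, Cmd.set]; omega) (hupd 24 (by norm_num)) (hupd' 24 (by norm_num))
    hq ?_).mono fun s' _ hs' => ⟨hs'.1, fun c => hs'.2.2 c.1 (by simp) c rfl⟩
  intro i₁ hi₁ s₁ hagree₁ hcount₁ hq₁
  have h₁ := h.mono hagree₁ (by norm_num)
  refine (Ensures.forall_loop (n := n) (Inv := fun s => G.IsEntry low pm T r v j (best s))
    (Dom := fun c s => G.Dominates low T v j (best s) c)
    (fun i c => (c.1 : ℕ) = i₁ ∧ (c.2.1 : ℕ) = i)
    G.size_add_two_le h₁.loaded.nodes (by omega) (by norm_num)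
    (by simp [relax, Cmd.Writes, Cmd.set]; omega) (hupd 25 (by norm_num)) (hupd' 25 (by norm_num))
    hq₁ ?_).mono fun s' _ hs' => ⟨hs'.1, hs'.2.1, fun c hc => hs'.2.2 c.2.1 c.2.1.2 c ⟨hc, rfl⟩⟩
  intro i₂ hi₂ s₂ hagree₂ hcount₂ hq₂
  have h₂ := h₁.mono hagree₂ (by norm_num)
  refine (Ensures.forall_loop (n := n) (Inv := fun s => G.IsEntry low pm T r v j (best s))
    (Dom := fun c s => G.Dominates low T v j (best s) c)
    (fun i c => ((c.1 : ℕ) = i₁ ∧ (c.2.1 : ℕ) = i₂) ∧ (c.2.2.1 : ℕ) = i)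
    G.size_add_two_le h₂.loaded.nodes (by omega) (by norm_num)
    (by simp [relax, Cmd.Writes, Cmd.set]; omega) (hupd 26 (by norm_num)) (hupd' 26 (by norm_num))
    hq₂ ?_).mono fun s' _ hs' => ⟨hs'.1, hs'.2.1, fun c hc =>
      hs'.2.2 c.2.2.1 (by simp) c ⟨hc, rfl⟩⟩
  intro i₃ hi₃ s₃ hagree₃ hcount₃ hq₃
  have h₃ := h₂.mono hagree₃ (by norm_num)
  refine (Ensures.forall_loop (n := n) (Inv := fun s => G.IsEntry low pm T r v j (best s))
    (Dom := fun c s => G.Dominates low T v j (best s) c)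
    (fun i c => (((c.1 : ℕ) = i₁ ∧ (c.2.1 : ℕ) = i₂) ∧ (c.2.2.1 : ℕ) = i₃) ∧ (c.2.2.2 : ℕ) = i)
    G.size_add_two_le h₃.loaded.nodes (by omega) (by norm_num)
    (by simp [relax, Cmd.Writes, Cmd.set]; omega) (hupd 27 (by norm_num)) (hupd' 27 (by norm_num))
    hq₃ ?_).mono fun s' _ hs' => ⟨hs'.1, hs'.2.1, fun c hc =>
      hs'.2.2 c.2.2.2 c.2.2.2.2 c ⟨hc, rfl⟩⟩
  intro i₄ hi₄ s₄ hagree₄ hcount₄ hq₄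
  have h₄ := h₃.mono hagree₄ (by norm_num)
  refine (relax_ensures h₄ hT hr (w₁ := ⟨i₁, hi₁⟩) (j₁ := ⟨i₂, hi₂⟩) (w₂ := ⟨i₃, hi₃⟩)
    (j₂ := ⟨i₄, hi₄⟩) ?_ ?_ ?_ hcount₄ hq₄).mono fun s' _ hs' =>
      ⟨hs'.1, hs'.2.1, fun c hc => hs'.2.2 c ?_⟩
  · rw [hagree₄ 24 (by norm_num), hagree₃ 24 (by norm_num), hagree₂ 24 (by norm_num), hcount₁]
  · rw [hagree₄ 25 (by norm_num), hagree₃ 25 (by norm_num), hcount₂]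
  · rw [hagree₄ 26 (by norm_num), hcount₃]
  · obtain ⟨⟨⟨c₁, c₂⟩, c₃⟩, c₄⟩ := hc
    exact Prod.ext (Fin.ext c₁) (Prod.ext (Fin.ext c₂) (Prod.ext (Fin.ext c₃) (Fin.ext c₄)))

end Game

namespace Game

open RAM Cmd

variable {n : ℕ} {G : Game (Fin n) ℚ} {s : Mem} {low pm : Fin n → ℚ}
  {T : Fin n → Fin (n + 1) → Option ℚ} {r : ℕ} {v : Fin n} {j : Fin (n + 1)}

theorem IsEntry.congr {q q' : ℕ → ℚ} (hq : ∀ i < 6, q i = q' i) (h : G.IsEntry low pm T r v j q) :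
    G.IsEntry low pm T r v j q' := by
  unfold IsEntry at h ⊢
  rwa [hq 0 (by norm_num), hq 1 (by norm_num), hq 2 (by norm_num), hq 3 (by norm_num),
    hq 4 (by norm_num), hq 5 (by norm_num)] at h

theorem Dominates.congr {q q' : ℕ → ℚ} (hq : ∀ i < 6, q i = q' i) {c}
    (h : G.Dominates low T v j q c) : G.Dominates low T v j q' c := by
  unfold Dominates at h ⊢
  rwa [hq 0 (by norm_num), hq 1 (by norm_num)] at h

/-- The default is the punishing move: the child that attains the security level, with memory state
`n`. At a leaf `pm` has the value `n`, which is how the program recognizes leaves. -/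
theorem start_ensures (h : Context G low pm T r v j s) (hpm : ∀ w, pm w = n ↔ G.children w = ∅) :
    Ensures G.size (bitBound G.size) start s fun s' => G.IsEntry low pm T r v j (best s') := by
  have hn := G.le_size
  have hB := G.size_add_two_le
  have hbn : bits (n : ℚ) ≤ bitBound G.size := (bits_natCast_le n).trans (by omega)
  have h11 : ∀ s', AgreeBelow 28 s s' → (read₂ 11 (var 0) (var 16)).eval s' = pm v := by
    intro s' hs'
    have := h.mono hs' (by norm_num)
    simp only [Expr.eval_read₂, Expr.eval_var, this.loaded.nodes, this.node, Nat.floor_natCast,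
      this.pm_eq]
  have hbpm : BitBound (bitBound G.size) s → bits (pm v) ≤ bitBound G.size :=
    fun hb => h.pm_eq v ▸ hb _
  have a₀ : AgreeBelow 28 s s := fun _ _ _ => rfl
  intro hbs
  refine (Ensures.seq (Ensures.set_eq (q := 0) rfl (fun _ => bits_zero_le.trans (by omega))
    (Ensures.seq (Ensures.set_eq (q := G.leafUtil Player.leader v) ?_
      (fun _ => (G.bits_leafUtil_le _ _).trans (by omega))
    (Ensures.seq (Ensures.set_eq (q := pm v) (h11 _ ?_) (fun _ => hbpm hbs)
    (Ensures.seq (Ensures.set_eq (q := n) ?_ (fun _ => hbn)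
    (Ensures.seq (Ensures.set_eq (q := pm v) (h11 _ ?_) (fun _ => hbpm hbs)
    (Ensures.seq (Ensures.set_eq (q := n) ?_ (fun _ => hbn) ?_)))))))))))) hbs
  · simp [Expr.eval_read₁, h.node, h.loaded.leader]
  · exact (a₀.update le_rfl _ _).update (by norm_num) _ _
  · simp [h.loaded.nodes]
  · exact (((a₀.update le_rfl _ _).update (by norm_num) _ _).update (by norm_num) _ _).update
      (by norm_num) _ _
  · simp [h.loaded.nodes]
  set s' : Mem := Function.update (β := fun _ => ℚ) _ ((33 : ℕ), (0 : ℕ), (0 : ℕ), (0 : ℕ)) (n : ℚ)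
    with hs'
  have hagree : AgreeBelow 28 s s' :=
    (((((a₀.update le_rfl _ _).update (by norm_num) _ _).update (by norm_num) _ _).update
      (by norm_num) _ _).update (by norm_num) _ _).update (by norm_num) _ _
  have h' := h.mono hagree (by norm_num)
  have q₀ : best s' 0 = 0 := by simp [best, hs']
  have q₁ : best s' 1 = G.leafUtil Player.leader v := by simp [best, hs']
  have q₂ : best s' 2 = pm v := by simp [best, hs']
  have q₃ : best s' 3 = n := by simp [best, hs']
  have q₄ : best s' 4 = pm v := by simp [best, hs']
  have q₅ : best s' 5 = n := by simp [best, hs']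
  have hlast : ((j : ℕ) : ℚ) < n ↔ j ≠ Fin.last n := by
    rw [Nat.cast_lt, ← Fin.lt_last_iff_ne_last]
    exact Iff.rfl
  have hcond : leafCond.eval s' ≠ 0 ↔ j ≠ Fin.last n ∧ G.children v = ∅ ∧
      G.target j = G.leafUtil Player.follower v := by
    have t₀ : goalTarget.eval s' = G.target j := by
      simp only [goalTarget, Expr.eval_read₁, Expr.eval_var, h'.goal, Nat.floor_natCast]
      exact h'.loaded.target j
    rw [← hlast, ← hpm v]
    simp only [leafCond, Expr.eval_conj_ne_zero, Expr.eval_less_ne_zero,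
      Expr.eval_equal_ne_zero, t₀, h11 s' hagree, Expr.eval_read₁, Expr.eval_var, h'.goal,
      h'.loaded.nodes, h'.node, Nat.floor_natCast, h'.loaded.follower]
  refine Ensures.when (fun hne => ?_) (fun hz => ?_)
  · obtain ⟨c₁, c₂, c₃⟩ := hcond.1 hne
    refine Ensures.set_eq (q := 1) rfl (fun _ => bits_one_le.trans (by omega)) ?_
    have hb : ∀ i, best (Function.update s' (28, 0, 0, 0) 1) (i + 1) = best s' (i + 1) := by
      intro i
      unfold best
      rw [Function.update_of_ne]
      simp
    refine ⟨?_, .inl ⟨?_, ?_, ?_, ?_, .inr ⟨by simp [best], c₂, c₁, c₃, ?_⟩⟩⟩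
    · rw [hb 0, q₁]
      exact G.isFrac_leafUtil _ _
    · rw [hb 1, q₂]
    · rw [hb 2, q₃]
    · rw [hb 3, q₄]
    · rw [hb 4, q₅]
    · rw [hb 0, q₁]
  · refine ⟨q₁ ▸ G.isFrac_leafUtil _ _, .inl ⟨q₂, q₃, q₄, q₅, .inl ⟨q₀, fun c₁ c₂ c₃ => ?_⟩⟩⟩
    exact hcond.2 ⟨c₂, c₁, c₃⟩ hz

/-- The entry of the tables at level `r`. -/
def level (s : Mem) (r : ℕ) (v : Fin n) (j : Fin (n + 1)) (i : ℕ) : ℚ := s (18 + i, r, v, j)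

theorem store_ensures {L B : ℕ} (h : Context G low pm T r v j s) {a e : ℕ} {q : ℚ}
    {Q : Mem → Prop} (he : s (e, 0, 0, 0) = q)
    (hQ : Q (Function.update s (a, r + 1, (v : ℕ), (j : ℕ)) q)) : Ensures L B (store a e) s Q := by
  refine Ensures.write_three (x := r + 1) (y := v) (z := j) (q := q) ?_ ?_ ?_ (by simp [he])
    (fun hb => he ▸ hb _) hQ
  · simp [Expr.eval_add, h.round, Expr.eval_const]
  · simp [h.node]
  · simp [h.goal]

theorem Context.update_level (h : Context G low pm T r v j s) {a : ℕ} (ha : 18 ≤ a) (q : ℚ) :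
    Context G low pm T r v j (Function.update s (a, r + 1, (v : ℕ), (j : ℕ)) q) := by
  have key : ∀ b p, p.1 ≠ r + 1 ∨ b < 18 →
      Function.update s (a, r + 1, (v : ℕ), (j : ℕ)) q (b, p) = s (b, p) := by
    intro b p hp
    rw [Function.update_of_ne]
    intro he
    simp only [Prod.mk.injEq] at he
    rcases hp with hp | hp
    · exact hp (by rw [he.2])
    · omega
  refine ⟨h.loaded.mono (k := 5) (fun b hb p => key b p (.inr (by omega))) le_rfl, ?_, ?_, ?_, ?_,
    ?_, ?_⟩
  · rw [key _ _ (.inr (by norm_num)), h.round]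
  · rw [key _ _ (.inr (by norm_num)), h.node]
  · rw [key _ _ (.inr (by norm_num)), h.goal]
  · intro w
    rw [key _ _ (.inr (by norm_num)), h.low_eq]
  · intro w
    rw [key _ _ (.inr (by norm_num)), h.pm_eq]
  · rw [← h.tab_eq]
    funext w i
    unfold tab
    rw [key _ _ (.inl (by simp)), key _ _ (.inl (by simp))]

theorem storeBest_ensures {L B : ℕ} (h : Context G low pm T r v j s) :
    Ensures L B storeBest s fun s' => (∀ i < 6, level s' (r + 1) v j i = best s i) ∧
      ∀ a < 24, ∀ p, p ≠ (r + 1, (v : ℕ), (j : ℕ)) → s' (a, p) = s (a, p) := by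
  have h₁ := h.update_level le_rfl (best s 0)
  have h₂ := h₁.update_level (a := 19) (by norm_num) (best s 1)
  have h₃ := h₂.update_level (a := 20) (by norm_num) (best s 2)
  have h₄ := h₃.update_level (a := 21) (by norm_num) (best s 3)
  have h₅ := h₄.update_level (a := 22) (by norm_num) (best s 4)
  refine Ensures.seq (store_ensures h (q := best s 0) rfl
    (Ensures.seq (store_ensures h₁ (q := best s 1) (by simp [best])
    (Ensures.seq (store_ensures h₂ (q := best s 2) (by simp [best])
    (Ensures.seq (store_ensures h₃ (q := best s 3) (by simp [best])
    (Ensures.seq (store_ensures h₄ (q := best s 4) (by simp [best])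
    (store_ensures h₅ (q := best s 5) (by simp [best]) ⟨?_, ?_⟩))))))))))
  · intro i hi
    interval_cases i <;> simp [level]
  · intro a _ p hp
    simp [hp]

theorem entry_ensures (h : Context G low pm T r v j s)
    (hT : ∀ w i y, T w i = some y → IsFrac (G.levelDen r) (2 ^ G.size) y) (hr : r < n)
    (hpm : ∀ w, pm w = n ↔ G.children w = ∅) :
    Ensures G.size (bitBound G.size) entry s fun s' =>
      (G.IsEntry low pm T r v j (level s' (r + 1) v j) ∧
        ∀ c, G.Dominates low T v j (level s' (r + 1) v j) c) ∧
      ∀ a < 24, ∀ p, p ≠ (r + 1, (v : ℕ), (j : ℕ)) → s' (a, p) = s (a, p) := by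
  refine Ensures.seq ((start_ensures h hpm).agree (k := 24)
    (by simp [start, Cmd.Writes, Cmd.set]; omega) |>.mono ?_)
  rintro s₁ - ⟨hagree₁, hq₁⟩
  have h₁ := h.mono hagree₁ le_rfl
  refine Ensures.seq ((search_ensures h₁ hT hr hq₁).agree (k := 24)
    (by simp [search, relax, Cmd.Writes, Cmd.set]; omega) |>.mono ?_)
  rintro s₂ - ⟨hagree₂, hq₂, hdom₂⟩
  have h₂ := h₁.mono hagree₂ le_rfl
  refine (storeBest_ensures h₂).mono ?_
  rintro s₃ - ⟨hlevel, hcell⟩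
  have hl : ∀ i < 6, best s₂ i = level s₃ (r + 1) v j i := fun i hi => (hlevel i hi).symm
  refine ⟨⟨hq₂.congr hl, fun c => (hdom₂ c).congr hl⟩, fun a ha p hp => ?_⟩
  rw [hcell a ha p hp, hagree₂ a ha, hagree₁ a ha]

/-- The entry for the target `j` at `v` in round `r + 1` is optimal with respect to round `r`. -/
def TableLevel (G : Game (Fin n) ℚ) (low pm : Fin n → ℚ) (s : Mem) (r : ℕ) (v : Fin n)
    (j : Fin (n + 1)) : Prop :=
  G.IsEntry low pm (tab n s r) r v j (level s (r + 1) v j) ∧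
    ∀ c, G.Dominates low (tab n s r) v j (level s (r + 1) v j) c

theorem TableLevel.congr {s' : Mem}
    (hl : ∀ a < 24, ∀ (u : Fin n) (k : Fin (n + 1)), s' (a, r, u, k) = s (a, r, u, k))
    (hl' : ∀ a < 24, s' (a, r + 1, v, j) = s (a, r + 1, v, j)) (h : G.TableLevel low pm s r v j) :
    G.TableLevel low pm s' r v j := by
  have ht : tab n s' r = tab n s r := by
    funext u k
    unfold tab
    rw [hl 18 (by norm_num), hl 19 (by norm_num)]
  have hq : ∀ i < 6, level s (r + 1) v j i = level s' (r + 1) v j i :=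
    fun i hi => (hl' (18 + i) (by omega)).symm
  unfold TableLevel
  rw [ht]
  exact ⟨h.1.congr hq, fun c => (h.2 c).congr hq⟩

/-- The entries in the set `P` have been computed. -/
def Computed (G : Game (Fin n) ℚ) (low pm : Fin n → ℚ) (P : ℕ → Fin n → Fin (n + 1) → Prop)
    (s : Mem) : Prop :=
  (∀ (v : Fin n) (j : Fin (n + 1)), s (18, 0, v, j) = 0) ∧
    ∀ r v j, P r v j → G.TableLevel low pm s r v j

theorem Computed.mono {P P' : ℕ → Fin n → Fin (n + 1) → Prop} (h : G.Computed low pm P s)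
    (hP : ∀ r v j, P' r v j → P r v j) : G.Computed low pm P' s :=
  ⟨h.1, fun r v j h' => h.2 r v j (hP r v j h')⟩

theorem Computed.update {P : ℕ → Fin n → Fin (n + 1) → Prop} (h : G.Computed low pm P s) {a : ℕ}
    (ha : a < 18) (q : ℚ) : G.Computed low pm P (Function.update s (a, 0, 0, 0) q) := by
  have key : ∀ b, 18 ≤ b → ∀ p, Function.update s (a, 0, 0, 0) q (b, p) = s (b, p) := by
    intro b hb p
    rw [Function.update_of_ne]
    intro he
    have : b = a := congrArg Prod.fst he
    omega
  refine ⟨fun v j => by rw [key _ le_rfl, h.1], fun r v j hP => ?_⟩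
  obtain ⟨h₁, h₂⟩ := h.2 r v j hP
  have ht : tab n (Function.update s (a, 0, 0, 0) q) r = tab n s r := by
    funext u k
    unfold tab
    rw [key 18 le_rfl, key 19 (by norm_num)]
  have hq : ∀ i < 6, level s (r + 1) v j i =
      level (Function.update s (a, 0, 0, 0) q) (r + 1) v j i :=
    fun i hi => (key (18 + i) (by omega) _).symm
  unfold TableLevel
  rw [ht]
  exact ⟨h₁.congr hq, fun c => (h₂ c).congr hq⟩

/-- At level `0` all flags are zero, so that the table is empty and there is nothing to bound; later
levels carry the bound in `IsEntry`. -/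
theorem Computed.isFrac {P : ℕ → Fin n → Fin (n + 1) → Prop} (h : G.Computed low pm P s)
    (hP : ∀ r' < r, ∀ v j, P r' v j) {w : Fin n} {i : Fin (n + 1)} {y : ℚ}
    (hy : tab n s r w i = some y) : IsFrac (G.levelDen r) (2 ^ G.size) y := by
  rw [tab_eq_some] at hy
  obtain ⟨h₁, rfl⟩ := hy
  rcases r with _ | r
  · exact absurd (h.1 w i) h₁
  · exact (h.2 r w i (hP r (Nat.lt_succ_self r) w i)).1.1

theorem tableCmd_ensures (hs : G.Loaded s) (hlow : ∀ w : Fin n, s (10, n, w, 0) = low w)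
    (hpms : ∀ w : Fin n, s (11, n, w, 0) = pm w) (hpm : ∀ w, pm w = n ↔ G.children w = ∅)
    (h0 : ∀ (v : Fin n) (j : Fin (n + 1)), s (18, 0, v, j) = 0) :
    Ensures G.size (bitBound G.size) tableCmd s fun s' =>
      ∀ r < n, ∀ v j, G.TableLevel low pm s' r v j := by
  have hn := G.le_size
  refine Ensures.for_above (n := n) (fun i => G.Computed low pm fun r _ _ => r < i)
    G.size_add_two_le hs.nodes (by omega) (by norm_num)
    (by simp [entry, start, search, relax, storeBest, store, Cmd.Writes, Cmd.set]; omega)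
    (fun i s q h => h.update (by norm_num) q) ⟨h0, by simp⟩ ?_
    (fun s' _ h r hr v j => h.2 r v j hr)
  intro r hr s₁ hagree₁ hcount₁ hinv₁
  have hs₁ := hs.mono hagree₁ (by norm_num)
  refine Ensures.for_above (n := n) (fun i => G.Computed low pm fun r' v _ =>
      r' < r ∨ r' = r ∧ (v : ℕ) < i)
    G.size_add_two_le hs₁.nodes (by omega) (by norm_num)
    (by simp [entry, start, search, relax, storeBest, store, Cmd.Writes, Cmd.set]; omega)
    (fun i s q h => h.update (by norm_num) q) (hinv₁.mono (by simp)) ?_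
    (fun s' _ h => h.mono fun r' v j h' => by have := v.2; omega)
  intro k hk s₂ hagree₂ hcount₂ hinv₂
  set v : Fin n := ⟨k, by simpa using hk⟩ with hv
  have hs₂ := hs₁.mono hagree₂ (by norm_num)
  -- Entries are computed in the lexicographic order of round, node and target.
  refine Ensures.for_above (n := n) (fun i => G.Computed low pm fun r' u j =>
      r' < r ∨ r' = r ∧ (u < v ∨ u = v ∧ (j : ℕ) < i))
    G.size_add_two_le hs₂.nodes (by omega) (by norm_num)
    (by simp [entry, start, search, relax, storeBest, store, Cmd.Writes, Cmd.set]; omega)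
    (fun i s q h => h.update (by norm_num) q)
    (hinv₂.mono fun r' u j h' => by simpa [Fin.lt_def, hv] using h') ?_
    (fun s' _ h => h.mono fun r' u j h' => by
      rcases h' with h' | ⟨h', h''⟩
      · exact .inl h'
      · refine .inr ⟨h', ?_⟩
        rcases Nat.lt_succ_iff_lt_or_eq.1 h'' with h3 | h3
        · exact .inl h3
        · exact .inr ⟨Fin.ext h3, j.2⟩)
  intro l hl s₃ hagree₃ hcount₃ hinv₃
  set j : Fin (n + 1) := ⟨l, hl⟩ with hj
  have hs₃ := hs₂.mono hagree₃ (by norm_num)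
  have h₃ : Context G low pm (tab n s₃ r) r v j s₃ :=
    { loaded := hs₃
      round := by rw [hagree₃ 15 (by norm_num), hagree₂ 15 (by norm_num), hcount₁]
      node := by rw [hagree₃ 16 (by norm_num), hcount₂]
      goal := hcount₃
      low_eq := fun w => by
        rw [hagree₃ 10 (by norm_num), hagree₂ 10 (by norm_num), hagree₁ 10 (by norm_num), hlow]
      pm_eq := fun w => by
        rw [hagree₃ 11 (by norm_num), hagree₂ 11 (by norm_num), hagree₁ 11 (by norm_num), hpms]
      tab_eq := rfl }
  refine (entry_ensures h₃ (fun w i y hy => hinv₃.isFrac (fun r' hr' _ _ => .inl hr') hy) hr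
    hpm).mono ?_
  rintro s₄ - ⟨⟨hentry, hdom⟩, hcell⟩
  -- Round `r` writes only to level `r + 1` of the tables, so the level it reads, and all earlier
  -- ones, stay as they were.
  have htab : ∀ r' ≤ r, ∀ a < 24, ∀ (u : Fin n) (k : Fin (n + 1)),
      s₄ (a, r', u, k) = s₃ (a, r', u, k) := by
    intro r' hr' a ha u k
    refine hcell a ha _ fun he => ?_
    simp only [Prod.mk.injEq] at he
    omega
  refine ⟨fun u k => by rw [htab 0 (Nat.zero_le _) 18 (by norm_num), hinv₃.1],
    fun r' u k hP => ?_⟩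
  by_cases heq : r' = r ∧ u = v ∧ k = j
  · obtain ⟨rfl, rfl, rfl⟩ := heq
    have ht : tab n s₄ r' = tab n s₃ r' := by
      funext u k
      unfold tab
      rw [htab r' le_rfl 18 (by norm_num), htab r' le_rfl 19 (by norm_num)]
    unfold TableLevel
    rw [ht]
    exact ⟨hentry, hdom⟩
  · have hP' : r' < r ∨ r' = r ∧ (u < v ∨ u = v ∧ (k : ℕ) < l) := by
      rcases hP with h | ⟨h, h' | ⟨h', h''⟩⟩
      · exact .inl h
      · exact .inr ⟨h, .inl h'⟩
      · refine .inr ⟨h, .inr ⟨h', ?_⟩⟩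
        rcases Nat.lt_succ_iff_lt_or_eq.1 h'' with h3 | h3
        · exact h3
        · exact absurd ⟨h, h', Fin.ext h3⟩ heq
    refine (hinv₃.2 r' u k hP').congr (htab r' (by omega)) fun a ha => hcell a ha _ fun he => heq ?_
    simp only [Prod.mk.injEq, add_left_inj] at he
    exact ⟨he.1, Fin.ext he.2.1, Fin.ext he.2.2⟩

end Game

/-! ### Initial state and output: programs and correctness -/

namespace RAM

/-- The root of the game. -/
def rootNode : Expr := read₁ 0 (.const 1)

/-- The target in variable `34` is better for the leader than the one in variable `35`. -/
def initCond : Expr :=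
  conj (.read 18 (var 0) rootNode (var 34)) (disj (equal (var 35) (var 0))
    (less (.read 19 (var 0) rootNode (var 35)) (.read 19 (var 0) rootNode (var 34))))

/-- The computation of the initial memory state. -/
def initCmd : Cmd :=
  .seq (.set 35 (var 0)) (.seq (.for_ 34 1 (.when initCond (.set 35 (var 34))))
    (.seq (.set 5 (.add (var 0) (.const 1)))
      (.write 5 (.const 1) (.const 0) (.const 0) (var 35))))

/-- An entry of the final tables. -/
def final (a : ℕ) : Expr := .read a (var 0) (var 37) (var 36)

/-- The weight of the first child. -/
def finalWeight : Expr :=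
  .div (.sub (read₁ 4 (final 23)) (read₁ 4 (var 36)))
    (.sub (read₁ 4 (final 23)) (read₁ 4 (final 21)))

/-- The move probability. -/
def actValue : Expr :=
  .add (.mul (equal (var 38) (final 20)) finalWeight)
    (.mul (equal (var 38) (final 22)) (.sub (.const 1) finalWeight))

/-- The next memory state. -/
def updateValue : Expr :=
  .add (.mul (equal (var 38) (final 22)) (final 23))
    (.mul (.sub (.const 1) (equal (var 38) (final 22)))
      (.add (.mul (equal (var 38) (final 20)) (final 21))
        (.mul (.sub (.const 1) (equal (var 38) (final 20))) (var 0))))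

/-- The output of the move probabilities and of the memory update function. -/
def outputCmd : Cmd :=
  .for_ 36 1 (.for_ 37 0 (.for_ 38 0 (.seq (.write 6 (var 36) (var 37) (var 38) actValue)
    (.write 7 (var 36) (var 37) (var 38) updateValue))))

/-- The computation of a strong Stackelberg equilibrium. -/
def sseCmd : Cmd := .seq lowCmd (.seq tableCmd (.seq initCmd outputCmd))

end RAM

namespace Game

open RAM Cmd

variable {n : ℕ} {G : Game (Fin n) ℚ} {s : Mem}

/-- The value `n` in variable `35` means that no entry has been found. It cannot be mistaken for a
state that was found, since the index `n` is that of the punishing state, which has no entry. -/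
theorem initCmd_ensures (hs : G.Loaded s) (hlast : tab n s n G.root (Fin.last n) = none) :
    Ensures G.size (bitBound G.size) initCmd s fun s' =>
      s' (5, 0, 0, 0) = (n + 1 : ℕ) ∧ ∃ i : Fin (n + 1), s' (5, 1, 0, 0) = (i : ℕ) ∧
        ∀ j y, tab n s n G.root j = some y → ∃ y', tab n s n G.root i = some y' ∧ y ≤ y' := by
  have hn := G.le_size
  have hB := G.size_add_two_le
  have hne : ∀ {j y}, tab n s n G.root j = some y → j ≠ Fin.last n := by
    rintro j y hy rfl
    simp [hlast] at hy
  refine Ensures.seq (Ensures.set_eq (q := n) (by simp [hs.nodes])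
    (fun _ => (bits_natCast_le n).trans (by omega)) ?_)
  set s₁ := Function.update s (35, 0, 0, 0) (n : ℚ) with hs₁
  have hagree₁ : AgreeBelow 34 s s₁ :=
    AgreeBelow.update (fun _ _ _ => rfl) (by norm_num) _ _
  have hl₁ := hs.mono hagree₁ (by norm_num)
  refine Ensures.seq (Ensures.for_above (n := n) (Q := fun s' => AgreeBelow 34 s₁ s' ∧
      ∃ i : Fin (n + 1), s' (35, 0, 0, 0) = (i : ℕ) ∧
        ∀ j y, tab n s n G.root j = some y → ∃ y', tab n s n G.root i = some y' ∧ y ≤ y')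
    (fun k s' => (s' (35, 0, 0, 0) = n ∧
        ∀ j : Fin (n + 1), (j : ℕ) < k → tab n s n G.root j = none) ∨
      ∃ (i : Fin (n + 1)) (y' : ℚ), s' (35, 0, 0, 0) = (i : ℕ) ∧ tab n s n G.root i = some y' ∧
        ∀ j : Fin (n + 1), (j : ℕ) < k → ∀ y, tab n s n G.root j = some y → y ≤ y')
    hB hl₁.nodes (by omega) (by norm_num) (by simp [Cmd.Writes, Cmd.set]; omega) ?_
    (.inl ⟨by simp [hs₁], by simp⟩) ?_ ?_ |>.mono ?_)
  · intro i s' q h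
    simpa [Function.update_apply] using h
  · intro k hk s₂ hagree₂ hcount hinv
    set j : Fin (n + 1) := ⟨k, hk⟩ with hj
    have hl₂ := hl₁.mono hagree₂ (by norm_num)
    have hsucc : ∀ j' : Fin (n + 1), (j' : ℕ) < k + 1 → (j' : ℕ) < k ∨ j' = j := fun j' h => by
      rcases Nat.lt_succ_iff_lt_or_eq.1 h with h | h
      · exact .inl h
      · exact .inr (Fin.ext h)
    have hroot : rootNode.eval s₂ = (G.root : ℕ) := by
      simp only [rootNode, Expr.eval_read₁, Expr.eval_const, Nat.floor_one, hl₂.root]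
    have htab : ∀ i : Fin (n + 1), tab n s₂ n G.root i = tab n s n G.root i := fun i => by
      unfold tab
      rw [hagree₂ 18 (by norm_num), hagree₂ 19 (by norm_num), hagree₁ 18 (by norm_num),
        hagree₁ 19 (by norm_num)]
    have h35 : (Expr.read 19 (var 0) rootNode (var 34)).eval s₂ = s₂ (19, n, G.root, j) := by
      simp only [Expr.eval_read, Expr.eval_var, hroot, hl₂.nodes, hcount, Nat.floor_natCast]
      rfl
    have h18 : (Expr.read 18 (var 0) rootNode (var 34)).eval s₂ = s₂ (18, n, G.root, j) := by
      simp only [Expr.eval_read, Expr.eval_var, hroot, hl₂.nodes, hcount, Nat.floor_natCast]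
      rfl
    have h19 : ∀ i : Fin (n + 1), s₂ (35, 0, 0, 0) = (i : ℕ) →
        (Expr.read 19 (var 0) rootNode (var 35)).eval s₂ = s₂ (19, n, G.root, i) := fun i hi => by
      simp only [Expr.eval_read, Expr.eval_var, hroot, hl₂.nodes, hi, Nat.floor_natCast]
    have hcond : initCond.eval s₂ ≠ 0 ↔ s₂ (18, n, G.root, j) ≠ 0 ∧ (s₂ (35, 0, 0, 0) = n ∨
        (Expr.read 19 (var 0) rootNode (var 35)).eval s₂ < s₂ (19, n, G.root, j)) := by
      rw [initCond, Expr.eval_conj_ne_zero, Expr.eval_disj_ne_zero, Expr.eval_equal_ne_zero,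
        Expr.eval_less_ne_zero, h18, h35, Expr.eval_var, Expr.eval_var, hl₂.nodes]
    refine Ensures.when (fun hc => ?_) (fun hc => ?_)
    · obtain ⟨c₁, c₂⟩ := hcond.1 hc
      refine Ensures.set_eq (q := (j : ℕ)) (by simp [hcount, hj]) (fun _ => bits_fin_le le_rfl j) ?_
      have hjs : tab n s n G.root j = some (s₂ (19, n, G.root, j)) := by
        rw [← htab, tab_eq_some]
        exact ⟨c₁, rfl⟩
      refine .inr ⟨j, _, by simp, hjs, fun j' hj' y hy => ?_⟩
      rcases hsucc j' hj' with h | rfl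
      · rcases hinv with ⟨h1, h2⟩ | ⟨i, y', h1, h2, h3⟩
        · simp [h2 j' h] at hy
        · rcases c₂ with c₂ | c₂
          · refine absurd ?_ (hne h2)
            rw [h1] at c₂
            exact Fin.ext (Nat.cast_injective c₂)
          · rw [h19 i h1] at c₂
            have h2' := h2
            rw [← htab, tab_eq_some] at h2'
            rw [h2'.2] at c₂
            exact (h3 j' h y hy).trans c₂.le
      · rw [hjs] at hy
        exact (Option.some.inj hy).ge
    · rcases hinv with ⟨h1, h2⟩ | ⟨i, y', h1, h2, h3⟩
      · refine .inl ⟨h1, fun j' hj' => ?_⟩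
        rcases hsucc j' hj' with h | rfl
        · exact h2 j' h
        · by_contra hcon
          obtain ⟨y, hy⟩ := Option.ne_none_iff_exists'.1 hcon
          rw [← htab, tab_eq_some] at hy
          exact hcond.2 ⟨hy.1, .inl h1⟩ hc
      · refine .inr ⟨i, y', h1, h2, fun j' hj' y hy => ?_⟩
        rcases hsucc j' hj' with h | rfl
        · exact h3 j' h y hy
        · by_contra hcon
          rw [← htab, tab_eq_some] at hy h2
          refine hcond.2 ⟨hy.1, .inr ?_⟩ hc
          rw [h19 i h1, h2.2, hy.2]
          exact not_le.1 hcon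
  · intro s' hagree hinv
    refine ⟨hagree, ?_⟩
    rcases hinv with ⟨h1, h2⟩ | ⟨i, y', h1, h2, h3⟩
    · exact ⟨Fin.last n, by simpa using h1, fun j y hy => by simp [h2 j j.2] at hy⟩
    · exact ⟨i, h1, fun j y hy => ⟨y', h2, h3 j j.2 y hy⟩⟩
  · rintro s₂ - ⟨hagree₂, i, hi, hbest⟩
    have hl₂ := hl₁.mono hagree₂ (by norm_num)
    refine Ensures.seq (Ensures.set_eq (q := (n + 1 : ℕ)) ?_ (fun _ => (bits_natCast_le _).trans ?_)
      (Ensures.write_three (x := 1) (y := 0) (z := 0) (q := (i : ℕ)) ?_ ?_ ?_ ?_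
        (fun _ => bits_fin_le le_rfl i) ⟨?_, i, ?_, hbest⟩))
    · simp [Expr.eval_add, hl₂.nodes, Expr.eval_const]
    · omega
    · simp [Expr.eval_const]
    · simp [Expr.eval_const]
    · simp [Expr.eval_const]
    · simp [hi]
    · simp
    · simp

/-- The move probability and the next memory state in the output are those given by the children
`w₁` and `w₂` and the memory states `j₁` and `j₂` (functions of the node and the memory state). -/
def IsOutputCell (G : Game (Fin n) ℚ) (w₁ w₂ : Fin n → Fin (n + 1) → ℚ)
    (j₁ j₂ : Fin n → Fin (n + 1) → Fin (n + 1)) (c : Fin (n + 1) × Fin n × Fin n) (s : Mem) :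
    Prop :=
  s (6, c.1, c.2.1, c.2.2) =
      (if ((c.2.2 : ℕ) : ℚ) = w₁ c.2.1 c.1 then
        weight G.target c.1 (j₁ c.2.1 c.1) (j₂ c.2.1 c.1) else 0) +
      (if ((c.2.2 : ℕ) : ℚ) = w₂ c.2.1 c.1 then
        1 - weight G.target c.1 (j₁ c.2.1 c.1) (j₂ c.2.1 c.1) else 0) ∧
    s (7, c.1, c.2.1, c.2.2) =
      (((if ((c.2.2 : ℕ) : ℚ) = w₂ c.2.1 c.1 then j₂ c.2.1 c.1
        else if ((c.2.2 : ℕ) : ℚ) = w₁ c.2.1 c.1 then j₁ c.2.1 c.1 else Fin.last n :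
          Fin (n + 1)) : ℕ) : ℚ)

/-- The alternative `j₁ = j₂` is for punishing moves, where the target of `j` need not lie between
the other two. -/
theorem bits_weight_le {j j₁ j₂ : Fin (n + 1)}
    (h : j₁ = j₂ ∨ G.target j₁ ≤ G.target j ∧ G.target j ≤ G.target j₂) (hn : 1 ≤ n)
    {p q : Prop} [Decidable p] [Decidable q] :
    bits ((if p then weight G.target j j₁ j₂ else 0) +
      (if q then 1 - weight G.target j j₁ j₂ else 0)) ≤ bitBound G.size := by
  rcases h with rfl | ⟨h₁, h₂⟩
  · have hB := G.size_add_two_le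
    rw [weight_eq_zero rfl]
    split_ifs <;> norm_num
    · exact bits_one_le.trans (by omega)
    · exact bits_zero_le.trans (by omega)
    · exact bits_one_le.trans (by omega)
    · exact bits_zero_le.trans (by omega)
  · have := G.bits_le_bitBound (r := 1) hn (G.isFrac_of_weight h₁ h₂ (a := if p then 1 else 0)
      (b := if q then 1 else 0) (by split_ifs <;> simp) (by split_ifs <;> simp))
    convert this using 2
    split_ifs <;> simp

/-- Arrays `6` and `7` have smaller numbers than the counters, so these loops need the rule
`forall_loop_on` with an explicit set of preserved arrays. -/
theorem outputCmd_ensures (hs : G.Loaded s) {w₁ w₂ : Fin n → Fin (n + 1) → ℚ}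
    {j₁ j₂ : Fin n → Fin (n + 1) → Fin (n + 1)}
    (h20 : ∀ (v : Fin n) (j : Fin (n + 1)), s (20, n, v, j) = w₁ v j)
    (h21 : ∀ (v : Fin n) (j : Fin (n + 1)), s (21, n, v, j) = (j₁ v j : ℕ))
    (h22 : ∀ (v : Fin n) (j : Fin (n + 1)), s (22, n, v, j) = w₂ v j)
    (h23 : ∀ (v : Fin n) (j : Fin (n + 1)), s (23, n, v, j) = (j₂ v j : ℕ))
    (hj : ∀ v j, j₁ v j = j₂ v j ∨
      G.target (j₁ v j) ≤ G.target j ∧ G.target j ≤ G.target (j₂ v j)) :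
    Ensures G.size (bitBound G.size) outputCmd s fun s' =>
      ∀ c, G.IsOutputCell w₁ w₂ j₁ j₂ c s' := by
  have hn := G.le_size
  have hB := G.size_add_two_le
  have hupd : ∀ a, 8 ≤ a → ∀ (c : Fin (n + 1) × Fin n × Fin n) (s : Mem) (q : ℚ),
      G.IsOutputCell w₁ w₂ j₁ j₂ c s →
      G.IsOutputCell w₁ w₂ j₁ j₂ c (Function.update s (a, 0, 0, 0) q) := by
    intro a ha c s q h
    unfold IsOutputCell at h ⊢
    rwa [Function.update_of_ne (by simp; omega), Function.update_of_ne (by simp; omega)]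
  refine (Ensures.forall_loop_on (n := n) (Inv := fun _ => True)
    (Dom := G.IsOutputCell w₁ w₂ j₁ j₂) (fun i c => (c.1 : ℕ) = i)
    (fun b => b ≠ 6 ∧ b ≠ 7 ∧ b < 36) hB hs.nodes (by omega)
    (by simp [Cmd.Writes]) (by norm_num) (by simp [Cmd.Writes]; omega) (fun _ _ _ => trivial)
    (hupd 36 (by norm_num)) trivial ?_).mono fun s' _ hs' c => hs'.2.2 c.1 c.1.2 c rfl
  rintro i₁ hi₁ s₁ hagree₁ hcount₁ -
  refine (Ensures.forall_loop_on (n := n) (Inv := fun _ => True)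
    (Dom := G.IsOutputCell w₁ w₂ j₁ j₂) (fun i c => (c.1 : ℕ) = i₁ ∧ (c.2.1 : ℕ) = i)
    (fun b => b ≠ 6 ∧ b ≠ 7 ∧ b < 37) hB
    (by rw [hagree₁ 0 (by norm_num), hs.nodes]) (by omega)
    (by simp [Cmd.Writes]) (by norm_num) (by simp [Cmd.Writes]; omega) (fun _ _ _ => trivial)
    (hupd 37 (by norm_num)) trivial ?_).mono fun s' _ hs' =>
      ⟨trivial, hs'.2.1, fun c hc => hs'.2.2 c.2.1 (by simp) c ⟨hc, rfl⟩⟩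
  rintro i₂ hi₂ s₂ hagree₂ hcount₂ -
  refine (Ensures.forall_loop_on (n := n) (Inv := fun _ => True)
    (Dom := G.IsOutputCell w₁ w₂ j₁ j₂)
    (fun i c => ((c.1 : ℕ) = i₁ ∧ (c.2.1 : ℕ) = i₂) ∧ (c.2.2 : ℕ) = i)
    (fun b => b ≠ 6 ∧ b ≠ 7 ∧ b < 38) hB
    (by rw [hagree₂ 0 (by norm_num), hagree₁ 0 (by norm_num), hs.nodes]) (by omega)
    (by simp [Cmd.Writes]) (by norm_num) (by simp [Cmd.Writes]; omega) (fun _ _ _ => trivial)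
    (hupd 38 (by norm_num)) trivial ?_).mono fun s' _ hs' =>
      ⟨trivial, hs'.2.1, fun c hc => hs'.2.2 c.2.2 (by simp) c ⟨hc, rfl⟩⟩
  rintro i₃ hi₃ s₃ hagree₃ hcount₃ -
  set j : Fin (n + 1) := ⟨i₁, hi₁⟩ with hjdef
  set v : Fin n := ⟨i₂, hi₂⟩ with hvdef
  set w : Fin n := ⟨i₃, hi₃⟩ with hwdef
  have hagree : ∀ b, b ≠ 6 ∧ b ≠ 7 ∧ b < 36 → ∀ p, s₃ (b, p) = s (b, p) := fun b hb p => by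
    rw [hagree₃ b ⟨hb.1, hb.2.1, by omega⟩, hagree₂ b ⟨hb.1, hb.2.1, by omega⟩, hagree₁ b hb]
  -- Stated for every memory that agrees with `s₃` outside the output arrays, because the
  -- expressions are evaluated both before and after the first write.
  have eval_values : ∀ s', (∀ b, b ≠ 6 ∧ b ≠ 7 → ∀ p, s' (b, p) = s₃ (b, p)) →
      (var 36).eval s' = (j : ℕ) ∧ (var 37).eval s' = (v : ℕ) ∧ (var 38).eval s' = (w : ℕ) ∧
      actValue.eval s' = (if ((w : ℕ) : ℚ) = w₁ v j then weight G.target j (j₁ v j) (j₂ v j)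
          else 0) +
        (if ((w : ℕ) : ℚ) = w₂ v j then 1 - weight G.target j (j₁ v j) (j₂ v j) else 0) ∧
      updateValue.eval s' = (((if ((w : ℕ) : ℚ) = w₂ v j then j₂ v j
        else if ((w : ℕ) : ℚ) = w₁ v j then j₁ v j else Fin.last n : Fin (n + 1)) : ℕ) : ℚ) := by
    intro s' hs'
    have hl' : G.Loaded s' := fun b hb p => by
      rw [hs' b (by omega), hagree b (by omega), hs b hb]
    have e36 : s' (36, 0, 0, 0) = (j : ℕ) := by
      rw [hs' 36 (by norm_num), hagree₃ 36 (by norm_num), hagree₂ 36 (by norm_num), hcount₁]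
    have e37 : s' (37, 0, 0, 0) = (v : ℕ) := by
      rw [hs' 37 (by norm_num), hagree₃ 37 (by norm_num), hcount₂]
    have e38 : s' (38, 0, 0, 0) = (w : ℕ) := by
      rw [hs' 38 (by norm_num), hcount₃]
    have hfin : ∀ a, a ≠ 6 ∧ a ≠ 7 ∧ a < 36 → (final a).eval s' = s (a, n, v, j) := fun a ha => by
      simp only [final, Expr.eval_read, Expr.eval_var, hl'.nodes, e36, e37, Nat.floor_natCast]
      rw [hs' a ⟨ha.1, ha.2.1⟩, hagree a ha]
    have e20 := (hfin 20 (by norm_num)).trans (h20 v j)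
    have e21 := (hfin 21 (by norm_num)).trans (h21 v j)
    have e22 := (hfin 22 (by norm_num)).trans (h22 v j)
    have e23 := (hfin 23 (by norm_num)).trans (h23 v j)
    have hw : finalWeight.eval s' = weight G.target j (j₁ v j) (j₂ v j) := by
      simp only [finalWeight, Expr.eval_div, Expr.eval_sub, Expr.eval_read₁, e21, e23,
        Expr.eval_var, e36, Nat.floor_natCast, hl'.target]
      rfl
    refine ⟨by simp [e36], by simp [e37], by simp [e38], ?_, ?_⟩
    · simp only [actValue, Expr.eval_add, Expr.eval_mul, Expr.eval_sub, Expr.eval_const,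
        Expr.eval_equal, Expr.eval_var, e38, e20, e22, hw, ite_mul, one_mul, zero_mul]
    · simp only [updateValue, Expr.eval_add, Expr.eval_mul, Expr.eval_sub, Expr.eval_const,
        Expr.eval_equal, Expr.eval_var, e38, e20, e21, e22, e23, hl'.nodes]
      split_ifs <;> simp
  obtain ⟨f36, f37, f38, fact, -⟩ := eval_values s₃ fun _ _ _ => rfl
  have hn1 : 1 ≤ n := Nat.one_le_iff_ne_zero.2 fun h => by have := v.2; omega
  refine Ensures.seq (Ensures.write_three f36 f37 f38 fact (fun _ => bits_weight_le (hj v j) hn1) ?_)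
  obtain ⟨g36, g37, g38, -, gupd⟩ := eval_values
    (Function.update s₃ (6, (j : ℕ), (v : ℕ), (w : ℕ))
      ((if ((w : ℕ) : ℚ) = w₁ v j then weight G.target j (j₁ v j) (j₂ v j) else 0) +
        (if ((w : ℕ) : ℚ) = w₂ v j then 1 - weight G.target j (j₁ v j) (j₂ v j) else 0)))
    fun b hb p => Function.update_of_ne (fun h => hb.1 (congrArg Prod.fst h)) _ _
  refine Ensures.write_three g36 g37 g38 gupd (fun _ => bits_fin_le le_rfl _)
    ⟨trivial, fun c hc => ?_, fun c hc => ?_⟩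
  · by_cases hcw : c = (j, v, w)
    · subst hcw
      exact ⟨by simp, by simp⟩
    · have hne : ((c.1 : ℕ), (c.2.1 : ℕ), (c.2.2 : ℕ)) ≠ ((j : ℕ), (v : ℕ), (w : ℕ)) := by
        intro h
        simp only [Prod.mk.injEq] at h
        exact hcw (Prod.ext (Fin.ext h.1) (Prod.ext (Fin.ext h.2.1) (Fin.ext h.2.2)))
      have key : ∀ (a b : ℕ) (s : Mem) (q : ℚ), Function.update s (b, (j : ℕ), (v : ℕ), (w : ℕ)) q
          (a, (c.1 : ℕ), (c.2.1 : ℕ), (c.2.2 : ℕ)) = s (a, c.1, c.2.1, c.2.2) := fun a b s q =>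
        Function.update_of_ne (fun h => hne (congrArg Prod.snd h)) _ _
      unfold IsOutputCell at hc ⊢
      rwa [key, key, key, key]
  · obtain ⟨⟨c₁, c₂⟩, c₃⟩ := hc
    have hcw : c = (j, v, w) := Prod.ext (Fin.ext c₁) (Prod.ext (Fin.ext c₂) (Fin.ext c₃))
    subst hcw
    exact ⟨by simp, by simp⟩

end Game

/-! ### From the final memory to an equilibrium -/

namespace Game

open RAM Cmd

variable {n : ℕ} {G : Game (Fin n) ℚ} {s : Mem} {low pm : Fin n → ℚ}
  {T T' : Fin n → Fin (n + 1) → Option ℚ} {r : ℕ} {v : Fin n} {j : Fin (n + 1)}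

theorem IsReply.congr {g g' : Fin n → ℚ} {a q : ℚ} (hg : ∀ w ∈ G.children v, g w = g' w)
    (h : G.IsReply v g a q) : G.IsReply v g' a q :=
  ⟨h.1.congr hg, h.2.1, fun hv => by
    obtain ⟨w, hw, h₁, h₂⟩ := h.2.2 hv
    exact ⟨w, hw, h₁, hg w hw ▸ h₂⟩⟩

theorem IsEntry.congr_tab {q : ℕ → ℚ} (hT : ∀ w ∈ G.children v, T w = T' w)
    (h : G.IsEntry low pm T r v j q) : G.IsEntry low pm T' r v j q := by
  refine ⟨h.1, h.2.imp id ?_⟩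
  rintro ⟨h₁, h₂, w₁, j₁, w₂, j₂, e₁, e₂, e₃, e₄, hA⟩
  exact ⟨h₁, h₂, w₁, j₁, w₂, j₂, e₁, e₂, e₃, e₄, hA.congr hT⟩

theorem isRow_of_tableLevel (h : ∀ j, G.TableLevel low pm s r v j) :
    IsRow G low G.target (Fin.last n) v (tab n s r) (tab n s (r + 1) v) where
  pun_eq := by
    by_contra hcon
    obtain ⟨y, hy⟩ := Option.ne_none_iff_exists'.1 hcon
    rw [tab_eq_some] at hy
    rcases (h (Fin.last n)).1.2 with ⟨-, -, -, -, ⟨h₀, -⟩ | ⟨-, -, h₁, -⟩⟩ | ⟨-, h₁, -⟩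
    exacts [hy.1 h₀, h₁ rfl, h₁ rfl]
  leaf hv j hj y := by
    rw [tab_eq_some, ← leafUtil_of_leaf _ hv, ← leafUtil_of_leaf _ hv]
    rcases (h j).1.2 with ⟨-, -, -, -, ⟨h₀, h₁⟩ | ⟨h₀, -, -, h₁, h₂⟩⟩ | ⟨-, -, w, _, _, _, _, _, _, _, hA⟩
    · exact ⟨fun h' => absurd h₀ h'.1, fun h' => absurd h'.1 (h₁ hv hj)⟩
    · refine ⟨fun h' => ⟨h₁, h'.2.symm.trans h₂⟩, fun h' => ⟨?_, h₂.trans h'.2.symm⟩⟩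
      exact fun h'' => one_ne_zero (h₀.symm.trans h'')
    · simpa [hv] using hA.mem₁
  ge j hj w₁ j₁ w₂ j₂ y hA := by
    obtain ⟨h₀, hle⟩ := (h j).2 (w₁, j₁, w₂, j₂) hj y hA
    exact ⟨_, tab_eq_some.2 ⟨h₀, rfl⟩, hle⟩
  attained hv j y hy := by
    rw [tab_eq_some] at hy
    rcases (h j).1.2 with ⟨-, -, -, -, ⟨h₀, -⟩ | ⟨-, h₁, -⟩⟩ |
      ⟨-, -, w₁, j₁, w₂, j₂, -, -, -, -, hA⟩
    · exact absurd h₀ hy.1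
    · exact absurd h₁ hv.ne_empty
    · exact ⟨w₁, j₁, w₂, j₂, hy.2 ▸ hA⟩

/-- All ranks are below `n`, so after `n` rounds the level is a solution; `n` is positive because
`v` is a node, and the last round is the one from `N` to `N + 1 = n`. -/
theorem isReply_final (hG : G.Acyclic) (h : ∀ r < n, ∀ v, G.LowLevel s r v) (v : Fin n) :
    G.IsReply v (fun w => s (10, n, w, 0)) (s (10, n, v, 0)) (s (11, n, v, 0)) := by
  obtain ⟨rank, hr, hc⟩ := hG.exists_rank
  obtain ⟨N, rfl⟩ : ∃ N, n = N + 1 := ⟨n - 1, by have := v.2; omega⟩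
  refine IsReply.congr ?_ (h N (Nat.lt_succ_self N) v)
  exact eq_pred_level (f := fun r v => s (10, r, (v : ℕ), 0)) hr
    (R := fun v low a => IsLow G v low a) (fun _ _ _ _ _ h => IsLow.unique h)
    (fun v => by simpa using hc v) (fun r hr v => (h r hr v).1) v

/-- The round `r` in the second part enters only through the denominator of the utility, which no
longer matters. -/
theorem tab_final (hG : G.Acyclic) (h : ∀ r < n, ∀ v j, G.TableLevel low pm s r v j) (v : Fin n) :
    IsRow G low G.target (Fin.last n) v (tab n s n) (tab n s n v) ∧
      ∀ j, ∃ r, G.IsEntry low pm (tab n s n) r v j (level s n v j) := by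
  obtain ⟨rank, hr, hc⟩ := hG.exists_rank
  obtain ⟨N, hN⟩ : ∃ N, n = N + 1 := ⟨n - 1, by have := v.2; omega⟩
  have heq : ∀ v, ∀ w ∈ G.children v, tab n s N w = tab n s (N + 1) w :=
    eq_pred_level (f := fun r v => tab n s r v) hr
      (R := fun v T row => IsRow G low G.target (Fin.last n) v T row)
      (fun _ _ _ _ _ h => IsRow.unique h) (fun v => by simpa [hN] using hc v)
      (fun r hr v => isRow_of_tableLevel (h r (hN ▸ hr) v))
  have hlt : N < n := by omega
  have e₁ : tab n s n = tab n s (N + 1) := by rw [← hN]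
  have e₂ : ∀ j, level s n v j = level s (N + 1) v j := fun j => by rw [← hN]
  rw [e₁]
  refine ⟨(isRow_of_tableLevel (h N hlt v)).congr (heq v), fun j => ⟨N, ?_⟩⟩
  rw [e₂]
  exact ((h N hlt v j).1).congr_tab (heq v)

/-- Recovers nodes and memory states from the rational numbers in the cells. At a leaf with a
default entry, arrays `20` and `22` contain `n`, which is no node, so the children are identified
only at inner nodes. -/
theorem exists_moves (hG : G.Acyclic) (hl : ∀ r < n, ∀ v, G.LowLevel s r v)
    (h : ∀ r < n, ∀ v j, G.TableLevel (fun w => s (10, n, w, 0)) (fun w => s (11, n, w, 0)) s r v j)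
    (v : Fin n) (j : Fin (n + 1)) :
    ∃ (w₁ : Fin n) (j₁ : Fin (n + 1)) (w₂ : Fin n) (j₂ : Fin (n + 1)),
      s (21, n, v, j) = (j₁ : ℕ) ∧ s (23, n, v, j) = (j₂ : ℕ) ∧
      (j₁ = j₂ ∨ G.target j₁ ≤ G.target j ∧ G.target j ≤ G.target j₂) ∧
      ((G.children v).Nonempty → s (20, n, v, j) = (w₁ : ℕ) ∧ s (22, n, v, j) = (w₂ : ℕ) ∧
        (∀ y, tab n s n v j = some y →
          Admissible G (fun w => s (10, n, w, 0)) G.target (tab n s n) v j w₁ j₁ w₂ j₂ y) ∧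
        (tab n s n v j = none → w₁ ∈ G.children v ∧ j₁ = Fin.last n ∧ w₂ ∈ G.children v ∧
          j₂ = Fin.last n ∧ s (10, n, w₂, 0) = s (10, n, v, 0))) := by
  obtain ⟨r, -, ⟨q₂, q₃, q₄, q₅, hq⟩ | ⟨q₀, -, w₁, j₁, w₂, j₂, q₂, q₃, q₄, q₅, hA⟩⟩ :=
    (tab_final hG h v).2 j
  · have hnone : (G.children v).Nonempty → ∀ y, tab n s n v j ≠ some y := fun hv y hy => by
      rw [tab_eq_some] at hy
      rcases hq with ⟨h₀, -⟩ | ⟨-, h₁, -⟩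
      exacts [hy.1 h₀, hv.ne_empty h₁]
    obtain ⟨w, hw⟩ : ∃ w : Fin n, (G.children v).Nonempty → w ∈ G.children v ∧
        s (11, n, v, 0) = (w : ℕ) ∧ s (10, n, w, 0) = s (10, n, v, 0) := by
      rcases (G.children v).eq_empty_or_nonempty with hv | hv
      · exact ⟨v, fun h => absurd hv h.ne_empty⟩
      · obtain ⟨w, h₁, h₂, h₃⟩ := (isReply_final hG hl v).2.2 hv
        exact ⟨w, fun _ => ⟨h₁, h₂, h₃⟩⟩
    refine ⟨w, Fin.last n, w, Fin.last n, q₃.trans (by simp), q₅.trans (by simp), .inl rfl,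
      fun hv => ?_⟩
    obtain ⟨h₁, h₂, h₃⟩ := hw hv
    exact ⟨q₂.trans h₂, q₄.trans h₂, fun y hy => absurd hy (hnone hv y),
      fun _ => ⟨h₁, rfl, h₁, rfl, h₃⟩⟩
  · have hsome : tab n s n v j = some (level s n v j 1) :=
      tab_eq_some.2 ⟨fun h₀ => one_ne_zero (q₀.symm.trans h₀), rfl⟩
    refine ⟨w₁, j₁, w₂, j₂, q₃, q₅, .inr ⟨hA.le₁, hA.le₂⟩, fun _ => ⟨q₂, q₄, fun y hy => ?_,
      fun hno => ?_⟩⟩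
    · rw [hsome] at hy
      exact Option.some.inj hy ▸ hA
    · simp [hsome] at hno

theorem exists_profile (hG : G.Acyclic) {s' : Mem} (hl : ∀ r < n, ∀ v, G.LowLevel s r v)
    (h : ∀ r < n, ∀ v j, G.TableLevel (fun w => s (10, n, w, 0)) (fun w => s (11, n, w, 0)) s r v j)
    {j₁ j₂ : Fin n → Fin (n + 1) → Fin (n + 1)}
    (h21 : ∀ (v : Fin n) (j : Fin (n + 1)), s (21, n, v, j) = (j₁ v j : ℕ))
    (h23 : ∀ (v : Fin n) (j : Fin (n + 1)), s (23, n, v, j) = (j₂ v j : ℕ))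
    {i : Fin (n + 1)}
    (hi : ∀ j y, tab n s n G.root j = some y → ∃ y', tab n s n G.root i = some y' ∧ y ≤ y')
    (hcount : s' (5, 0, 0, 0) = (n + 1 : ℕ)) (hinit : s' (5, 1, 0, 0) = (i : ℕ))
    (hout : ∀ c, G.IsOutputCell (fun v j => s (20, n, v, j)) (fun v j => s (22, n, v, j)) j₁ j₂ c s') :
    ∃ P : MemProfile (Fin n) (Fin (n + 1)), P.IsOutput s' ∧ G.toReal.IsSSEWithMemory P := by
  choose w₁ k₁ w₂ k₂ e₁ e₂ _ hmove using exists_moves hG hl h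
  -- Both functions are read from the same cells.
  obtain rfl : j₁ = k₁ := by
    funext v j
    exact Fin.ext (Nat.cast_injective (R := ℚ) ((h21 v j).symm.trans (e₁ v j)))
  obtain rfl : j₂ = k₂ := by
    funext v j
    exact Fin.ext (Nat.cast_injective (R := ℚ) ((h23 v j).symm.trans (e₂ v j)))
  set t : Tables (Fin n) (Fin (n + 1)) ℚ :=
    { low := fun w => s (10, n, w, 0)
      val := tab n s n
      fst := fun j v => w₁ v j
      fstMem := fun j v => j₁ v j
      snd := fun j v => w₂ v j
      sndMem := fun j v => j₂ v j } with ht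
  have hvalid : t.Valid G G.target (Fin.last n) :=
    { low := fun v => (isReply_final hG hl v).1
      row := fun v => (tab_final hG h v).1
      target := fun v hv => ⟨v.castSucc, (Fin.castSucc_lt_last v).ne, by
        simp [target, leafUtil_of_leaf _ hv]⟩
      move := fun v hv j => (hmove v j hv).2.2.1
      punish := fun v hv j => (hmove v j hv).2.2.2 }
  -- The probabilities are taken from the output memory itself, leaving nothing to prove about them
  -- in `IsOutput`.
  set P : MemProfile (Fin n) (Fin (n + 1)) :=
    { act := fun j v w => ((s' (6, j, v, w) : ℚ) : ℝ)
      update := fun j v w => if ((w : ℕ) : ℚ) = s (22, n, v, j) then j₂ v j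
        else if ((w : ℕ) : ℚ) = s (20, n, v, j) then j₁ v j else Fin.last n
      init := i } with hP
  refine ⟨P, ⟨hcount, hinit, fun _ _ _ => rfl, fun m v w => (hout (m, v, w)).2⟩,
    Tables.Implements.isSSEWithMemory (t := t.toReal) hG ?_ hvalid.toReal ?_⟩
  · have hnode : ∀ {w u : Fin n} {q : ℚ}, q = (u : ℕ) → (((w : ℕ) : ℚ) = q ↔ w = u) := by
      rintro w u q rfl
      rw [Nat.cast_inj, Fin.ext_iff]
    constructor
    · intro j v hv w
      obtain ⟨f₁, f₂, -⟩ := hmove v j hv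
      have := (hout (j, v, w)).1
      simp only [hnode f₁, hnode f₂] at this
      simp only [hP, this, weight_cast, Tables.toReal, ht]
      split_ifs <;> simp
    · intro j v hv w
      obtain ⟨f₁, f₂, -⟩ := hmove v j hv
      simp only [hP, hnode f₁, hnode f₂, Tables.toReal, ht]
  · intro j y hy
    obtain ⟨q, hq, rfl⟩ := Option.map_eq_some_iff.1 hy
    obtain ⟨q', hq', hle⟩ := hi j q hq
    exact ⟨q', Option.map_eq_some_iff.2 ⟨q', hq', rfl⟩, by exact_mod_cast hle⟩

theorem sseCmd_ensures (hG : G.Acyclic) :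
    Ensures G.size (bitBound G.size) sseCmd G.input fun s' =>
      ∃ P : MemProfile (Fin n) (Fin (n + 1)), P.IsOutput s' ∧ G.toReal.IsSSEWithMemory P := by
  have hs : G.Loaded G.input := fun _ _ _ => rfl
  refine Ensures.seq ((lowCmd_ensures G.size_add_two_le G.le_size hs).mono ?_)
  intro s₁ hframe₁ hlow₁
  have hs₁ : G.Loaded s₁ := fun b hb p =>
    hframe₁ b (by simp [lowCmd, lowRound, lowSearch, Cmd.Writes, Cmd.set]; omega) p
  -- At an inner node the cell contains the number of a child, which is less than `n`.
  have hpm : ∀ w : Fin n, s₁ (11, n, w, 0) = n ↔ G.children w = ∅ := by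
    intro w
    refine ⟨fun h => ?_, (isReply_final hG hlow₁ w).2.1⟩
    by_contra hne
    obtain ⟨u, -, hu, -⟩ := (isReply_final hG hlow₁ w).2.2 (Finset.nonempty_iff_ne_empty.2 hne)
    have := u.2
    have := Nat.cast_injective (R := ℚ) (hu.symm.trans h)
    omega
  refine Ensures.seq ((tableCmd_ensures hs₁ (fun _ => rfl) (fun _ => rfl) hpm fun v j => ?_).mono ?_)
  · rw [hframe₁ 18 (by simp [lowCmd, lowRound, lowSearch, Cmd.Writes, Cmd.set])]
    rfl
  intro s₂ hframe₂ htable₂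
  have hw₂ : ∀ b < 15, ∀ p, s₂ (b, p) = s₁ (b, p) := fun b hb p => hframe₂ b (by
    simp [tableCmd, entry, start, search, relax, storeBest, store, Cmd.Writes, Cmd.set]; omega) p
  have hs₂ : G.Loaded s₂ := hs₁.mono (k := 15) hw₂ (by norm_num)
  have hlow₂ : ∀ r < n, ∀ v, G.LowLevel s₂ r v := fun r hr v => by
    simpa only [LowLevel, hw₂ 10 (by norm_num), hw₂ 11 (by norm_num)] using hlow₁ r hr v
  have htab₂ : ∀ r < n, ∀ v j,
      G.TableLevel (fun w => s₂ (10, n, w, 0)) (fun w => s₂ (11, n, w, 0)) s₂ r v j := by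
    simpa only [hw₂ 10 (by norm_num), hw₂ 11 (by norm_num)] using htable₂
  choose w₁ j₁ w₂ j₂ h21 h23 hj _ using exists_moves hG hlow₂ htab₂
  refine Ensures.seq ((initCmd_ensures hs₂ (tab_final hG htab₂ G.root).1.pun_eq).mono ?_)
  rintro s₃ hframe₃ ⟨hcount, i, hinit, hbest⟩
  have hw₃ : ∀ b, b ≠ 5 → b < 34 → ∀ p, s₃ (b, p) = s₂ (b, p) := fun b hb hb' p => hframe₃ b (by
    simp [initCmd, Cmd.Writes, Cmd.set]; omega) p
  have hs₃ : G.Loaded s₃ := hs₂.mono (k := 5) (fun b hb p => hw₃ b (by omega) (by omega) p) le_rfl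
  refine (outputCmd_ensures hs₃ (w₁ := fun v j => s₂ (20, n, v, j))
    (w₂ := fun v j => s₂ (22, n, v, j)) (fun v j => hw₃ 20 (by norm_num) (by norm_num) _)
    (fun v j => (hw₃ 21 (by norm_num) (by norm_num) _).trans (h21 v j))
    (fun v j => hw₃ 22 (by norm_num) (by norm_num) _)
    (fun v j => (hw₃ 23 (by norm_num) (by norm_num) _).trans (h23 v j)) hj).mono ?_
  intro s₄ hframe₄ hout
  have h5 : ∀ p, s₄ (5, p) = s₃ (5, p) := hframe₄ 5 (by simp [outputCmd, Cmd.Writes])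
  exact exists_profile hG hlow₂ htab₂ h21 h23 hbest ((h5 _).trans hcount) ((h5 _).trans hinit) hout

end Game

theorem theorem1 :
    ∃ C : ℕ,
      (∀ (V : Type*) [Fintype V] (G : Game V ℝ), G.Acyclic →
        ∃ (M : Type) (_ : Fintype M) (P : MemProfile V M),
          Fintype.card M ≤ C * Fintype.card V ∧ G.IsSSEWithMemory P) ∧
      ∃ (prog : RAM.Prog) (p : Polynomial ℕ),
        ∀ (n : ℕ) (G : Game (Fin n) ℚ), G.Acyclic →
          ∃ (s : RAM.Mem) (t : ℕ), RAM.Run prog G.input s t ∧ t ≤ p.eval G.size ∧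
            ∃ (k : ℕ) (P : MemProfile (Fin n) (Fin k)),
              k ≤ C * n ∧ P.IsOutput s ∧ G.toReal.IsSSEWithMemory P := by
  obtain ⟨q, hq⟩ := Game.exists_bitBound_eq
  obtain ⟨p, hp⟩ := RAM.sseCmd.exists_cost_eq q
  -- There are `|V| + 1` memory states, and `|V| + 1 ≤ 2 * |V|` because the root is a node.
  refine ⟨2, fun V _ G hG => ?_, RAM.sseCmd.toProg, p, fun n G hG => ?_⟩
  · obtain ⟨P, hP⟩ := Game.exists_isSSEWithMemory hG
    have : 0 < Fintype.card V := Fintype.card_pos_iff.2 ⟨G.root⟩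
    exact ⟨_, inferInstance, P, by simp only [Fintype.card_option, Fintype.card_fin]; omega, hP⟩
  · obtain ⟨s, t, hrun, ht, -, -, P, hout, hP⟩ := Game.sseCmd_ensures hG G.bitBound_input
    refine ⟨s, t, hrun, ?_, n + 1, P, ?_, hout, hP⟩
    · rwa [hq, hp] at ht
    · have := G.root.2
      omega
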